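/- Let $d\ge 1$. For $\varphi,f\in L^2(\mathbf R^d)$ let $$V_\varphi f(x,\xi)=(2\pi)^{-d/2}\int_{\mathbf R^d} f(y)\overline{\varphi(y-x)}\,e^{-i\langle y,\xi\rangle}\,dy,\qquad x,\xi\in\mathbf R^d,$$ be the short-time Fourier transform, with the usual extension $V_{\varphi}f(x,\xi)=(2\pi)^{-d/2}\langle f,\overline{\varphi(\cdot-x)}e^{-i\langle\cdot,\xi\rangle}\rangle$ to tempered distributions $f$ when $\varphi$ is a Schwartz function. Let $\phi_0(x)=\pi^{-d/4}e^{-|x|^2/2}$. For $1\le p<\infty$ the modulation space $M^p(\mathbf R^d)$ consists of all tempered distributions $f$ with $\|f\|_{M^p}=\|V_{\phi_0}f\|_{L^p(\mathbf R^{2d})}<\infty$. For a Young function $\Phi:[0,\infty]\to[0,\infty]$ (convex, $\Phi(0)=0$, $\lim_{t\to\infty}\Phi(t)=\Phi(\infty)=\infty$) the Orlicz modulation space $M^\Phi(\mathbf R^d)$ consists of all tempered distributions $f$ with $$\|f\|_{M^\Phi}=\inf\Big\{\lambda>0:\iint_{\mathbf R^{2d}}\Phi\big(|V_{\phi_0}f(x,\xi)|/\lambda\big)\,dxd\xi\le1\Big\}<\infty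 .$$ These spaces carry the topologies given by their norms. **Theorem.** Let $\Phi$ be a Young function such that $\Phi(t)=-t^2\log t$ for $0\le t\le t_0$, for some $t_0>0$ (with $0\log0=0$), and let $\phi\in M^1(\mathbf R^d)\setminus 0$. Then $M^p(\mathbf R^d)\subseteq L^2(\mathbf R^d)$ for $1\le p<2$, $M^\Phi(\mathbf R^d)\subseteq L^2(\mathbf R^d)$, and $M^2(\mathbf R^d)=L^2(\mathbf R^d)$. Consider, for $f\in L^2(\mathbf R^d)$, the entropy functional $$E_\phi(f)=-\iint_{\mathbf R^{2d}}|V_\phi f(x,\xi)|^2\log|V_\phi f(x,\xi)|^2\,dxd\xi+\|V_\phi f\|_{L^2}^2\log\|V_\phi f\|_{L^2}^2\in(-\infty,\infty].$$ 1. $E_\phi$ is finite and continuous on $M^\Phi(\mathbf R^d)$ and on $M^p(\mathbf R^d)$ for every $1\le p<2$. 2. $E_\phi$ is discontinuous on $M^2(\mathbf R^d)=L^2(\mathbf R^d)$. Moreover, the Gaussians $f_\lambda(x)=\pi^{-d/4}\lambda^{d/4}e^{-\lambda|x|^2/2}$, $\lambda>0$, satisfy $\|f_\lambda\|_{L^2}=1$,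 and $E_\phi(f_\lambda)\to\infty$ both as $\lambda\to\infty$ and as $\lambda\to0+$. -/

import Mathlib

open MeasureTheory Filter Topology
open scoped ENNReal NNReal SchwartzMap

/-- The Euclidean space `ℝ^d`. -/
abbrev RSpace (d : ℕ) : Type := EuclideanSpace ℝ (Fin d)

section GaussianAtom

theorem one_add_pow_mul_exp_le (N : ℕ) {r : ℝ} (hr : 0 ≤ r) :
    (1 + r) ^ N * Real.exp (-(r ^ 2 / 2)) ≤ N.factorial * Real.exp (3 / 2) := by
  have h1 : (1 + r) ^ N ≤ N.factorial * Real.exp (1 + r) := by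
    have h := Real.pow_div_factorial_le_exp (1 + r) (by linarith) N
    have hN : (0 : ℝ) < N.factorial := by exact_mod_cast N.factorial_pos
    rw [div_le_iff₀ hN] at h
    linarith
  have h2 : Real.exp (-(r ^ 2 / 2)) ≤ Real.exp (1 / 2 - r) :=
    Real.exp_le_exp.2 (by nlinarith [sq_nonneg (r - 1)])
  calc (1 + r) ^ N * Real.exp (-(r ^ 2 / 2))
      ≤ (N.factorial * Real.exp (1 + r)) * Real.exp (1 / 2 - r) := by gcongr
    _ = N.factorial * Real.exp (3 / 2) := by
      rw [mul_assoc, ← Real.exp_add]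
      ring_nf

/-- The exponent `-|y - x|² / 2 - i ⟨y, ξ⟩`. -/
noncomputable def atomPhase {d : ℕ} (x ξ y : RSpace d) : ℂ :=
  -(((‖y - x‖ ^ 2 / 2 : ℝ)) : ℂ) - Complex.I * ((inner ℝ y ξ : ℝ) : ℂ)

theorem atomPhase_hasTemperateGrowth {d : ℕ} (x ξ : RSpace d) :
    (atomPhase x ξ).HasTemperateGrowth := by
  have h1 : (fun y : RSpace d => ‖y - x‖ ^ 2).HasTemperateGrowth :=
    (Function.hasTemperateGrowth_norm_sq (H := RSpace d)).comp
      (Function.HasTemperateGrowth.id'.sub (Function.HasTemperateGrowth.const x))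
  have h2 : (fun y : RSpace d => (((‖y - x‖ ^ 2 / 2 : ℝ)) : ℂ)).HasTemperateGrowth := by
    have h3 : (fun y : RSpace d => ‖y - x‖ ^ 2 * (2⁻¹ : ℝ)).HasTemperateGrowth :=
      h1.mul (Function.HasTemperateGrowth.const (2⁻¹ : ℝ))
    have h5 := Function.HasTemperateGrowth.comp Function.Complex.hasTemperateGrowth_ofReal h3
    simpa only [div_eq_mul_inv, Function.comp_def] using h5
  have h4 : (fun y : RSpace d => ((inner ℝ y ξ : ℝ) : ℂ)).HasTemperateGrowth :=
    Function.HasTemperateGrowth.comp Function.Complex.hasTemperateGrowth_ofReal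
      (Function.hasTemperateGrowth_inner_left ξ)
  exact h2.neg.sub ((Function.HasTemperateGrowth.const Complex.I).mul h4)

theorem norm_cexp_atomPhase {d : ℕ} (x ξ y : RSpace d) :
    ‖Complex.exp (atomPhase x ξ y)‖ = Real.exp (-(‖y - x‖ ^ 2 / 2)) := by
  rw [Complex.norm_exp]
  congr 1
  simp [atomPhase]
  norm_cast

theorem norm_iteratedFDeriv_cexp (n : ℕ) (z : ℂ) :
    ‖iteratedFDeriv ℝ n Complex.exp z‖ ≤ ‖Complex.exp z‖ := by
  have h : iteratedFDeriv ℝ n Complex.exp z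
      = (iteratedFDeriv ℂ n Complex.exp z).restrictScalars ℝ := by
    have := (Complex.contDiff_exp (𝕜 := ℂ) (n := n)).contDiffAt (x := z)
    exact this.restrictScalars_iteratedFDeriv.symm
  rw [h]
  simp [norm_iteratedFDeriv_eq_norm_iteratedDeriv, iteratedDeriv_eq_iterate, Complex.iter_deriv_exp]

theorem cexp_atomPhase_decay {d : ℕ} (x ξ : RSpace d) (k n : ℕ) :
    ∃ C : ℝ, ∀ y : RSpace d,
      ‖y‖ ^ k * ‖iteratedFDeriv ℝ n (Complex.exp ∘ atomPhase x ξ) y‖ ≤ C := by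
  obtain ⟨m, C, hC, hb⟩ := (atomPhase_hasTemperateGrowth x ξ).norm_iteratedFDeriv_le_uniform n
  have key : ∀ y : RSpace d, ‖iteratedFDeriv ℝ n (Complex.exp ∘ atomPhase x ξ) y‖
      ≤ n.factorial * Real.exp (-(‖y - x‖ ^ 2 / 2)) * ((1 + C) * (1 + ‖y‖) ^ m) ^ n := by
    intro y
    have h1 : (1 : ℝ) ≤ (1 + ‖y‖) ^ m := one_le_pow₀ (by linarith [norm_nonneg y])
    refine norm_iteratedFDeriv_comp_le (𝕜 := ℝ) (N := (n : ℕ∞))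
      Complex.contDiff_exp ((atomPhase_hasTemperateGrowth x ξ).1.of_le (by exact_mod_cast le_top))
      le_rfl y ?_ ?_
    · intro i _
      rw [← norm_cexp_atomPhase x ξ y]
      exact norm_iteratedFDeriv_cexp i _
    · intro i hi hin
      have h2 : (1 : ℝ) ≤ (1 + C) * (1 + ‖y‖) ^ m := by nlinarith
      calc ‖iteratedFDeriv ℝ i (atomPhase x ξ) y‖ ≤ C * (1 + ‖y‖) ^ m := hb i hin y
        _ ≤ (1 + C) * (1 + ‖y‖) ^ m := by nlinarith
        _ ≤ ((1 + C) * (1 + ‖y‖) ^ m) ^ i := le_self_pow₀ h2 (by omega)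
  refine ⟨n.factorial * (1 + C) ^ n * (1 + ‖x‖) ^ (k + m * n) *
    ((k + m * n).factorial * Real.exp (3 / 2)), fun y => ?_⟩
  have hy : 1 + ‖y‖ ≤ (1 + ‖x‖) * (1 + ‖y - x‖) := by
    have h := norm_add_le (y - x) x
    rw [sub_add_cancel] at h
    nlinarith [mul_nonneg (norm_nonneg x) (norm_nonneg (y - x))]
  have hyk : ‖y‖ ^ k ≤ (1 + ‖y‖) ^ k :=
    pow_le_pow_left₀ (norm_nonneg y) (by linarith) k
  calc ‖y‖ ^ k * ‖iteratedFDeriv ℝ n (Complex.exp ∘ atomPhase x ξ) y‖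
      ≤ (1 + ‖y‖) ^ k *
        (n.factorial * Real.exp (-(‖y - x‖ ^ 2 / 2)) * ((1 + C) * (1 + ‖y‖) ^ m) ^ n) :=
        mul_le_mul hyk (key y) (norm_nonneg _) (by positivity)
    _ = n.factorial * (1 + C) ^ n *
        ((1 + ‖y‖) ^ (k + m * n) * Real.exp (-(‖y - x‖ ^ 2 / 2))) := by
        rw [mul_pow, ← pow_mul, pow_add]; ring
    _ ≤ n.factorial * (1 + C) ^ n *
        (((1 + ‖x‖) * (1 + ‖y - x‖)) ^ (k + m * n) * Real.exp (-(‖y - x‖ ^ 2 / 2))) := by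
        gcongr
    _ = n.factorial * (1 + C) ^ n * (1 + ‖x‖) ^ (k + m * n) *
        ((1 + ‖y - x‖) ^ (k + m * n) * Real.exp (-(‖y - x‖ ^ 2 / 2))) := by
        rw [mul_pow]; ring
    _ ≤ _ := by
        refine mul_le_mul_of_nonneg_left ?_ (by positivity)
        exact one_add_pow_mul_exp_le (k + m * n) (norm_nonneg (y - x))

/-- The Schwartz function `y ↦ φ₀(y - x) e^{-i⟨y, ξ⟩}`, where
`φ₀(y) = π^{-d/4} e^{-|y|²/2}` is the standard Gaussian. -/
noncomputable def gaussianAtom {d : ℕ} (x ξ : RSpace d) : 𝓢(RSpace d, ℂ) where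
  toFun y := ((Real.pi ^ (-(d : ℝ) / 4) : ℝ) : ℂ) * Complex.exp (atomPhase x ξ y)
  smooth' := by
    have h := (atomPhase_hasTemperateGrowth x ξ).1
    exact contDiff_const.mul (Complex.contDiff_exp.comp h)
  decay' := by
    intro k n
    obtain ⟨C, hC⟩ := cexp_atomPhase_decay x ξ k n
    set c : ℂ := ((Real.pi ^ (-(d : ℝ) / 4) : ℝ) : ℂ)
    refine ⟨‖c‖ * C, fun y => ?_⟩
    have h : iteratedFDeriv ℝ n (fun y => c * Complex.exp (atomPhase x ξ y)) y
        = c • iteratedFDeriv ℝ n (Complex.exp ∘ atomPhase x ξ) y := by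
      have hs : ContDiffAt ℝ n (Complex.exp ∘ atomPhase x ξ) y :=
        ((Complex.contDiff_exp.comp (atomPhase_hasTemperateGrowth x ξ).1).of_le
          (by exact_mod_cast le_top)).contDiffAt
      exact iteratedFDeriv_const_smul_apply (𝕜 := ℝ) (a := c) hs
    rw [h, norm_smul]
    calc ‖y‖ ^ k * (‖c‖ * ‖iteratedFDeriv ℝ n (Complex.exp ∘ atomPhase x ξ) y‖)
        = ‖c‖ * (‖y‖ ^ k * ‖iteratedFDeriv ℝ n (Complex.exp ∘ atomPhase x ξ) y‖) := by ring
      _ ≤ ‖c‖ * C := by gcongr; exact hC y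

end GaussianAtom

/-- The short-time Fourier transform of a tempered distribution `u` with the standard Gaussian
window `φ₀`, at `z = (x, ξ)`:
`V_{φ₀} u (x, ξ) = (2π)^{-d/2} ⟨u, conj φ₀(· - x) e^{-i⟨·, ξ⟩}⟩`. -/
noncomputable def gaussianSTFT {d : ℕ} (u : 𝓢'(RSpace d, ℂ)) (z : RSpace d × RSpace d) : ℂ :=
  (((2 * Real.pi) ^ (-(d : ℝ) / 2) : ℝ) : ℂ) * u (gaussianAtom z.1 z.2)

/-- A Young function `[0, ∞] → [0, ∞]`. -/
structure IsYoungFunction (Φ : ℝ≥0∞ → ℝ≥0∞) : Prop where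
  convex : ConvexOn ℝ≥0 Set.univ Φ
  map_zero : Φ 0 = 0
  tendsto_top : Tendsto Φ (𝓝[<] ⊤) (𝓝 ⊤)
  map_top : Φ ⊤ = ⊤

/-- The Orlicz (Luxemburg) norm of a function on `ℝ^{2d}`, with value `∞` outside `L^Φ`. -/
noncomputable def orliczNorm {d : ℕ} (Φ : ℝ≥0∞ → ℝ≥0∞) (F : RSpace d × RSpace d → ℂ) : ℝ≥0∞ :=
  sInf {a : ℝ≥0∞ | 0 < a ∧ a < ⊤ ∧ ∫⁻ z, Φ (‖F z‖ₑ / a) ≤ 1}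

/-- The norm of the modulation space `M^p = M^{p,p}`. -/
noncomputable def lebesgueModNorm {d : ℕ} (p : ℝ≥0∞) (u : 𝓢'(RSpace d, ℂ)) : ℝ≥0∞ :=
  eLpNorm (gaussianSTFT u) p volume

/-- The norm of the Orlicz modulation space `M^Φ`. -/
noncomputable def orliczModNorm {d : ℕ} (Φ : ℝ≥0∞ → ℝ≥0∞) (u : 𝓢'(RSpace d, ℂ)) : ℝ≥0∞ :=
  orliczNorm Φ (gaussianSTFT u)

/-- The set of all tempered distributions `u` with `N u < ∞`. -/
structure FiniteNormSpace {d : ℕ} (N : 𝓢'(RSpace d, ℂ) → ℝ≥0∞) where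
  val : 𝓢'(RSpace d, ℂ)
  norm_lt_top : N val < ⊤

/-- The norm topology: a set is open if it contains an `N`-ball about each of its points. -/
instance {d : ℕ} (N : 𝓢'(RSpace d, ℂ) → ℝ≥0∞) : TopologicalSpace (FiniteNormSpace N) where
  IsOpen s := ∀ u ∈ s, ∃ δ : ℝ≥0∞, 0 < δ ∧ ∀ v : FiniteNormSpace N, N (v.val - u.val) < δ → v ∈ s
  isOpen_univ := fun _ _ => ⟨1, one_pos, fun _ _ => Set.mem_univ _⟩
  isOpen_inter := by
    intro s t hs ht u hu
    obtain ⟨δ₁, h₁, H₁⟩ := hs u hu.1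
    obtain ⟨δ₂, h₂, H₂⟩ := ht u hu.2
    exact ⟨min δ₁ δ₂, lt_min h₁ h₂, fun v hv =>
      ⟨H₁ v (hv.trans_le (min_le_left _ _)), H₂ v (hv.trans_le (min_le_right _ _))⟩⟩
  isOpen_sUnion := by
    intro S hS u hu
    obtain ⟨s, hsS, hus⟩ := hu
    obtain ⟨δ, hδ, H⟩ := hS s hsS u hus
    exact ⟨δ, hδ, fun v hv => ⟨s, hsS, H v hv⟩⟩

/-- The modulation space `M^p(ℝ^d)` with its norm topology. -/
abbrev ModSpace (d : ℕ) (p : ℝ≥0∞) : Type :=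
  FiniteNormSpace (lebesgueModNorm (d := d) p)

/-- The Orlicz modulation space `M^Φ(ℝ^d)` with its norm topology. -/
abbrev OrliczModSpace (d : ℕ) (Φ : ℝ≥0∞ → ℝ≥0∞) : Type :=
  FiniteNormSpace (orliczModNorm (d := d) Φ)

/-- The tempered distribution `u` is (given by) the function `f ∈ L²(ℝ^d)`. -/
def IsL2Function {d : ℕ} (u : 𝓢'(RSpace d, ℂ)) (f : RSpace d → ℂ) : Prop :=
  MemLp f 2 volume ∧ ∀ ψ : 𝓢(RSpace d, ℂ), u ψ = ∫ y, ψ y * f y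

open Classical in
/-- The function `f ∈ L²(ℝ^d)`, unique almost everywhere, that gives `u ∈ L²(ℝ^d)`
(and `0` if `u` is not in `L²(ℝ^d)`). -/
noncomputable def l2Function {d : ℕ} (u : 𝓢'(RSpace d, ℂ)) : RSpace d → ℂ :=
  if h : ∃ f, IsL2Function u f then h.choose else 0

/-- The short-time Fourier transform of `f ∈ L²(ℝ^d)` with window `φ ∈ L²(ℝ^d)`:
`V_φ f (x, ξ) = (2π)^{-d/2} ∫ f(y) conj φ(y - x) e^{-i⟨y, ξ⟩} dy`. -/
noncomputable def stft {d : ℕ} (φ f : RSpace d → ℂ) (z : RSpace d × RSpace d) : ℂ :=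
  (((2 * Real.pi) ^ (-(d : ℝ) / 2) : ℝ) : ℂ) *
    ∫ y, f y * (starRingEnd ℂ) (φ (y - z.1)) *
      Complex.exp (-(Complex.I * ((inner ℝ y z.2 : ℝ) : ℂ)))

/-- The entropy functional
`E_φ(f) = -∬ |V_φ f|² log |V_φ f|² + ‖V_φ f‖² log ‖V_φ f‖²` on `L²(ℝ^d)`.
The integral is the integral of the positive part minus that of the negative part, and may
be `+∞`; `Real.negMulLog t = -t log t`, with `0 log 0 = 0`. -/
noncomputable def entropy {d : ℕ} (φ u : 𝓢'(RSpace d, ℂ)) : EReal :=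
  let V := stft (l2Function φ) (l2Function u)
  (((∫⁻ z, ENNReal.ofReal (Real.negMulLog (‖V z‖ ^ 2)) : ℝ≥0∞) : EReal)
      - ((∫⁻ z, ENNReal.ofReal (-Real.negMulLog (‖V z‖ ^ 2)) : ℝ≥0∞) : EReal))
    + (((∫ z, ‖V z‖ ^ 2) * Real.log (∫ z, ‖V z‖ ^ 2) : ℝ) : EReal)

/-- The Gaussian `f_r(x) = π^{-d/4} r^{d/4} e^{-r|x|²/2}`. -/
noncomputable def gaussianFamily {d : ℕ} (r : ℝ) (y : RSpace d) : ℂ :=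
  ((Real.pi ^ (-(d : ℝ) / 4) * r ^ ((d : ℝ) / 4) * Real.exp (-(r / 2 * ‖y‖ ^ 2)) : ℝ) : ℂ)

/-! Write `V u` for the transform with the Gaussian window. Everything rests on the reproducing
formula `apply_eq_integral_gaussianSTFT`: a Schwartz function is a superposition of Gaussian atoms,
weighted by its own transform and converging in every Schwartz seminorm, so a tempered distribution
may be applied under the integral. Moyal's identity and Cauchy–Schwarz then give `|u ψ| ≤ ‖V u‖₂
‖ψ‖₂`, hence `M² = L²`. Testing on an atom instead (`enorm_gaussianSTFT_le`) bounds `|V u|` by its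
own average against an integrable bounded kernel. Hence any modular of at least linear growth
controls `sup |V u|` (`exists_enorm_gaussianSTFT_le`).

Because of this sup bound only the values of `Φ` near zero matter. Finiteness of the `M^Φ` or `M^p`
norm, `p < 2`, becomes one condition, `SqLogBound`: after division by a multiple of the norm, `|V
u|` stays in a range where `-t² log t` is increasing, convex and at least `t²`, and its modular is
at most one. For a window `φ ∈ M¹`, `|V_φ f|` is dominated by an average of `|V f|` with the
integrable weight `|V φ|`, so Jensen's inequality carries the condition over to `V_φ f`
(`SqLogBound.of_average`, `exists_sqLogBound_stft`).

For continuity, `abs_sqLog_sub_le_add` bounds the increment of `-t² log t` from `b` to `a` by `ε (b²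
+ b² |log b|)` plus a constant depending on `ε` times the corresponding expression in `|a - b|`.
Integrated, the second term is small when the norm of the increment is small, and `ε` is arbitrary.

For the Gaussians, `‖V_φ f_r‖₂ = ‖φ‖₂` by Moyal, while `V_φ f_r → 0` uniformly
(`eventually_norm_stft_le`): for a compactly supported continuous window use `‖f_r‖₁ → 0` as `r → ∞`
and `‖f_r‖_∞ → 0` as `r → 0`. A fixed `L²` mass spread over ever smaller values has entropy tending
to infinity (`tendsto_entropy_top`). Multiples `c f_r` with small `c` show that the entropy is
unbounded in every `L²` ball about `0`, where it vanishes. -/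

/-! ### Integrals of Schwartz-valued families and tempered distributions -/

section SchwartzIntegral

open scoped BoundedContinuousFunction

/-- Continuous `n`-linear forms on `E`. -/
def SchwartzForm (E : Type*) [NormedAddCommGroup E] [NormedSpace ℝ E] (n : ℕ) : Type _ :=
  E [×n]→L[ℝ] ℂ

namespace SchwartzForm

variable (E : Type*) [NormedAddCommGroup E] [NormedSpace ℝ E] (n : ℕ)

noncomputable instance : NormedAddCommGroup (SchwartzForm E n) :=
  inferInstanceAs (NormedAddCommGroup (E [×n]→L[ℝ] ℂ))

noncomputable instance : NormedSpace ℂ (SchwartzForm E n) :=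
  inferInstanceAs (NormedSpace ℂ (E [×n]→L[ℝ] ℂ))

noncomputable instance : NormedSpace ℝ (SchwartzForm E n) :=
  inferInstanceAs (NormedSpace ℝ (E [×n]→L[ℝ] ℂ))

instance : CompleteSpace (SchwartzForm E n) :=
  inferInstanceAs (CompleteSpace (E [×n]→L[ℝ] ℂ))

variable {E n}

/-- Evaluation of forms at `m`. -/
noncomputable def eval (m : Fin n → E) : SchwartzForm E n →L[ℝ] ℂ :=
  ContinuousMultilinearMap.apply ℝ (fun _ : Fin n => E) ℂ m

end SchwartzForm

variable {E : Type*} [NormedAddCommGroup E] [NormedSpace ℝ E]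

/-- The `n`-th derivative of a Schwartz function. -/
noncomputable def SchwartzMap.formDeriv (n : ℕ) (ψ : 𝓢(E, ℂ)) (y : E) : SchwartzForm E n :=
  iteratedFDeriv ℝ n ψ y

theorem SchwartzMap.continuous_formDeriv (n : ℕ) (ψ : 𝓢(E, ℂ)) :
    Continuous (SchwartzMap.formDeriv n ψ) :=
  (ψ.smooth n).continuous_iteratedFDeriv le_rfl

/-- The bounded continuous function `y ↦ ‖y‖ ^ k • D^n ψ(y)`, linearly in the Schwartz
function `ψ`. -/
noncomputable def SchwartzMap.weightedDeriv (k n : ℕ) :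
    𝓢(E, ℂ) →ₗ[ℂ] (E →ᵇ SchwartzForm E n) where
  toFun ψ := BoundedContinuousFunction.ofNormedAddCommGroup
    (fun y => ‖y‖ ^ k • SchwartzMap.formDeriv n ψ y)
    ((continuous_norm.pow k).smul (SchwartzMap.continuous_formDeriv n ψ))
    (SchwartzMap.seminorm ℝ k n ψ)
    (fun y => by
      rw [norm_smul, norm_pow, norm_norm]
      exact SchwartzMap.le_seminorm ℝ k n ψ y)
  map_add' ψ χ := by
    ext1 y
    simp only [BoundedContinuousFunction.coe_ofNormedAddCommGroup,
      BoundedContinuousFunction.coe_add, Pi.add_apply]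
    rw [← smul_add]
    congr 1
    exact iteratedFDeriv_add_apply (ψ.smooth n).contDiffAt (χ.smooth n).contDiffAt
  map_smul' c ψ := by
    ext1 y
    simp only [BoundedContinuousFunction.coe_ofNormedAddCommGroup,
      BoundedContinuousFunction.coe_smul, RingHom.id_apply]
    rw [smul_comm]
    congr 1
    exact iteratedFDeriv_const_smul_apply (𝕜 := ℝ) (a := c) (ψ.smooth n).contDiffAt

theorem SchwartzMap.weightedDeriv_apply (k n : ℕ) (ψ : 𝓢(E, ℂ)) (y : E) :
    SchwartzMap.weightedDeriv k n ψ y = ‖y‖ ^ k • SchwartzMap.formDeriv n ψ y := rfl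

theorem SchwartzMap.norm_weightedDeriv_le (k n : ℕ) (ψ : 𝓢(E, ℂ)) :
    ‖SchwartzMap.weightedDeriv k n ψ‖ ≤ SchwartzMap.seminorm ℝ k n ψ := by
  refine (BoundedContinuousFunction.norm_le (apply_nonneg _ _)).2 fun y => ?_
  rw [SchwartzMap.weightedDeriv_apply, norm_smul, norm_pow, norm_norm]
  exact SchwartzMap.le_seminorm ℝ k n ψ y

theorem SchwartzMap.seminorm_le_norm_weightedDeriv (k n : ℕ) (ψ : 𝓢(E, ℂ)) :
    SchwartzMap.seminorm ℂ k n ψ ≤ ‖SchwartzMap.weightedDeriv k n ψ‖ := by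
  refine SchwartzMap.seminorm_le_bound ℂ k n ψ (norm_nonneg _) fun y => ?_
  have h := (SchwartzMap.weightedDeriv k n ψ).norm_coe_le_norm y
  rwa [SchwartzMap.weightedDeriv_apply, norm_smul, norm_pow, norm_norm] at h

theorem SchwartzMap.continuous_weightedDeriv (k n : ℕ) :
    Continuous (SchwartzMap.weightedDeriv (E := E) k n) := by
  refine continuous_of_continuousAt_zero
    ((SchwartzMap.weightedDeriv (E := E) k n).toAddMonoidHom) ?_
  have h0 : Tendsto (fun ψ : 𝓢(E, ℂ) => SchwartzMap.seminorm ℝ k n ψ) (𝓝 0) (𝓝 0) := by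
    have h := ((schwartz_withSeminorms ℝ E ℂ).continuous_seminorm (k, n)).tendsto (0 : 𝓢(E, ℂ))
    simpa [schwartzSeminormFamily_apply] using h
  have : Tendsto (fun ψ : 𝓢(E, ℂ) => SchwartzMap.weightedDeriv k n ψ) (𝓝 0) (𝓝 0) :=
    squeeze_zero_norm (fun ψ => SchwartzMap.norm_weightedDeriv_le k n ψ) h0
  simpa [ContinuousAt] using this

variable {Z : Type*} [TopologicalSpace Z] [MeasurableSpace Z] [OpensMeasurableSpace Z]
  {μ : Measure Z}

/-- Continuity of `T` bounds a seminorm of `T ψ` by finitely many seminorms of `ψ`, so the standing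
integrability assumption survives the passage to derivatives of the family. -/
theorem SchwartzMap.integrable_seminorm_comp {K : Z → 𝓢(E, ℂ)} (hK : Continuous K)
    (hint : ∀ k n, Integrable (fun z => SchwartzMap.seminorm ℝ k n (K z)) μ)
    (T : 𝓢(E, ℂ) →L[ℝ] 𝓢(E, ℂ)) (k n : ℕ) :
    Integrable (fun z => SchwartzMap.seminorm ℝ k n (T (K z))) μ := by
  have hc : Continuous fun ψ : 𝓢(E, ℂ) => SchwartzMap.seminorm ℝ k n (T ψ) :=
    ((schwartz_withSeminorms ℝ E ℂ).continuous_seminorm (k, n)).comp T.continuous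
  obtain ⟨S, C, -, hC⟩ := Seminorm.bound_of_continuous (schwartz_withSeminorms ℝ E ℂ)
    ((SchwartzMap.seminorm ℝ k n : Seminorm ℝ 𝓢(E, ℂ)).comp (T : 𝓢(E, ℂ) →ₗ[ℝ] 𝓢(E, ℂ))) hc
  refine Integrable.mono' (g := fun z => C * ∑ i ∈ S, SchwartzMap.seminorm ℝ i.1 i.2 (K z))
    ((integrable_finsetSum S fun i _ => hint i.1 i.2).const_mul _)
    (hc.comp hK).aestronglyMeasurable (Eventually.of_forall fun z => ?_)
  rw [Real.norm_of_nonneg (apply_nonneg _ _)]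
  refine (hC (K z)).trans ?_
  change C * (S.sup (schwartzSeminormFamily ℝ E ℂ)) (K z) ≤ _
  refine mul_le_mul_of_nonneg_left ?_ C.2
  refine Seminorm.finset_sup_apply_le (Finset.sum_nonneg fun i _ => apply_nonneg _ _) fun i hi => ?_
  exact Finset.single_le_sum (f := fun i : ℕ × ℕ => SchwartzMap.seminorm ℝ i.1 i.2 (K z))
    (fun i _ => apply_nonneg _ _) hi

theorem SchwartzMap.continuous_eval (y : E) : Continuous fun ψ : 𝓢(E, ℂ) => ψ y := by
  have h : Continuous fun ψ : 𝓢(E, ℂ) => SchwartzMap.toBoundedContinuousFunctionCLM ℝ E ℂ ψ y :=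
    (continuous_eval_const y).comp (SchwartzMap.toBoundedContinuousFunctionCLM ℝ E ℂ).continuous
  exact h

-- Differentiation under the integral along the line `y + t v`. The dominating function is the sup
-- seminorm of `∂_v (K z)`, which does not depend on `t`.
open LineDeriv in
theorem SchwartzMap.lineDerivOp_eq_integral {K : Z → 𝓢(E, ℂ)} (hK : Continuous K)
    (hint : ∀ k n, Integrable (fun z => SchwartzMap.seminorm ℝ k n (K z)) μ)
    {ψ : 𝓢(E, ℂ)} (hψ : ∀ y, ψ y = ∫ z, K z y ∂μ) (v y : E) :
    (∂_{v} ψ) y = ∫ z, (∂_{v} (K z)) y ∂μ := by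
  have hcont : ∀ x, Continuous fun z => K z x := fun x => (SchwartzMap.continuous_eval x).comp hK
  have hi : ∀ x, Integrable (fun z => K z x) μ := fun x =>
    (hint 0 0).mono' (hcont x).aestronglyMeasurable
      (Eventually.of_forall fun z => SchwartzMap.norm_le_seminorm ℝ (K z) x)
  have hline : HasDerivAt (fun t : ℝ => ∫ z, K z (y + t • v) ∂μ)
      (∫ z, (∂_{v} (K z)) y ∂μ) 0 := by
    have h0 : (fun z => (∂_{v} (K z)) y) = fun z => (∂_{v} (K z)) (y + (0 : ℝ) • v) := by simp
    rw [h0]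
    refine (hasDerivAt_integral_of_dominated_loc_of_deriv_le (s := Set.univ)
      (F := fun (t : ℝ) z => K z (y + t • v))
      (F' := fun (t : ℝ) z => (∂_{v} (K z)) (y + t • v))
      (bound := fun z => SchwartzMap.seminorm ℝ 0 0 (lineDerivOpCLM ℝ 𝓢(E, ℂ) v (K z)))
      Filter.univ_mem (Eventually.of_forall fun t => (hi _).aestronglyMeasurable) (hi _)
      ?_ ?_ ?_ ?_).2
    · exact ((SchwartzMap.continuous_eval _).comp
        ((lineDerivOpCLM ℝ 𝓢(E, ℂ) v).continuous.comp hK)).aestronglyMeasurable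
    · exact Eventually.of_forall fun z t _ => SchwartzMap.norm_le_seminorm ℝ _ _
    · exact SchwartzMap.integrable_seminorm_comp hK hint _ 0 0
    · refine Eventually.of_forall fun z t _ => ?_
      rw [SchwartzMap.lineDerivOp_apply_eq_fderiv]
      have h1 : HasDerivAt (fun t : ℝ => y + t • v) v t := by
        simpa using ((hasDerivAt_id t).smul_const v).const_add y
      exact ((K z).hasFDerivAt (y + t • v)).comp_hasDerivAt t h1
  have h2 : HasDerivAt (fun t : ℝ => ψ (y + t • v)) ((∂_{v} ψ) y) 0 := by
    rw [SchwartzMap.lineDerivOp_apply_eq_fderiv]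
    have h1 : HasDerivAt (fun t : ℝ => y + t • v) v 0 := by
      simpa using ((hasDerivAt_id (0 : ℝ)).smul_const v).const_add y
    have h3 := ψ.hasFDerivAt (y + (0 : ℝ) • v)
    have h4 := h3.comp_hasDerivAt (0 : ℝ) h1
    simpa [Function.comp_def] using h4
  simp only [hψ] at h2
  exact h2.unique hline

-- Induction that peels off the outermost line derivative: the family of lower derivatives is again
-- continuous with integrable seminorms, so the one-derivative case applies to it.
open LineDeriv in
theorem SchwartzMap.iteratedFDeriv_eq_integral {K : Z → 𝓢(E, ℂ)} (hK : Continuous K)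
    (hint : ∀ k n, Integrable (fun z => SchwartzMap.seminorm ℝ k n (K z)) μ)
    {ψ : 𝓢(E, ℂ)} (hψ : ∀ y, ψ y = ∫ z, K z y ∂μ) (n : ℕ) (m : Fin n → E) (y : E) :
    iteratedFDeriv ℝ n ψ y m = ∫ z, iteratedFDeriv ℝ n (K z) y m ∂μ := by
  simp only [← SchwartzMap.iteratedLineDerivOp_eq_iteratedFDeriv]
  induction n generalizing y with
  | zero => simpa using hψ y
  | succ n ih =>
    simp only [iteratedLineDerivOp_succ_left]
    exact SchwartzMap.lineDerivOp_eq_integral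
      ((iteratedLineDerivOpCLM ℝ 𝓢(E, ℂ) (Fin.tail m)).continuous.comp hK)
      (SchwartzMap.integrable_seminorm_comp hK hint (iteratedLineDerivOpCLM ℝ 𝓢(E, ℂ) (Fin.tail m)))
      (ih (Fin.tail m)) (m 0) y

/-- Continuous linear functionals on the Schwartz space factor through finitely many of the maps
`SchwartzMap.weightedDeriv`. -/
theorem SchwartzMap.exists_dual_weightedDeriv (u : 𝓢(E, ℂ) →L[ℂ] ℂ) :
    ∃ (S : Finset (ℕ × ℕ)) (ℓ : (Π i : S, E →ᵇ (SchwartzForm E i.1.2)) →L[ℂ] ℂ),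
      ∀ ψ, u ψ = ℓ (fun i => SchwartzMap.weightedDeriv i.1.1 i.1.2 ψ) := by
  obtain ⟨S, C, -, hC⟩ := Seminorm.bound_of_continuous (schwartz_withSeminorms ℂ E ℂ)
    ((normSeminorm ℂ ℂ).comp u.toLinearMap) (continuous_norm.comp u.continuous)
  let J : 𝓢(E, ℂ) →ₗ[ℂ] (Π i : S, E →ᵇ (SchwartzForm E i.1.2)) :=
    LinearMap.pi fun i => SchwartzMap.weightedDeriv i.1.1 i.1.2
  have hJ : ∀ ψ, ‖u ψ‖ ≤ C * ‖J ψ‖ := by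
    intro ψ
    refine (hC ψ).trans ?_
    change C * (S.sup (schwartzSeminormFamily ℂ E ℂ)) ψ ≤ _
    refine mul_le_mul_of_nonneg_left ?_ C.2
    refine Seminorm.finset_sup_apply_le (norm_nonneg _) fun i hi => ?_
    exact (SchwartzMap.seminorm_le_norm_weightedDeriv i.1 i.2 ψ).trans
      (norm_le_pi_norm (J ψ) ⟨i, hi⟩)
  -- `J.rangeRestrict` is onto, so the bound by `‖J ψ‖` makes `u` descend to a bounded functional on
  -- the range of `J`; Hahn–Banach extends it to the whole product.
  have hd : DenseRange J.rangeRestrict :=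
    (LinearMap.surjective_rangeRestrict J).denseRange
  obtain ⟨ℓ, hℓ, -⟩ := exists_extension_norm_eq (𝕜 := ℂ) (LinearMap.range J)
    (LinearMap.extendOfNorm u.toLinearMap J.rangeRestrict)
  refine ⟨S, ℓ, fun ψ => ?_⟩
  have h1 := LinearMap.extendOfNorm_eq (f := u.toLinearMap) (e := J.rangeRestrict) hd
    ⟨C, fun ψ => hJ ψ⟩ ψ
  have h2 := hℓ (J.rangeRestrict ψ)
  rw [h1] at h2
  exact h2.symm

variable [SecondCountableTopology Z]

/-- The Schwartz space is not normed, so the Bochner integral is taken in the Banach space of tuples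
of weighted derivatives through which `u` factors. That this integral is the tuple of `ψ` is checked
by evaluating at points and directions. -/
theorem SchwartzMap.apply_eq_integral (u : 𝓢(E, ℂ) →L[ℂ] ℂ) {K : Z → 𝓢(E, ℂ)}
    (hK : Continuous K)
    (hint : ∀ k n, Integrable (fun z => SchwartzMap.seminorm ℝ k n (K z)) μ)
    {ψ : 𝓢(E, ℂ)} (hψ : ∀ y, ψ y = ∫ z, K z y ∂μ) :
    u ψ = ∫ z, u (K z) ∂μ := by
  obtain ⟨S, ℓ, hℓ⟩ := SchwartzMap.exists_dual_weightedDeriv u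
  have hi : ∀ k n, Integrable (fun z => SchwartzMap.weightedDeriv k n (K z)) μ := fun k n =>
    (hint k n).mono' ((SchwartzMap.continuous_weightedDeriv k n).comp hK).aestronglyMeasurable
      (Eventually.of_forall fun z => SchwartzMap.norm_weightedDeriv_le k n (K z))
  have hint' : Integrable
      (fun z => (fun i : S => SchwartzMap.weightedDeriv i.1.1 i.1.2 (K z))) μ :=
    Integrable.of_eval fun i => hi _ _
  simp_rw [hℓ]
  rw [ContinuousLinearMap.integral_comp_comm ℓ hint']
  congr 1
  funext i
  rw [eval_integral fun i => hi _ _]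
  ext1 y
  have h := ContinuousLinearMap.integral_comp_comm
    (BoundedContinuousFunction.evalCLM ℝ (β := SchwartzForm E i.1.2) y) (hi i.1.1 i.1.2)
  simp only [BoundedContinuousFunction.evalCLM_apply] at h
  rw [← h]
  have hv : Integrable (fun z => SchwartzMap.weightedDeriv i.1.1 i.1.2 (K z) y) μ :=
    (BoundedContinuousFunction.evalCLM ℝ (β := SchwartzForm E i.1.2) y).integrable_comp (hi _ _)
  refine ContinuousMultilinearMap.ext fun m => ?_
  have h2 := ContinuousLinearMap.integral_comp_comm (SchwartzForm.eval m) hv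
  refine Eq.trans ?_ h2
  simp only [SchwartzMap.weightedDeriv_apply, map_smul]
  rw [integral_smul]
  have h3 := SchwartzMap.iteratedFDeriv_eq_integral hK hint hψ i.1.2 m y
  change ‖y‖ ^ i.1.1 • iteratedFDeriv ℝ i.1.2 ψ y m = _
  rw [h3]
  rfl

end SchwartzIntegral

/-! ### Dependence of the Gaussian atoms on the phase-space point -/

section GaussianAtomFamily

variable {d : ℕ}

/-- The function `exp(-|y - x|² / 2 - i ⟨y, ξ⟩)` of all the variables `((x, ξ), y)`. -/
noncomputable def atomKernel {d : ℕ} (w : (RSpace d × RSpace d) × RSpace d) : ℂ :=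
  Complex.exp (atomPhase w.1.1 w.1.2 w.2)

theorem atomPhase_uncurry_hasTemperateGrowth :
    (fun w : (RSpace d × RSpace d) × RSpace d =>
      atomPhase w.1.1 w.1.2 w.2).HasTemperateGrowth := by
  let px : ((RSpace d × RSpace d) × RSpace d) →L[ℝ] RSpace d :=
    (ContinuousLinearMap.fst ℝ _ _).comp (ContinuousLinearMap.fst ℝ _ _)
  let pξ : ((RSpace d × RSpace d) × RSpace d) →L[ℝ] RSpace d :=
    (ContinuousLinearMap.snd ℝ _ _).comp (ContinuousLinearMap.fst ℝ _ _)
  let py : ((RSpace d × RSpace d) × RSpace d) →L[ℝ] RSpace d := ContinuousLinearMap.snd ℝ _ _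
  have h1 : (fun w : (RSpace d × RSpace d) × RSpace d => ‖(py - px) w‖ ^ 2).HasTemperateGrowth :=
    (Function.hasTemperateGrowth_norm_sq (H := RSpace d)).comp (py - px).hasTemperateGrowth
  have h2 : (fun w : (RSpace d × RSpace d) × RSpace d =>
      (((‖(py - px) w‖ ^ 2 / 2 : ℝ)) : ℂ)).HasTemperateGrowth := by
    have h3 := h1.mul (Function.HasTemperateGrowth.const (2⁻¹ : ℝ))
    have h5 := Function.HasTemperateGrowth.comp Function.Complex.hasTemperateGrowth_ofReal h3
    simpa only [div_eq_mul_inv, Function.comp_def, Pi.mul_apply] using h5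
  have h4 : (fun w : (RSpace d × RSpace d) × RSpace d =>
      ((inner ℝ (py w) (pξ w) : ℝ) : ℂ)).HasTemperateGrowth :=
    Function.HasTemperateGrowth.comp Function.Complex.hasTemperateGrowth_ofReal
      ((innerSL ℝ).bilinear_hasTemperateGrowth py.hasTemperateGrowth pξ.hasTemperateGrowth)
  exact h2.neg.sub ((Function.HasTemperateGrowth.const Complex.I).mul h4)

theorem contDiff_atomKernel : ContDiff ℝ (⊤ : ℕ∞) (atomKernel (d := d)) :=
  Complex.contDiff_exp.comp atomPhase_uncurry_hasTemperateGrowth.1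

/-- The derivative bound for a composition with `exp` gives a Gaussian in `y - x` times a polynomial
in all variables. The part of the polynomial in `y - x` is absorbed by the Gaussian, and powers of
`1 + ‖z‖` remain. -/
theorem atomKernel_decay (k n : ℕ) :
    ∃ (C : ℝ) (N : ℕ), 0 ≤ C ∧ ∀ (z : RSpace d × RSpace d) (y : RSpace d),
      ‖y‖ ^ k * ‖iteratedFDeriv ℝ n (atomKernel (d := d)) (z, y)‖ ≤ C * (1 + ‖z‖) ^ N := by
  obtain ⟨m, C, hC, hb⟩ :=
    (atomPhase_uncurry_hasTemperateGrowth (d := d)).norm_iteratedFDeriv_le_uniform n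
  refine ⟨n.factorial * (1 + C) ^ n * 2 ^ (k + m * n) *
    ((k + m * n).factorial * Real.exp (3 / 2)), k + m * n, by positivity, fun z y => ?_⟩
  have key : ‖iteratedFDeriv ℝ n (atomKernel (d := d)) (z, y)‖
      ≤ n.factorial * Real.exp (-(‖y - z.1‖ ^ 2 / 2)) * ((1 + C) * (1 + ‖(z, y)‖) ^ m) ^ n := by
    have h1 : (1 : ℝ) ≤ (1 + ‖(z, y)‖) ^ m := one_le_pow₀ (by linarith [norm_nonneg (z, y)])
    refine norm_iteratedFDeriv_comp_le (𝕜 := ℝ) (N := (n : ℕ∞))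
      Complex.contDiff_exp
      ((atomPhase_uncurry_hasTemperateGrowth (d := d)).1.of_le (by exact_mod_cast le_top))
      le_rfl (z, y) ?_ ?_
    · intro i _
      rw [← norm_cexp_atomPhase z.1 z.2 y]
      exact norm_iteratedFDeriv_cexp i _
    · intro i hi hin
      -- The constant `1 + C` makes the base at least one, so that its `i`-th power, which the
      -- composition estimate asks for, dominates it for `i ≥ 1`.
      have h2 : (1 : ℝ) ≤ (1 + C) * (1 + ‖(z, y)‖) ^ m := by nlinarith
      refine (hb i hin (z, y)).trans (le_trans ?_ (le_self_pow₀ h2 (by omega)))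
      nlinarith
  have hx : ‖z.1‖ ≤ ‖z‖ := norm_fst_le z
  have hy0 : ‖y‖ ≤ ‖y - z.1‖ + ‖z.1‖ := by
    have h := norm_add_le (y - z.1) z.1
    rwa [sub_add_cancel] at h
  have hw : 1 + ‖(z, y)‖ ≤ 2 * (1 + ‖z‖) * (1 + ‖y - z.1‖) := by
    have h : ‖(z, y)‖ ≤ ‖z‖ + ‖y‖ :=
      max_le (le_add_of_nonneg_right (norm_nonneg y)) (le_add_of_nonneg_left (norm_nonneg z))
    nlinarith [mul_nonneg (norm_nonneg z) (norm_nonneg (y - z.1)), norm_nonneg z,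
      norm_nonneg (y - z.1)]
  have hyk : ‖y‖ ^ k ≤ (1 + ‖(z, y)‖) ^ k :=
    pow_le_pow_left₀ (norm_nonneg y) ((norm_snd_le (z, y)).trans (by linarith)) k
  calc ‖y‖ ^ k * ‖iteratedFDeriv ℝ n (atomKernel (d := d)) (z, y)‖
      ≤ (1 + ‖(z, y)‖) ^ k * (n.factorial * Real.exp (-(‖y - z.1‖ ^ 2 / 2)) *
        ((1 + C) * (1 + ‖(z, y)‖) ^ m) ^ n) :=
        mul_le_mul hyk key (norm_nonneg _) (by positivity)
    _ = n.factorial * (1 + C) ^ n *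
        ((1 + ‖(z, y)‖) ^ (k + m * n) * Real.exp (-(‖y - z.1‖ ^ 2 / 2))) := by
        rw [mul_pow, ← pow_mul, pow_add]; ring
    _ ≤ n.factorial * (1 + C) ^ n * ((2 * (1 + ‖z‖) * (1 + ‖y - z.1‖)) ^ (k + m * n) *
        Real.exp (-(‖y - z.1‖ ^ 2 / 2))) := by gcongr
    _ = n.factorial * (1 + C) ^ n * 2 ^ (k + m * n) * (1 + ‖z‖) ^ (k + m * n) *
        ((1 + ‖y - z.1‖) ^ (k + m * n) * Real.exp (-(‖y - z.1‖ ^ 2 / 2))) := by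
        rw [mul_pow, mul_pow]; ring
    _ ≤ n.factorial * (1 + C) ^ n * 2 ^ (k + m * n) * (1 + ‖z‖) ^ (k + m * n) *
        ((k + m * n).factorial * Real.exp (3 / 2)) :=
        mul_le_mul_of_nonneg_left (one_add_pow_mul_exp_le (k + m * n) (norm_nonneg (y - z.1)))
          (by positivity)
    _ = _ := by ring

/-- The value `π^{-d/4}` of the standard Gaussian at the origin. -/
noncomputable def gaussianConst (d : ℕ) : ℝ := Real.pi ^ (-(d : ℝ) / 4)

theorem gaussianConst_pos : 0 < gaussianConst d := Real.rpow_pos_of_pos Real.pi_pos _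

theorem gaussianAtom_apply (x ξ y : RSpace d) :
    gaussianAtom x ξ y = (gaussianConst d : ℂ) * Complex.exp (atomPhase x ξ y) := rfl

theorem iteratedFDeriv_gaussianAtom (z : RSpace d × RSpace d) (n : ℕ) (y : RSpace d) :
    iteratedFDeriv ℝ n (gaussianAtom z.1 z.2) y =
      (gaussianConst d : ℂ) • (iteratedFDeriv ℝ n (atomKernel (d := d))
        (z, y)).compContinuousLinearMap (fun _ => ContinuousLinearMap.inr ℝ _ _) := by
  have h1 : (gaussianAtom z.1 z.2 : RSpace d → ℂ) = (gaussianConst d : ℂ) •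
      ((fun w => atomKernel (w + (z, 0))) ∘
        (ContinuousLinearMap.inr ℝ (RSpace d × RSpace d) (RSpace d))) := by
    funext y
    simp [gaussianAtom_apply, atomKernel]
  have h2 : ContDiff ℝ n (fun w => atomKernel (d := d) (w + (z, 0))) :=
    (contDiff_atomKernel.of_le (by exact_mod_cast le_top)).comp (contDiff_id.add contDiff_const)
  rw [h1, iteratedFDeriv_const_smul_apply (h2.comp (ContinuousLinearMap.contDiff _)).contDiffAt,
    ContinuousLinearMap.iteratedFDeriv_comp_right _ h2 y le_rfl, iteratedFDeriv_comp_add_right]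
  simp

theorem norm_comp_inr_le {n : ℕ} (M : ((RSpace d × RSpace d) × RSpace d) [×n]→L[ℝ] ℂ) :
    ‖M.compContinuousLinearMap (fun _ => ContinuousLinearMap.inr ℝ _ _)‖ ≤ ‖M‖ := by
  refine (ContinuousMultilinearMap.norm_compContinuousLinearMap_le _ _).trans ?_
  refine mul_le_of_le_one_right (norm_nonneg _) ?_
  exact Finset.prod_le_one (fun _ _ => norm_nonneg _) fun _ _ =>
    ContinuousLinearMap.norm_inr_le_one ℝ _ _

/-- Polynomial growth in `z` is enough: it will be multiplied by the transform of a Schwartz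
function, which decays faster than any power. -/
theorem seminorm_gaussianAtom_le (k n : ℕ) :
    ∃ (C : ℝ) (N : ℕ), 0 ≤ C ∧ ∀ z : RSpace d × RSpace d,
      SchwartzMap.seminorm ℝ k n (gaussianAtom z.1 z.2) ≤ C * (1 + ‖z‖) ^ N := by
  obtain ⟨C, N, hC, h⟩ := atomKernel_decay (d := d) k n
  refine ⟨gaussianConst d * C, N, mul_nonneg gaussianConst_pos.le hC, fun z => ?_⟩
  have hc := gaussianConst_pos (d := d)
  refine SchwartzMap.seminorm_le_bound ℝ k n _ (by positivity) fun y => ?_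
  rw [iteratedFDeriv_gaussianAtom, norm_smul, Complex.norm_real, Real.norm_of_nonneg hc.le]
  calc _ ≤ ‖y‖ ^ k * (gaussianConst d * ‖iteratedFDeriv ℝ n (atomKernel (d := d)) (z, y)‖) := by
        gcongr; exact norm_comp_inr_le _
    _ = gaussianConst d * (‖y‖ ^ k * ‖iteratedFDeriv ℝ n (atomKernel (d := d)) (z, y)‖) := by ring
    _ ≤ gaussianConst d * (C * (1 + ‖z‖) ^ N) := mul_le_mul_of_nonneg_left (h z y) hc.le
    _ = _ := by ring

theorem seminorm_gaussianAtom_sub_le (k n : ℕ) (w : RSpace d × RSpace d) :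
    ∃ C : ℝ, ∀ z : RSpace d × RSpace d, ‖z - w‖ ≤ 1 →
      SchwartzMap.seminorm ℝ k n (gaussianAtom z.1 z.2 - gaussianAtom w.1 w.2) ≤
        C * ‖z - w‖ := by
  obtain ⟨C, N, hC, h⟩ := atomKernel_decay (d := d) k (n + 1)
  have hc := gaussianConst_pos (d := d)
  refine ⟨gaussianConst d * (C * (2 + ‖w‖) ^ N), fun z hz => ?_⟩
  refine SchwartzMap.seminorm_le_bound ℝ k n _ (by positivity) fun y => ?_
  set D := iteratedFDeriv ℝ n (atomKernel (d := d)) with hD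
  have hmv : ‖‖y‖ ^ k • D (z, y) - ‖y‖ ^ k • D (w, y)‖ ≤
      C * (2 + ‖w‖) ^ N * ‖((z, y) : (RSpace d × RSpace d) × RSpace d) - (w, y)‖ := by
    -- On a slice with `y` fixed the weight `‖y‖ ^ k` is constant, so the mean value inequality
    -- yields a Lipschitz bound in `z` that is uniform in `y`.
    refine Convex.norm_image_sub_le_of_norm_hasFDerivWithin_le (𝕜 := ℝ)
      (s := Metric.closedBall w 1 ×ˢ {y}) (f := fun v => ‖y‖ ^ k • D v)
      (f' := fun v => ‖y‖ ^ k • fderiv ℝ D v) ?_ ?_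
      ((convex_closedBall w 1).prod (convex_singleton y)) ?_ ?_
    · intro v _
      have h1 : HasFDerivAt D (fderiv ℝ D v) v :=
        ((contDiff_atomKernel (d := d)).differentiable_iteratedFDeriv
          (by exact_mod_cast WithTop.coe_lt_top n) v).hasFDerivAt
      exact (h1.const_smul (‖y‖ ^ k)).hasFDerivWithinAt
    · rintro ⟨v, y'⟩ ⟨hv, hy'⟩
      obtain rfl : y' = y := hy'
      rw [norm_smul, norm_pow, norm_norm, hD, norm_fderiv_iteratedFDeriv]
      refine (h v y').trans ?_
      have h1 : ‖v‖ ≤ 1 + ‖w‖ := by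
        have := norm_sub_norm_le v w
        rw [Metric.mem_closedBall, dist_eq_norm] at hv
        linarith
      exact mul_le_mul_of_nonneg_left
        (pow_le_pow_left₀ (by positivity) (by linarith) N) hC
    · exact ⟨Metric.mem_closedBall_self zero_le_one, rfl⟩
    · exact ⟨by simpa [dist_eq_norm] using hz, rfl⟩
  have hsub : iteratedFDeriv ℝ n (gaussianAtom z.1 z.2 - gaussianAtom w.1 w.2 : 𝓢(RSpace d, ℂ)) y
      = (gaussianConst d : ℂ) • (D (z, y) - D (w, y)).compContinuousLinearMap
        (fun _ => ContinuousLinearMap.inr ℝ _ _) := by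
    have h1 : iteratedFDeriv ℝ n
        (gaussianAtom z.1 z.2 - gaussianAtom w.1 w.2 : 𝓢(RSpace d, ℂ)) y =
        iteratedFDeriv ℝ n (gaussianAtom z.1 z.2) y -
          iteratedFDeriv ℝ n (gaussianAtom w.1 w.2) y :=
      iteratedFDeriv_sub_apply ((gaussianAtom z.1 z.2).smooth n).contDiffAt
        ((gaussianAtom w.1 w.2).smooth n).contDiffAt
    rw [h1, iteratedFDeriv_gaussianAtom, iteratedFDeriv_gaussianAtom, ← smul_sub]
    rfl
  rw [hsub, norm_smul, Complex.norm_real, Real.norm_of_nonneg hc.le]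
  have h3 : ‖((z, y) : (RSpace d × RSpace d) × RSpace d) - (w, y)‖ = ‖z - w‖ := by
    simp [Prod.norm_def]
  rw [← smul_sub, norm_smul, norm_pow, norm_norm, h3] at hmv
  calc _ ≤ ‖y‖ ^ k * (gaussianConst d * ‖D (z, y) - D (w, y)‖) := by
        gcongr; exact norm_comp_inr_le _
    _ = gaussianConst d * (‖y‖ ^ k * ‖D (z, y) - D (w, y)‖) := by ring
    _ ≤ gaussianConst d * (C * (2 + ‖w‖) ^ N * ‖z - w‖) := by gcongr
    _ = _ := by ring

theorem continuous_gaussianAtom :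
    Continuous fun z : RSpace d × RSpace d => gaussianAtom z.1 z.2 := by
  rw [continuous_iff_continuousAt]
  intro w
  rw [ContinuousAt, (schwartz_withSeminorms ℝ (RSpace d) ℂ).tendsto_nhds]
  rintro ⟨k, n⟩ ε hε
  obtain ⟨C, hC⟩ := seminorm_gaussianAtom_sub_le k n w
  have h1 : Tendsto (fun z => C * ‖z - w‖) (𝓝 w) (𝓝 0) := by
    have : Continuous fun z : RSpace d × RSpace d => C * ‖z - w‖ := by fun_prop
    simpa using this.tendsto w
  filter_upwards [h1.eventually_lt_const hε, Metric.closedBall_mem_nhds w one_pos] with z hz hz1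
  exact (hC z (by simpa [dist_eq_norm] using hz1)).trans_lt hz

end GaussianAtomFamily

/-! ### Plancherel for the Fourier integral on `L¹ ∩ L²` -/

section Plancherel

open FourierTransform
open scoped ComplexConjugate

variable {d : ℕ}

theorem eLpNorm_two_sq {α : Type*} [MeasurableSpace α] {μ : Measure α} (f : α → ℂ) :
    eLpNorm f 2 μ ^ 2 = ∫⁻ a, ‖f a‖ₑ ^ 2 ∂μ := by
  rw [eLpNorm_eq_lintegral_rpow_enorm_toReal (by simp) (by simp)]
  simp only [ENNReal.toReal_ofNat, ENNReal.rpow_ofNat]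
  rw [← ENNReal.rpow_natCast, ← ENNReal.rpow_mul]
  simp

/-- The Fourier transform on `L²` is the one of tempered distributions, and the Fourier integral
obeys the same multiplication formula `∫ Ĝ f = ∫ G f̂`. Hence the two agree against all test
functions. -/
theorem fourier_toLp_ae_eq {f : RSpace d → ℂ} (h1 : Integrable f) (h2 : MemLp f 2) :
    (𝓕 (h2.toLp f) : Lp ℂ 2 (volume : Measure (RSpace d))) =ᵐ[volume] 𝓕 f := by
  have hc : Continuous (𝓕 f) :=
    VectorFourier.fourierIntegral_continuous Real.continuous_fourierChar
      (by exact continuous_inner) h1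
  refine ae_eq_of_integral_contDiff_smul_eq ((Lp.memLp _).locallyIntegrable (by norm_num))
    hc.locallyIntegrable fun g hg hgc => ?_
  have hg1 : HasCompactSupport (Complex.ofRealCLM ∘ g) := hgc.comp_left rfl
  have hg2 : ContDiff ℝ (⊤ : ℕ∞) (Complex.ofRealCLM ∘ g) := by fun_prop
  set G : 𝓢(RSpace d, ℂ) := hg1.toSchwartzMap hg2 with hG
  have hGa : ∀ y, G y = (g y : ℂ) := fun y => rfl
  have e1 := congrArg (fun u : 𝓢'(RSpace d, ℂ) => u G)
    (MeasureTheory.Lp.fourier_toTemperedDistribution_eq (h2.toLp f))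
  simp only [TemperedDistribution.fourier_apply, Lp.toTemperedDistribution_apply] at e1
  have e2 : ∫ x, (𝓕 G) x • (h2.toLp f) x = ∫ x, (𝓕 (G : RSpace d → ℂ)) x • f x := by
    refine integral_congr_ae ?_
    filter_upwards [h2.coeFn_toLp] with x hx
    rw [hx]
    rfl
  have e3 : ∫ x, (𝓕 (G : RSpace d → ℂ)) x • f x = ∫ x, G x • 𝓕 f x := by
    have := VectorFourier.integral_fourierIntegral_smul_eq_flip (L := innerₗ (RSpace d))
      (μ := volume) (ν := volume) Real.continuous_fourierChar continuous_inner G.integrable h1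
    rw [flip_innerₗ] at this
    exact this
  rw [e2, e3] at e1
  simp only [hGa] at e1
  simpa [Complex.real_smul] using e1.symm

theorem lintegral_enorm_sq_fourier {f : RSpace d → ℂ} (h1 : Integrable f) (h2 : MemLp f 2) :
    ∫⁻ ξ, ‖𝓕 f ξ‖ₑ ^ 2 = ∫⁻ y, ‖f y‖ₑ ^ 2 := by
  rw [← eLpNorm_two_sq, ← eLpNorm_two_sq, ← eLpNorm_congr_ae (fourier_toLp_ae_eq h1 h2),
    ← eLpNorm_congr_ae h2.coeFn_toLp, ← Lp.enorm_def, ← Lp.enorm_def]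
  rw [← ofReal_norm, ← ofReal_norm, MeasureTheory.Lp.norm_fourier_eq]

theorem integral_fourier_mul_conj_fourier {f g : RSpace d → ℂ} (hf1 : Integrable f)
    (hf2 : MemLp f 2) (hg1 : Integrable g) (hg2 : MemLp g 2) :
    ∫ ξ, 𝓕 f ξ * conj (𝓕 g ξ) = ∫ y, f y * conj (g y) := by
  have h := MeasureTheory.Lp.inner_fourier_eq (hg2.toLp g) (hf2.toLp f)
  rw [L2.inner_def, L2.inner_def] at h
  have e1 : ∫ ξ, inner ℂ ((𝓕 (hg2.toLp g) : Lp ℂ 2 (volume : Measure (RSpace d))) ξ)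
      ((𝓕 (hf2.toLp f) : Lp ℂ 2 (volume : Measure (RSpace d))) ξ) =
      ∫ ξ, 𝓕 f ξ * conj (𝓕 g ξ) := by
    refine integral_congr_ae ?_
    filter_upwards [fourier_toLp_ae_eq hf1 hf2, fourier_toLp_ae_eq hg1 hg2] with ξ h1 h2
    rw [h1, h2, RCLike.inner_apply]
  have e2 : ∫ y, inner ℂ ((hg2.toLp g) y) ((hf2.toLp f) y) = ∫ y, f y * conj (g y) := by
    refine integral_congr_ae ?_
    filter_upwards [hf2.coeFn_toLp, hg2.coeFn_toLp] with ξ h1 h2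
    rw [h1, h2, RCLike.inner_apply]
  rw [← e1, ← e2, h]

theorem integral_mul_cexp_eq_fourier (f : RSpace d → ℂ) (ξ : RSpace d) :
    ∫ y, f y * Complex.exp (-(Complex.I * ((inner ℝ y ξ : ℝ) : ℂ))) =
      𝓕 f ((2 * Real.pi)⁻¹ • ξ) := by
  rw [Real.fourier_eq']
  refine integral_congr_ae (Eventually.of_forall fun y => ?_)
  simp only [smul_eq_mul]
  rw [mul_comm, inner_smul_right]
  congr 2
  have : (Real.pi : ℂ) ≠ 0 := by exact_mod_cast Real.pi_ne_zero
  push_cast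
  field_simp

theorem lintegral_comp_smul_rspace (F : RSpace d → ℝ≥0∞) {r : ℝ} (hr : 0 < r) :
    ∫⁻ ξ, F (r⁻¹ • ξ) = ENNReal.ofReal (r ^ d) * ∫⁻ ξ, F ξ := by
  have hr' : r⁻¹ ≠ 0 := (inv_pos.2 hr).ne'
  have h := Measure.map_addHaar_smul (volume : Measure (RSpace d)) hr'
  have h2 := (Homeomorph.smulOfNeZero (α := RSpace d) r⁻¹ hr').measurableEmbedding.lintegral_map
    (μ := volume) F
  have h3 : (⇑(Homeomorph.smulOfNeZero (α := RSpace d) r⁻¹ hr')) = (r⁻¹ • ·) := rfl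
  rw [h3, h, lintegral_smul_measure] at h2
  rw [← h2, finrank_euclideanSpace_fin, inv_pow, inv_inv, abs_of_pos (by positivity)]
  rfl

end Plancherel

/-! ### Moyal's identity -/

section Moyal

open FourierTransform
open scoped ComplexConjugate

variable {d : ℕ}

/-- The normalizing constant `(2π)^{-d/2}` of the short-time Fourier transform. -/
noncomputable def stftConst (d : ℕ) : ℝ := (2 * Real.pi) ^ (-(d : ℝ) / 2)

theorem stftConst_pos : 0 < stftConst d := Real.rpow_pos_of_pos (by positivity) _

/-- The Jacobian `(2π)^d` of the frequency scaling cancels the squared normalization, so Moyal's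
identity carries no constant. -/
theorem stftConst_sq : stftConst d ^ 2 * (2 * Real.pi) ^ d = 1 := by
  have h : (0 : ℝ) < 2 * Real.pi := by positivity
  rw [stftConst, ← Real.rpow_natCast, ← Real.rpow_mul h.le, ← Real.rpow_natCast,
    ← Real.rpow_add h]
  norm_num

theorem stft_eq_fourier (φ f : RSpace d → ℂ) (z : RSpace d × RSpace d) :
    stft φ f z = (stftConst d : ℂ) *
      𝓕 (fun y => f y * conj (φ (y - z.1))) ((2 * Real.pi)⁻¹ • z.2) := by
  rw [← integral_mul_cexp_eq_fourier]
  rfl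

theorem stft_congr_ae {φ φ' f f' : RSpace d → ℂ} (hφ : φ =ᵐ[volume] φ') (hf : f =ᵐ[volume] f') :
    stft φ f = stft φ' f' := by
  funext z
  unfold stft
  congr 1
  refine integral_congr_ae ?_
  have h := (measurePreserving_sub_right volume z.1).quasiMeasurePreserving.ae_eq_comp hφ
  filter_upwards [h, hf] with y h1 h2
  simp only [Function.comp_apply] at h1
  rw [h1, h2]

theorem memLp_comp_sub {φ : RSpace d → ℂ} {p : ℝ≥0∞} (hφ : MemLp φ p) (x : RSpace d) :
    MemLp (fun y => φ (y - x)) p :=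
  hφ.comp_measurePreserving (measurePreserving_sub_right volume x)

theorem integrable_window {φ f : RSpace d → ℂ} (hφ : MemLp φ 2) (hf : MemLp f 2) (x : RSpace d) :
    Integrable fun y => f y * conj (φ (y - x)) :=
  hf.integrable_mul (memLp_comp_sub hφ x).star

theorem lintegral_window {φ f : RSpace d → ℂ} (hφ : StronglyMeasurable φ)
    (hf : StronglyMeasurable f) :
    ∫⁻ x, ∫⁻ y, ‖f y * conj (φ (y - x))‖ₑ ^ 2 = (∫⁻ y, ‖f y‖ₑ ^ 2) * ∫⁻ y, ‖φ y‖ₑ ^ 2 := by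
  have hm : Measurable fun p : RSpace d × RSpace d => ‖f p.2 * conj (φ (p.2 - p.1))‖ₑ ^ 2 := by
    have h1 := hf.measurable
    have h2 := hφ.measurable
    have h3 : Measurable fun p : RSpace d × RSpace d => φ (p.2 - p.1) := h2.comp (by fun_prop)
    exact ((h1.comp measurable_snd).mul (Complex.continuous_conj.measurable.comp h3)).enorm.pow_const 2
  rw [lintegral_lintegral_swap hm.aemeasurable]
  have : ∀ y, ∫⁻ x, ‖f y * conj (φ (y - x))‖ₑ ^ 2 = ‖f y‖ₑ ^ 2 * ∫⁻ x, ‖φ x‖ₑ ^ 2 := by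
    intro y
    rw [← lintegral_sub_left_eq_self (fun x => ‖φ x‖ₑ ^ 2) y,
      ← lintegral_const_mul _ (by have := hφ.measurable; fun_prop)]
    refine lintegral_congr fun x => ?_
    rw [enorm_mul, mul_pow]
    congr 2
    exact RCLike.enorm_conj _
  simp_rw [this]
  rw [lintegral_mul_const]
  exact hf.measurable.enorm.pow_const 2

/-- A product of two `L²` functions need only be integrable. By Tonelli, however, its squared `L²`
norm has a finite integral over all translations, so almost every translate admits Plancherel in the
frequency. -/
theorem ae_memLp_window {φ f : RSpace d → ℂ} (hφ : MemLp φ 2) (hf : MemLp f 2)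
    (hφm : StronglyMeasurable φ) (hfm : StronglyMeasurable f) :
    ∀ᵐ x, MemLp (fun y => f y * conj (φ (y - x))) 2 := by
  have h := lintegral_window hφm hfm
  rw [← eLpNorm_two_sq, ← eLpNorm_two_sq] at h
  have hne : (∫⁻ x, ∫⁻ y, ‖f y * conj (φ (y - x))‖ₑ ^ 2) ≠ ⊤ := by
    rw [h]
    exact ENNReal.mul_ne_top (ENNReal.pow_ne_top hf.2.ne) (ENNReal.pow_ne_top hφ.2.ne)
  have hm : Measurable fun p : RSpace d × RSpace d => ‖f p.2 * conj (φ (p.2 - p.1))‖ₑ ^ 2 := by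
    have h1 := hfm.measurable
    have h2 := hφm.measurable
    have h3 : Measurable fun p : RSpace d × RSpace d => φ (p.2 - p.1) := h2.comp (by fun_prop)
    exact ((h1.comp measurable_snd).mul (Complex.continuous_conj.measurable.comp h3)).enorm.pow_const 2
  filter_upwards [ae_lt_top (Measurable.lintegral_prod_right' hm) hne] with x hx
  refine ⟨(integrable_window hφ hf x).1, ?_⟩
  rw [← eLpNorm_two_sq] at hx
  by_contra hcon
  rw [not_lt, top_le_iff] at hcon
  rw [hcon] at hx
  simp at hx

theorem stronglyMeasurable_stft {φ f : RSpace d → ℂ} (hφ : AEStronglyMeasurable φ)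
    (hf : AEStronglyMeasurable f) : StronglyMeasurable (stft φ f) := by
  rw [stft_congr_ae hφ.ae_eq_mk hf.ae_eq_mk]
  have h1 := hf.stronglyMeasurable_mk.measurable
  have h2 := hφ.stronglyMeasurable_mk.measurable
  unfold stft
  refine StronglyMeasurable.const_mul ?_ _
  refine StronglyMeasurable.integral_prod_right
    (f := fun (z : RSpace d × RSpace d) (y : RSpace d) => hf.mk f y *
      (starRingEnd ℂ) (hφ.mk φ (y - z.1)) *
      Complex.exp (-(Complex.I * ((inner ℝ y z.2 : ℝ) : ℂ)))) ?_
  refine Measurable.stronglyMeasurable ?_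
  refine Measurable.mul (Measurable.mul (h1.comp measurable_snd) ?_) ?_
  · exact Complex.continuous_conj.measurable.comp (h2.comp (by fun_prop))
  · refine Continuous.measurable ?_
    fun_prop

theorem lintegral_stft_sq {φ f : RSpace d → ℂ} (hφ : MemLp φ 2) (hf : MemLp f 2) :
    ∫⁻ z, ‖stft φ f z‖ₑ ^ 2 = (∫⁻ y, ‖f y‖ₑ ^ 2) * ∫⁻ y, ‖φ y‖ₑ ^ 2 := by
  -- The transform depends only on the classes of `φ` and `f`, so representatives that make the
  -- integrand jointly measurable may be chosen.
  wlog hm : StronglyMeasurable φ ∧ StronglyMeasurable f generalizing φ f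
  · have h := this ((memLp_congr_ae hφ.1.ae_eq_mk).1 hφ) ((memLp_congr_ae hf.1.ae_eq_mk).1 hf)
      ⟨hφ.1.stronglyMeasurable_mk, hf.1.stronglyMeasurable_mk⟩
    rw [stft_congr_ae hφ.1.ae_eq_mk hf.1.ae_eq_mk, h]
    simp only [← eLpNorm_two_sq]
    rw [← eLpNorm_congr_ae hφ.1.ae_eq_mk, ← eLpNorm_congr_ae hf.1.ae_eq_mk]
  rw [← lintegral_window hm.1 hm.2, Measure.volume_eq_prod,
    lintegral_prod _ ((stronglyMeasurable_stft hφ.1 hf.1).measurable.enorm.pow_const 2).aemeasurable]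
  refine lintegral_congr_ae ?_
  filter_upwards [ae_memLp_window hφ hf hm.1 hm.2] with x hx
  simp only [stft_eq_fourier, enorm_mul, mul_pow]
  rw [lintegral_const_mul' _ _ (by simp),
    lintegral_comp_smul_rspace (fun ξ => ‖𝓕 (fun y => f y * conj (φ (y - x))) ξ‖ₑ ^ 2)
      (by positivity : (0 : ℝ) < 2 * Real.pi),
    lintegral_enorm_sq_fourier (integrable_window hφ hf x) hx, ← mul_assoc]
  have h1 : ‖(stftConst d : ℂ)‖ₑ ^ 2 * ENNReal.ofReal ((2 * Real.pi) ^ d) = 1 := by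
    rw [← ofReal_norm, Complex.norm_real, Real.norm_of_nonneg stftConst_pos.le,
      ← ENNReal.ofReal_pow stftConst_pos.le, ← ENNReal.ofReal_mul (by positivity), stftConst_sq,
      ENNReal.ofReal_one]
  rw [h1, one_mul]
  simp only [enorm_mul, mul_pow]

theorem memLp_stft {φ f : RSpace d → ℂ} (hφ : MemLp φ 2) (hf : MemLp f 2) :
    MemLp (stft φ f) 2 := by
  refine ⟨(stronglyMeasurable_stft hφ.1 hf.1).aestronglyMeasurable, ?_⟩
  have h := lintegral_stft_sq hφ hf
  simp only [← eLpNorm_two_sq] at h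
  by_contra hcon
  rw [not_lt, top_le_iff] at hcon
  rw [hcon] at h
  have : eLpNorm f 2 ^ 2 * eLpNorm φ 2 ^ 2 ≠ ⊤ :=
    ENNReal.mul_ne_top (ENNReal.pow_ne_top hf.2.ne) (ENNReal.pow_ne_top hφ.2.ne)
  exact this (by rw [← h]; simp)

theorem integral_stft_mul_conj_stft {φ f g : RSpace d → ℂ} (hφ : MemLp φ 2) (hf : MemLp f 2)
    (hg : MemLp g 2) :
    ∫ z, stft φ f z * conj (stft φ g z) =
      (∫ y, f y * conj (g y)) * ((∫ y, ‖φ y‖ ^ 2 : ℝ) : ℂ) := by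
  wlog hm : StronglyMeasurable φ ∧ StronglyMeasurable f ∧ StronglyMeasurable g generalizing φ f g
  · have h := this ((memLp_congr_ae hφ.1.ae_eq_mk).1 hφ) ((memLp_congr_ae hf.1.ae_eq_mk).1 hf)
      ((memLp_congr_ae hg.1.ae_eq_mk).1 hg)
      ⟨hφ.1.stronglyMeasurable_mk, hf.1.stronglyMeasurable_mk, hg.1.stronglyMeasurable_mk⟩
    rw [stft_congr_ae hφ.1.ae_eq_mk hf.1.ae_eq_mk, stft_congr_ae hφ.1.ae_eq_mk hg.1.ae_eq_mk, h]
    congr 1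
    · refine integral_congr_ae ?_
      filter_upwards [hf.1.ae_eq_mk, hg.1.ae_eq_mk] with y h1 h2
      rw [h1, h2]
    · congr 1
      refine integral_congr_ae ?_
      filter_upwards [hφ.1.ae_eq_mk] with y h1
      rw [h1]
  have hint : Integrable fun z => stft φ f z * conj (stft φ g z) :=
    (memLp_stft hφ hf).integrable_mul (memLp_stft hφ hg).star
  have hfg : Integrable fun y => f y * conj (g y) := hf.integrable_mul hg.star
  have hφ2 : Integrable fun y => ((‖φ (-y)‖ ^ 2 : ℝ) : ℂ) := by
    have : Integrable fun y => ((‖φ y‖ ^ 2 : ℝ) : ℂ) :=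
      ((memLp_two_iff_integrable_sq_norm hφ.1).1 hφ).ofReal
    exact this.comp_neg
  -- Fubini is justified because this is the convolution integrand of the integrable functions `f ḡ`
  -- and `|φ(-·)|²`.
  have hprod : Integrable (fun p : RSpace d × RSpace d =>
      (f p.2 * conj (g p.2)) * ((‖φ (p.2 - p.1)‖ ^ 2 : ℝ) : ℂ)) (volume.prod volume) := by
    have h := Integrable.convolution_integrand (ContinuousLinearMap.mul ℝ ℂ) hfg hφ2
    simpa [neg_sub] using h
  rw [Measure.volume_eq_prod, integral_prod _ (by rwa [← Measure.volume_eq_prod])]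
  have hstep : ∀ᵐ x, ∫ ξ, stft φ f (x, ξ) * conj (stft φ g (x, ξ)) =
      ∫ y, (f y * conj (g y)) * ((‖φ (y - x)‖ ^ 2 : ℝ) : ℂ) := by
    filter_upwards [ae_memLp_window hφ hf hm.1 hm.2.1, ae_memLp_window hφ hg hm.1 hm.2.2]
      with x h1 h2
    have h3 := integral_fourier_mul_conj_fourier (integrable_window hφ hf x) h1
      (integrable_window hφ hg x) h2
    have h4 := Measure.integral_comp_inv_smul_of_nonneg (volume : Measure (RSpace d))
      (fun ξ => 𝓕 (fun y => f y * conj (φ (y - x))) ξ *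
        conj (𝓕 (fun y => g y * conj (φ (y - x))) ξ)) (by positivity : (0 : ℝ) ≤ 2 * Real.pi)
    rw [h3, finrank_euclideanSpace_fin] at h4
    have h5 : ∀ ξ, stft φ f (x, ξ) * conj (stft φ g (x, ξ)) = ((stftConst d ^ 2 : ℝ) : ℂ) *
        (𝓕 (fun y => f y * conj (φ (y - x))) ((2 * Real.pi)⁻¹ • ξ) *
        conj (𝓕 (fun y => g y * conj (φ (y - x))) ((2 * Real.pi)⁻¹ • ξ))) := by
      intro ξ
      rw [stft_eq_fourier, stft_eq_fourier, map_mul, Complex.conj_ofReal]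
      push_cast
      ring
    simp_rw [h5]
    rw [integral_const_mul, h4, Complex.real_smul, ← mul_assoc, ← Complex.ofReal_mul, stftConst_sq,
      Complex.ofReal_one, one_mul]
    refine integral_congr_ae (Eventually.of_forall fun y => ?_)
    have h6 : ((‖φ (y - x)‖ ^ 2 : ℝ) : ℂ) = φ (y - x) * conj (φ (y - x)) := by
      rw [Complex.mul_conj, Complex.normSq_eq_norm_sq]
    simp only [map_mul, Complex.conj_conj]
    rw [h6]
    ring
  rw [integral_congr_ae hstep, integral_integral_swap hprod]
  have hlast : ∀ y, ∫ x, (f y * conj (g y)) * ((‖φ (y - x)‖ ^ 2 : ℝ) : ℂ) =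
      (f y * conj (g y)) * ((∫ y, ‖φ y‖ ^ 2 : ℝ) : ℂ) := by
    intro y
    rw [integral_const_mul, integral_complex_ofReal, integral_sub_left_eq_self (fun x => ‖φ x‖ ^ 2)]
  simp_rw [hlast]
  rw [integral_mul_const]

end Moyal

/-! ### The Gaussian window and rapid decay of transforms of Schwartz functions -/

section GaussianWindow

open scoped ComplexConjugate

variable {d : ℕ}

/-- The standard Gaussian `φ₀`. -/
noncomputable def gaussianWindow (d : ℕ) : 𝓢(RSpace d, ℂ) := gaussianAtom 0 0

theorem gaussianWindow_apply (y : RSpace d) :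
    gaussianWindow d y = ((gaussianConst d * Real.exp (-(‖y‖ ^ 2 / 2)) : ℝ) : ℂ) := by
  simp [gaussianWindow, gaussianAtom_apply, atomPhase]

theorem conj_gaussianWindow (y : RSpace d) : conj (gaussianWindow d y) = gaussianWindow d y := by
  rw [gaussianWindow_apply, Complex.conj_ofReal]

theorem gaussianAtom_eq (x ξ y : RSpace d) :
    gaussianAtom x ξ y = conj (gaussianWindow d (y - x)) *
      Complex.exp (-(Complex.I * ((inner ℝ y ξ : ℝ) : ℂ))) := by
  rw [conj_gaussianWindow, gaussianWindow_apply, gaussianAtom_apply, atomPhase, sub_eq_add_neg,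
    Complex.exp_add]
  push_cast
  ring

theorem stft_gaussianWindow (f : RSpace d → ℂ) (z : RSpace d × RSpace d) :
    stft (gaussianWindow d) f z = (stftConst d : ℂ) * ∫ y, f y * gaussianAtom z.1 z.2 y := by
  unfold stft
  rw [stftConst]
  congr 1
  refine integral_congr_ae (Eventually.of_forall fun y => ?_)
  simp only [gaussianAtom_eq, mul_assoc]

theorem conj_gaussianAtom (x ξ y : RSpace d) :
    conj (gaussianAtom x ξ y) = gaussianAtom x (-ξ) y := by
  rw [gaussianAtom_eq, gaussianAtom_eq, map_mul, Complex.conj_conj, ← Complex.exp_conj,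
    conj_gaussianWindow]
  simp

theorem gaussianSTFT_eq_stft {u : 𝓢'(RSpace d, ℂ)} {f : RSpace d → ℂ} (h : IsL2Function u f) :
    gaussianSTFT u = stft (gaussianWindow d) f := by
  funext z
  rw [stft_gaussianWindow]
  unfold gaussianSTFT
  rw [h.2, stftConst]
  simp only [mul_comm]

theorem norm_gaussianAtom_le (x ξ y : RSpace d) : ‖gaussianAtom x ξ y‖ ≤ gaussianConst d := by
  rw [gaussianAtom_apply, norm_mul, norm_cexp_atomPhase, Complex.norm_real,
    Real.norm_of_nonneg gaussianConst_pos.le]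
  refine mul_le_of_le_one_right gaussianConst_pos.le (Real.exp_le_one_iff.2 ?_)
  have := sq_nonneg ‖y - x‖
  linarith

theorem memLp_gaussianWindow : MemLp (gaussianWindow d) 2 := (gaussianWindow d).memLp 2

theorem integral_norm_sq_gaussianWindow : ∫ y, ‖gaussianWindow d y‖ ^ 2 = 1 := by
  have h : ∀ y : RSpace d, ‖gaussianWindow d y‖ ^ 2 =
      gaussianConst d ^ 2 * Real.exp (-1 * ‖y‖ ^ 2) := by
    intro y
    rw [gaussianWindow_apply, Complex.norm_real, Real.norm_of_nonneg
      (mul_nonneg gaussianConst_pos.le (Real.exp_pos _).le), mul_pow, ← Real.exp_nat_mul]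
    congr 2
    push_cast
    ring
  simp_rw [h]
  rw [integral_const_mul, GaussianFourier.integral_rexp_neg_mul_sq_norm one_pos,
    finrank_euclideanSpace_fin, gaussianConst, ← Real.rpow_natCast, ← Real.rpow_mul Real.pi_pos.le,
    div_one, ← Real.rpow_add Real.pi_pos]
  norm_num
  ring_nf
  exact Real.rpow_zero _

theorem lintegral_sq_enorm_eq_ofReal {α : Type*} [MeasurableSpace α] {μ : Measure α} {f : α → ℂ}
    (hf : MemLp f 2 μ) : ∫⁻ y, ‖f y‖ₑ ^ 2 ∂μ = ENNReal.ofReal (∫ y, ‖f y‖ ^ 2 ∂μ) := by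
  rw [ofReal_integral_eq_lintegral_ofReal ((memLp_two_iff_integrable_sq_norm hf.1).1 hf)
    (Eventually.of_forall fun y => by positivity)]
  refine lintegral_congr fun y => ?_
  rw [ENNReal.ofReal_pow (norm_nonneg _), ofReal_norm]

theorem lintegral_sq_gaussianWindow : ∫⁻ y, ‖gaussianWindow d y‖ₑ ^ 2 = 1 := by
  rw [lintegral_sq_enorm_eq_ofReal memLp_gaussianWindow, integral_norm_sq_gaussianWindow,
    ENNReal.ofReal_one]

theorem lintegral_stft_gaussianWindow_sq {f : RSpace d → ℂ} (hf : MemLp f 2) :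
    ∫⁻ z, ‖stft (gaussianWindow d) f z‖ₑ ^ 2 = ∫⁻ y, ‖f y‖ₑ ^ 2 := by
  rw [lintegral_stft_sq memLp_gaussianWindow hf, lintegral_sq_gaussianWindow, mul_one]

theorem integral_stft_gaussianWindow {f g : RSpace d → ℂ} (hf : MemLp f 2) (hg : MemLp g 2) :
    ∫ z, stft (gaussianWindow d) f z * conj (stft (gaussianWindow d) g z) =
      ∫ y, f y * conj (g y) := by
  rw [integral_stft_mul_conj_stft memLp_gaussianWindow hf hg, integral_norm_sq_gaussianWindow,
    Complex.ofReal_one, mul_one]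

open LineDeriv

/-- The creation operator in the direction `v`. -/
noncomputable def creation (v : RSpace d) (ψ : 𝓢(RSpace d, ℂ)) : 𝓢(RSpace d, ℂ) :=
  SchwartzMap.smulLeftCLM ℂ (fun y : RSpace d => ((inner ℝ y v : ℝ) : ℂ)) ψ - ∂_{v} ψ

theorem creation_apply (v : RSpace d) (ψ : 𝓢(RSpace d, ℂ)) (y : RSpace d) :
    creation v ψ y = ((inner ℝ y v : ℝ) : ℂ) * ψ y - (∂_{v} ψ) y := by
  have h : (fun y : RSpace d => ((inner ℝ y v : ℝ) : ℂ)).HasTemperateGrowth :=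
    Function.HasTemperateGrowth.comp Function.Complex.hasTemperateGrowth_ofReal
      (Function.hasTemperateGrowth_inner_left v)
  rw [creation, sub_apply, SchwartzMap.smulLeftCLM_apply_apply h, smul_eq_mul]

theorem lineDeriv_gaussianAtom (x ξ v y : RSpace d) :
    (∂_{v} (gaussianAtom x ξ)) y =
      (-((inner ℝ (y - x) v : ℝ) : ℂ) - Complex.I * ((inner ℝ v ξ : ℝ) : ℂ)) *
        gaussianAtom x ξ y := by
  rw [SchwartzMap.lineDerivOp_apply_eq_fderiv]
  have h1 : HasDerivAt (fun t : ℝ => y + t • v) v 0 := by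
    simpa using ((hasDerivAt_id (0 : ℝ)).smul_const v).const_add y
  have h2 : HasDerivAt (fun t : ℝ => gaussianAtom x ξ (y + t • v))
      (fderiv ℝ (gaussianAtom x ξ) y v) 0 := by
    have h3 := (gaussianAtom x ξ).hasFDerivAt (y + (0 : ℝ) • v)
    simpa [Function.comp_def] using h3.comp_hasDerivAt (0 : ℝ) h1
  have h4 : ∀ t : ℝ, atomPhase x ξ (y + t • v) = atomPhase x ξ y +
      (-(((inner ℝ (y - x) v : ℝ) : ℂ) * t + (((‖v‖ ^ 2 / 2 : ℝ)) : ℂ) * t ^ 2) -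
        Complex.I * ((inner ℝ v ξ : ℝ) : ℂ) * t) := by
    intro t
    have e1 : ‖y + t • v - x‖ ^ 2 = ‖y - x‖ ^ 2 + 2 * t * inner ℝ (y - x) v + t ^ 2 * ‖v‖ ^ 2 := by
      rw [show y + t • v - x = (y - x) + t • v by abel, norm_add_sq_real, inner_smul_right,
        norm_smul, mul_pow, Real.norm_eq_abs, sq_abs]
      ring
    simp only [atomPhase]
    rw [e1, inner_add_left, real_inner_smul_left]
    push_cast
    ring
  have h5 : HasDerivAt (fun t : ℝ => atomPhase x ξ (y + t • v))
      (-((inner ℝ (y - x) v : ℝ) : ℂ) - Complex.I * ((inner ℝ v ξ : ℝ) : ℂ)) 0 := by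
    simp_rw [h4]
    have ht : HasDerivAt (fun t : ℝ => (t : ℂ)) 1 0 := Complex.ofRealCLM.hasDerivAt
    have h6 := (((ht.const_mul (((inner ℝ (y - x) v : ℝ) : ℂ))).add
      ((ht.pow 2).const_mul (((‖v‖ ^ 2 / 2 : ℝ)) : ℂ))).neg.sub
        (ht.const_mul (Complex.I * ((inner ℝ v ξ : ℝ) : ℂ)))).const_add (atomPhase x ξ y)
    exact h6.congr_deriv (by simp)
  have h6 : HasDerivAt (fun t : ℝ => gaussianAtom x ξ (y + t • v))
      ((-((inner ℝ (y - x) v : ℝ) : ℂ) - Complex.I * ((inner ℝ v ξ : ℝ) : ℂ)) *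
        gaussianAtom x ξ y) 0 := by
    simp only [gaussianAtom_apply]
    have h7 := (h5.cexp).const_mul (gaussianConst d : ℂ)
    simp only [zero_smul, add_zero] at h7
    exact h7.congr_deriv (by ring)
  exact h2.unique h6

/-- Integration by parts moves `∂_v` onto the atom, where it produces the factor `-⟨y - x, v⟩ - i⟨v,
ξ⟩`. The terms in `y` cancel, and the creation operator becomes multiplication by a function of the
phase-space point alone. -/
theorem stft_creation (v : RSpace d) (ψ : 𝓢(RSpace d, ℂ)) (z : RSpace d × RSpace d) :
    stft (gaussianWindow d) (creation v ψ) z =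
      (((inner ℝ z.1 v : ℝ) : ℂ) - Complex.I * ((inner ℝ v z.2 : ℝ) : ℂ)) *
        stft (gaussianWindow d) ψ z := by
  rw [stft_gaussianWindow, stft_gaussianWindow]
  have hi : ∀ χ : 𝓢(RSpace d, ℂ), Integrable fun y => χ y * gaussianAtom z.1 z.2 y := fun χ =>
    (χ.memLp 2).integrable_mul ((gaussianAtom z.1 z.2).memLp 2)
  have h1 := SchwartzMap.integral_mul_lineDerivOp_right_eq_neg_left (μ := volume) ψ
    (gaussianAtom z.1 z.2) v
  have h2 : ∀ y, creation v ψ y * gaussianAtom z.1 z.2 y =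
      (((inner ℝ z.1 v : ℝ) : ℂ) - Complex.I * ((inner ℝ v z.2 : ℝ) : ℂ)) *
        (ψ y * gaussianAtom z.1 z.2 y) -
      (ψ y * (∂_{v} (gaussianAtom z.1 z.2)) y + (∂_{v} ψ) y * gaussianAtom z.1 z.2 y) := by
    intro y
    rw [creation_apply, lineDeriv_gaussianAtom, inner_sub_left]
    push_cast
    ring
  simp_rw [h2]
  have i1 : Integrable fun y => ψ y * (∂_{v} (gaussianAtom z.1 z.2)) y :=
    (ψ.memLp 2).integrable_mul ((∂_{v} (gaussianAtom z.1 z.2)).memLp 2)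
  have i2 : Integrable fun y => ψ y * (∂_{v} (gaussianAtom z.1 z.2)) y +
      (∂_{v} ψ) y * gaussianAtom z.1 z.2 y := i1.add (hi _)
  rw [integral_sub ((hi ψ).const_mul _) i2, integral_add i1 (hi _), h1, integral_const_mul]
  ring

theorem norm_stft_le_of_schwartz (ψ : 𝓢(RSpace d, ℂ)) :
    ∃ C, ∀ z, ‖stft (gaussianWindow d) ψ z‖ ≤ C := by
  refine ⟨stftConst d * ∫ y, ‖ψ y‖ * gaussianConst d, fun z => ?_⟩
  rw [stft_gaussianWindow, norm_mul, Complex.norm_real, Real.norm_of_nonneg stftConst_pos.le]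
  refine mul_le_mul_of_nonneg_left ?_ stftConst_pos.le
  refine norm_integral_le_of_norm_le (ψ.integrable.norm.mul_const _)
    (Eventually.of_forall fun y => ?_)
  rw [norm_mul]
  exact mul_le_mul_of_nonneg_left (norm_gaussianAtom_le _ _ _) (norm_nonneg _)

theorem norm_le_sum_coord (x : RSpace d) : ‖x‖ ≤ ∑ j, |x j| := by
  conv_lhs => rw [← (EuclideanSpace.basisFun (Fin d) ℝ).sum_repr x]
  refine (norm_sum_le _ _).trans (Finset.sum_le_sum fun j _ => ?_)
  simp [norm_smul]

/-- Each power of `‖z‖` is paid for by one creation operator: the factors `x_j - i ξ_j` over all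
coordinates `j` control `‖z‖`, and creation operators preserve the Schwartz space. -/
theorem stft_schwartz_decay (N : ℕ) (ψ : 𝓢(RSpace d, ℂ)) :
    ∃ C, ∀ z, ‖z‖ ^ N * ‖stft (gaussianWindow d) ψ z‖ ≤ C := by
  induction N generalizing ψ with
  | zero => simpa using norm_stft_le_of_schwartz ψ
  | succ N ih =>
    choose C hC using fun j : Fin d => ih (creation (EuclideanSpace.single j (1 : ℝ)) ψ)
    refine ⟨∑ j, 2 * C j, fun z => ?_⟩
    have h1 : ∀ j, ‖stft (gaussianWindow d) (creation (EuclideanSpace.single j (1 : ℝ)) ψ) z‖ =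
        ‖(z.1 j : ℂ) - Complex.I * (z.2 j : ℂ)‖ * ‖stft (gaussianWindow d) ψ z‖ := by
      intro j
      rw [stft_creation, norm_mul]
      simp [EuclideanSpace.inner_single_left, EuclideanSpace.inner_single_right]
    have h2 : ‖z‖ ≤ ∑ j, 2 * ‖(z.1 j : ℂ) - Complex.I * (z.2 j : ℂ)‖ := by
      have h3 : ‖z‖ ≤ ‖z.1‖ + ‖z.2‖ := by
        rw [Prod.norm_def]
        exact max_le (le_add_of_nonneg_right (norm_nonneg _))
          (le_add_of_nonneg_left (norm_nonneg _))
      refine h3.trans ((add_le_add (norm_le_sum_coord z.1) (norm_le_sum_coord z.2)).trans ?_)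
      rw [← Finset.sum_add_distrib]
      refine Finset.sum_le_sum fun j _ => ?_
      have h4 := Complex.abs_re_le_norm ((z.1 j : ℂ) - Complex.I * (z.2 j : ℂ))
      have h5 := Complex.abs_im_le_norm ((z.1 j : ℂ) - Complex.I * (z.2 j : ℂ))
      simp at h4 h5
      linarith
    calc ‖z‖ ^ (N + 1) * ‖stft (gaussianWindow d) ψ z‖
        = ‖z‖ * (‖z‖ ^ N * ‖stft (gaussianWindow d) ψ z‖) := by ring
      _ ≤ (∑ j, 2 * ‖(z.1 j : ℂ) - Complex.I * (z.2 j : ℂ)‖) *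
          (‖z‖ ^ N * ‖stft (gaussianWindow d) ψ z‖) := by gcongr
      _ = ∑ j, 2 * (‖z‖ ^ N *
          ‖stft (gaussianWindow d) (creation (EuclideanSpace.single j (1 : ℝ)) ψ) z‖) := by
          rw [Finset.sum_mul]
          refine Finset.sum_congr rfl fun j _ => ?_
          rw [h1]
          ring
      _ ≤ ∑ j, 2 * C j := by
          refine Finset.sum_le_sum fun j _ => ?_
          have := hC j z
          linarith

instance : (volume : Measure (RSpace d × RSpace d)).IsAddHaarMeasure :=
  Measure.prod.instIsAddHaarMeasure (volume : Measure (RSpace d)) (volume : Measure (RSpace d))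

theorem integrable_pow_mul_stft (N : ℕ) (ψ : 𝓢(RSpace d, ℂ)) :
    Integrable fun z => (1 + ‖z‖) ^ N * ‖stft (gaussianWindow d) ψ z‖ := by
  have hm : StronglyMeasurable (stft (gaussianWindow d) ψ) :=
    stronglyMeasurable_stft memLp_gaussianWindow.1 (ψ.memLp 2).1
  have h : ∀ k, Integrable fun z => ‖z‖ ^ k * ‖stft (gaussianWindow d) ψ z‖ := by
    intro k
    obtain ⟨C1, h1⟩ := norm_stft_le_of_schwartz ψ
    obtain ⟨C2, h2⟩ := stft_schwartz_decay
      (k + (volume : Measure (RSpace d × RSpace d)).integrablePower) ψ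
    exact integrable_of_le_of_pow_mul_le h1 h2 hm.aestronglyMeasurable
  have h0 : Integrable fun z => ‖stft (gaussianWindow d) ψ z‖ := by simpa using h 0
  refine ((h0.add (h N)).const_mul (2 ^ (N - 1))).mono' ?_ (Eventually.of_forall fun z => ?_)
  · exact ((continuous_const.add continuous_norm).pow N).aestronglyMeasurable.mul
      hm.norm.aestronglyMeasurable
  · rw [Real.norm_of_nonneg (by positivity)]
    have := add_pow_le zero_le_one (norm_nonneg z) N
    rw [one_pow] at this
    calc _ ≤ (2 ^ (N - 1) * (1 + ‖z‖ ^ N)) * ‖stft (gaussianWindow d) ψ z‖ := by gcongr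
      _ = _ := by simp only [Pi.add_apply]; ring

end GaussianWindow

/-! ### The reproducing formula, `M² = L²`, and pointwise convolution bounds -/

section Reproducing

open scoped ComplexConjugate

variable {d : ℕ}

theorem continuous_gaussianSTFT (u : 𝓢'(RSpace d, ℂ)) : Continuous (gaussianSTFT u) :=
  continuous_const.mul ((show Continuous u from ContinuousLinearMap.continuous u).comp continuous_gaussianAtom)

theorem exists_isL2Function {f : RSpace d → ℂ} (hf : MemLp f 2) :
    ∃ u : 𝓢'(RSpace d, ℂ), IsL2Function u f := by
  refine ⟨Lp.toTemperedDistribution (hf.toLp f), hf, fun ψ => ?_⟩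
  rw [Lp.toTemperedDistribution_apply]
  refine integral_congr_ae ?_
  filter_upwards [hf.coeFn_toLp] with y hy
  rw [hy, smul_eq_mul]

theorem continuous_stft_gaussianWindow {f : RSpace d → ℂ} (hf : MemLp f 2) :
    Continuous (stft (gaussianWindow d) f) := by
  obtain ⟨u, hu⟩ := exists_isL2Function hf
  rw [← gaussianSTFT_eq_stft hu]
  exact continuous_gaussianSTFT u

/-- The superposition of Gaussian atoms that reproduces `ψ`. -/
noncomputable def atomSuperposition (ψ : 𝓢(RSpace d, ℂ)) (z : RSpace d × RSpace d) :
    𝓢(RSpace d, ℂ) :=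
  ((stftConst d : ℂ) * stft (gaussianWindow d) ψ z) • gaussianAtom z.1 (-z.2)

theorem atomSuperposition_apply (ψ : 𝓢(RSpace d, ℂ)) (z : RSpace d × RSpace d) (y : RSpace d) :
    atomSuperposition ψ z y =
      (stftConst d : ℂ) * stft (gaussianWindow d) ψ z * gaussianAtom z.1 (-z.2) y := rfl

theorem continuous_atomSuperposition (ψ : 𝓢(RSpace d, ℂ)) : Continuous (atomSuperposition ψ) :=
  (continuous_const.mul (continuous_stft_gaussianWindow (ψ.memLp 2))).smul
    (continuous_gaussianAtom.comp (continuous_fst.prodMk continuous_snd.neg))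

theorem integrable_seminorm_atomSuperposition (ψ : 𝓢(RSpace d, ℂ)) (k n : ℕ) :
    Integrable fun z => SchwartzMap.seminorm ℝ k n (atomSuperposition ψ z) := by
  obtain ⟨C, N, hC, h⟩ := seminorm_gaussianAtom_le (d := d) k n
  refine Integrable.mono' ((integrable_pow_mul_stft N ψ).const_mul (stftConst d * C)) ?_
    (Eventually.of_forall fun z => ?_)
  · exact (((schwartz_withSeminorms ℝ (RSpace d) ℂ).continuous_seminorm (k, n)).comp
      (continuous_atomSuperposition ψ)).aestronglyMeasurable
  · rw [Real.norm_of_nonneg (apply_nonneg _ _)]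
    have h1 : SchwartzMap.seminorm ℝ k n (atomSuperposition ψ z) =
        ‖(stftConst d : ℂ) * stft (gaussianWindow d) ψ z‖ *
          SchwartzMap.seminorm ℝ k n (gaussianAtom z.1 (-z.2)) :=
      map_smul_eq_mul (SchwartzMap.seminorm ℂ k n) _ _
    have h2 := h (z.1, -z.2)
    have h3 : ‖((z.1, -z.2) : RSpace d × RSpace d)‖ = ‖z‖ := by simp [Prod.norm_def]
    rw [h3] at h2
    rw [h1, norm_mul, Complex.norm_real, Real.norm_of_nonneg stftConst_pos.le]
    calc _ ≤ stftConst d * ‖stft (gaussianWindow d) ψ z‖ * (C * (1 + ‖z‖) ^ N) :=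
          mul_le_mul_of_nonneg_left h2 (mul_nonneg stftConst_pos.le (norm_nonneg _))
      _ = _ := by ring

theorem integrable_stft_schwartz (ψ : 𝓢(RSpace d, ℂ)) :
    Integrable (stft (gaussianWindow d) ψ) := by
  have h := integrable_pow_mul_stft 0 ψ
  simp only [pow_zero, one_mul] at h
  exact (integrable_norm_iff
    (continuous_stft_gaussianWindow (ψ.memLp 2)).aestronglyMeasurable).1 h

/-- Conjugation of an atom reverses its frequency. After Fubini the left side is therefore the inner
product of the transforms of `ψ` and `conj χ`, and Moyal's identity evaluates it. -/
theorem integral_mul_atomSuperposition (ψ : 𝓢(RSpace d, ℂ)) {χ : RSpace d → ℂ}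
    (h1 : Integrable χ) (h2 : MemLp χ 2) :
    ∫ y, χ y * ∫ z, atomSuperposition ψ z y = ∫ y, χ y * ψ y := by
  have hint : Integrable (fun p : RSpace d × (RSpace d × RSpace d) =>
      χ p.1 * atomSuperposition ψ p.2 p.1) (volume.prod volume) := by
    have h3 := (h1.mul_prod ((integrable_stft_schwartz ψ).const_mul
      (stftConst d : ℂ))).bdd_mul (f := fun p : RSpace d × (RSpace d × RSpace d) =>
        gaussianAtom p.2.1 (-p.2.2) p.1) (c := gaussianConst d) ?_
        (Eventually.of_forall fun p => norm_gaussianAtom_le _ _ _)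
    · refine h3.congr (Eventually.of_forall fun p => ?_)
      simp only [atomSuperposition_apply]
      ring
    · refine Continuous.aestronglyMeasurable ?_
      simp only [gaussianAtom_apply, atomPhase]
      fun_prop
  simp_rw [← integral_const_mul]
  rw [integral_integral_swap hint]
  have h5 : ∀ z, ∫ y, χ y * atomSuperposition ψ z y =
      stft (gaussianWindow d) ψ z *
        conj (stft (gaussianWindow d) (fun y => conj (χ y)) z) := by
    intro z
    rw [stft_gaussianWindow (fun y => conj (χ y)), map_mul, Complex.conj_ofReal, ← integral_conj,
      ← integral_const_mul, ← integral_const_mul]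
    refine integral_congr_ae (Eventually.of_forall fun y => ?_)
    simp only [atomSuperposition_apply, map_mul, Complex.conj_conj, conj_gaussianAtom]
    ring
  simp_rw [h5]
  have hs : MemLp (fun y => conj (χ y)) 2 := h2.star
  rw [integral_stft_gaussianWindow (ψ.memLp 2) hs]
  refine integral_congr_ae (Eventually.of_forall fun y => ?_)
  simp only [Complex.conj_conj]
  ring

/-- Moyal's identity gives equality against test functions, hence almost everywhere; both sides are
continuous, so equality holds at every point. -/
theorem schwartz_eq_integral (ψ : 𝓢(RSpace d, ℂ)) (y : RSpace d) :
    ψ y = ∫ z, atomSuperposition ψ z y := by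
  have hc : Continuous fun y => ∫ z, atomSuperposition ψ z y := by
    refine continuous_of_dominated (bound := fun z => stftConst d *
      ‖stft (gaussianWindow d) ψ z‖ * gaussianConst d) ?_ ?_ ?_ ?_
    · intro y
      exact ((SchwartzMap.continuous_eval y).comp
        (continuous_atomSuperposition ψ)).aestronglyMeasurable
    · intro y
      refine Eventually.of_forall fun z => ?_
      rw [atomSuperposition_apply, norm_mul, norm_mul, Complex.norm_real,
        Real.norm_of_nonneg stftConst_pos.le]
      exact mul_le_mul_of_nonneg_left (norm_gaussianAtom_le _ _ _)
        (mul_nonneg stftConst_pos.le (norm_nonneg _))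
    · exact ((integrable_stft_schwartz ψ).norm.const_mul _).mul_const _
    · exact Eventually.of_forall fun z => (atomSuperposition ψ z).continuous
  have hae : ∀ᵐ y, ψ y = ∫ z, atomSuperposition ψ z y := by
    refine ae_eq_of_integral_contDiff_smul_eq ψ.continuous.locallyIntegrable
      hc.locallyIntegrable fun g hg hgc => ?_
    have h1 : Continuous fun y => ((g y : ℝ) : ℂ) := Complex.continuous_ofReal.comp hg.continuous
    have h2 : HasCompactSupport fun y => ((g y : ℝ) : ℂ) :=
      hgc.comp_left (g := fun t : ℝ => (t : ℂ)) rfl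
    have h := integral_mul_atomSuperposition ψ (h1.integrable_of_hasCompactSupport h2)
      (h1.memLp_of_hasCompactSupport h2)
    simpa [Complex.real_smul] using h.symm
  exact congrFun ((Continuous.ae_eq_iff_eq volume ψ.continuous hc).1 hae) y

theorem apply_eq_integral_gaussianSTFT (u : 𝓢'(RSpace d, ℂ)) (ψ : 𝓢(RSpace d, ℂ)) :
    u ψ = ∫ z : RSpace d × RSpace d,
      stft (gaussianWindow d) ψ z * gaussianSTFT u (z.1, -z.2) := by
  have h := SchwartzMap.apply_eq_integral (μ := volume) (u : 𝓢(RSpace d, ℂ) →L[ℂ] ℂ)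
    (continuous_atomSuperposition ψ)
    (integrable_seminorm_atomSuperposition ψ) (schwartz_eq_integral ψ)
  refine h.trans (integral_congr_ae (Eventually.of_forall fun z => ?_))
  have h1 : u (atomSuperposition ψ z) = ((stftConst d : ℂ) * stft (gaussianWindow d) ψ z) *
      u (gaussianAtom z.1 (-z.2)) :=
    ContinuousLinearMap.map_smul (u : 𝓢(RSpace d, ℂ) →L[ℂ] ℂ) _ _
  refine h1.trans ?_
  simp only [gaussianSTFT]
  rw [← stftConst]
  ring

theorem measurePreserving_conjFrequency :
    MeasurePreserving (fun z : RSpace d × RSpace d => (z.1, -z.2)) volume volume :=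
  (MeasurePreserving.id (volume : Measure (RSpace d))).prod
    (Measure.measurePreserving_neg (volume : Measure (RSpace d)))

/-- Cauchy–Schwarz in the reproducing formula, together with the isometry `‖V ψ‖₂ = ‖ψ‖₂`. This
makes `u` bounded for the `L²` norm on Schwartz functions. -/
theorem enorm_apply_le (u : 𝓢'(RSpace d, ℂ)) (ψ : 𝓢(RSpace d, ℂ)) :
    ‖u ψ‖ₑ ≤ eLpNorm (gaussianSTFT u) 2 volume * eLpNorm ψ 2 volume := by
  have hV : Continuous (stft (gaussianWindow d) ψ) :=
    continuous_stft_gaussianWindow (ψ.memLp 2)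
  have hG : Continuous fun z : RSpace d × RSpace d => gaussianSTFT u (z.1, -z.2) :=
    (continuous_gaussianSTFT u).comp (continuous_fst.prodMk continuous_snd.neg)
  rw [apply_eq_integral_gaussianSTFT]
  refine (enorm_integral_le_lintegral_enorm _).trans ?_
  simp_rw [enorm_mul]
  refine (ENNReal.lintegral_mul_le_Lp_mul_Lq volume Real.HolderConjugate.two_two
    hV.enorm.aemeasurable hG.enorm.aemeasurable).trans ?_
  have e : ∀ F : RSpace d × RSpace d → ℂ,
      (∫⁻ z, ‖F z‖ₑ ^ (2 : ℝ)) ^ (1 / 2 : ℝ) = eLpNorm F 2 volume := by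
    intro F
    rw [eLpNorm_eq_lintegral_rpow_enorm_toReal (by simp) (by simp)]
    simp
  rw [e (stft (gaussianWindow d) ψ), e fun z : RSpace d × RSpace d => gaussianSTFT u (z.1, -z.2),
    mul_comm]
  have e1 : eLpNorm (fun z : RSpace d × RSpace d => gaussianSTFT u (z.1, -z.2)) 2 volume =
      eLpNorm (gaussianSTFT u) 2 volume :=
    eLpNorm_comp_measurePreserving (continuous_gaussianSTFT u).aestronglyMeasurable
      measurePreserving_conjFrequency
  have e2 : eLpNorm (stft (gaussianWindow d) ψ) 2 volume = eLpNorm ψ 2 volume := by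
    have h := lintegral_stft_gaussianWindow_sq (ψ.memLp 2)
    rw [← eLpNorm_two_sq, ← eLpNorm_two_sq] at h
    exact (ENNReal.pow_right_strictMono two_ne_zero).injective h
  rw [e1, e2]

theorem exists_dual_of_eLpNorm_lt_top {u : 𝓢'(RSpace d, ℂ)}
    (hu : eLpNorm (gaussianSTFT u) 2 volume < ⊤) :
    ∃ ℓ : Lp ℂ 2 (volume : Measure (RSpace d)) →L[ℂ] ℂ, ∀ ψ : 𝓢(RSpace d, ℂ),
      ℓ (ψ.toLp 2 volume) = u ψ := by
  have hbound : ∀ ψ : 𝓢(RSpace d, ℂ),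
      ‖u ψ‖ ≤ (eLpNorm (gaussianSTFT u) 2 volume).toReal * ‖ψ.toLp 2 volume‖ := by
    intro ψ
    have h0 : eLpNorm ψ 2 volume ≠ ⊤ := (ψ.memLp 2 volume).2.ne
    have h1 : eLpNorm (gaussianSTFT u) 2 volume * eLpNorm ψ 2 volume ≠ ⊤ :=
      ENNReal.mul_ne_top hu.ne h0
    have h := ENNReal.toReal_mono h1 (enorm_apply_le u ψ)
    rwa [ENNReal.toReal_mul, toReal_enorm, ← SchwartzMap.norm_toLp] at h
  have hd : DenseRange (SchwartzMap.toLpCLM ℂ (E := RSpace d) ℂ 2 volume) :=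
    SchwartzMap.denseRange_toLpCLM ENNReal.ofNat_ne_top
  exact ⟨_, fun ψ => LinearMap.extendOfNorm_eq
    (f := (u : 𝓢(RSpace d, ℂ) →L[ℂ] ℂ).toLinearMap)
    (e := (SchwartzMap.toLpCLM ℂ (E := RSpace d) ℂ 2 volume).toLinearMap) hd ⟨_, hbound⟩ ψ⟩

theorem exists_isL2Function_of_eLpNorm_lt_top {u : 𝓢'(RSpace d, ℂ)}
    (hu : eLpNorm (gaussianSTFT u) 2 volume < ⊤) : ∃ f, IsL2Function u f := by
  obtain ⟨ℓ, hℓ⟩ := exists_dual_of_eLpNorm_lt_top hu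
  let g := (InnerProductSpace.toDual ℂ (Lp ℂ 2 (volume : Measure (RSpace d)))).symm ℓ
  -- The conjugate enters because distributions pair bilinearly with functions, while the inner
  -- product is conjugate linear in the Riesz representative.
  refine ⟨fun y => conj (g y), (Lp.memLp g).star, fun ψ => ?_⟩
  rw [← hℓ, ← InnerProductSpace.toDual_symm_apply, L2.inner_def]
  refine integral_congr_ae ?_
  filter_upwards [ψ.coeFn_toLp 2 volume] with y hy
  rw [RCLike.inner_apply, hy]

theorem lebesgueModNorm_two_lt_top_iff (u : 𝓢'(RSpace d, ℂ)) :
    lebesgueModNorm 2 u < ⊤ ↔ ∃ f, IsL2Function u f := by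
  refine ⟨exists_isL2Function_of_eLpNorm_lt_top, fun ⟨f, hf⟩ => ?_⟩
  rw [lebesgueModNorm, gaussianSTFT_eq_stft hf]
  exact (memLp_stft memLp_gaussianWindow hf.1).2

/-- The time-frequency shift of `φ` by `w`. -/
noncomputable def timeFreqShift (φ : RSpace d → ℂ) (w : RSpace d × RSpace d) (y : RSpace d) : ℂ :=
  φ (y - w.1) * Complex.exp (Complex.I * ((inner ℝ y w.2 : ℝ) : ℂ))

theorem norm_cexp_I_mul (t : ℝ) : ‖Complex.exp (Complex.I * (t : ℂ))‖ = 1 := by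
  rw [mul_comm]
  exact Complex.norm_exp_ofReal_mul_I t

theorem memLp_timeFreqShift {φ : RSpace d → ℂ} (hφ : MemLp φ 2) (w : RSpace d × RSpace d) :
    MemLp (timeFreqShift φ w) 2 := by
  have hc : Continuous fun y : RSpace d =>
      Complex.exp (Complex.I * ((inner ℝ y w.2 : ℝ) : ℂ)) := by fun_prop
  refine (memLp_comp_sub hφ w.1).of_le ((memLp_comp_sub hφ w.1).1.mul hc.aestronglyMeasurable)
    (Eventually.of_forall fun y => ?_)
  rw [timeFreqShift, norm_mul, norm_cexp_I_mul, mul_one]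

theorem stft_eq_integral_timeFreqShift (φ f : RSpace d → ℂ) (w : RSpace d × RSpace d) :
    stft φ f w = (stftConst d : ℂ) * ∫ y, f y * conj (timeFreqShift φ w y) := by
  unfold stft
  rw [stftConst]
  congr 1
  refine integral_congr_ae (Eventually.of_forall fun y => ?_)
  simp only [timeFreqShift, map_mul, ← Complex.exp_conj, Complex.conj_I, Complex.conj_ofReal]
  rw [mul_assoc, neg_mul]

/-- Covariance: shifting the function by `w` translates its transform by `w` up to a phase factor.
-/
theorem norm_stft_timeFreqShift (g φ : RSpace d → ℂ) (w z : RSpace d × RSpace d) :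
    ‖stft g (timeFreqShift φ w) z‖ = ‖stft g φ (z - w)‖ := by
  unfold stft
  rw [norm_mul, norm_mul]
  congr 1
  rw [← integral_add_right_eq_self _ w.1]
  have h : ∀ y, timeFreqShift φ w (y + w.1) * (starRingEnd ℂ) (g (y + w.1 - z.1)) *
      Complex.exp (-(Complex.I * ((inner ℝ (y + w.1) z.2 : ℝ) : ℂ))) =
      Complex.exp (Complex.I * ((inner ℝ w.1 (w.2 - z.2) : ℝ) : ℂ)) *
      (φ y * (starRingEnd ℂ) (g (y - (z - w).1)) *
        Complex.exp (-(Complex.I * ((inner ℝ y (z - w).2 : ℝ) : ℂ)))) := by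
    intro y
    have e1 : y + w.1 - z.1 = y - (z - w).1 := by simp; abel
    have e2 : Complex.exp (Complex.I * ((inner ℝ (y + w.1) w.2 : ℝ) : ℂ)) *
        Complex.exp (-(Complex.I * ((inner ℝ (y + w.1) z.2 : ℝ) : ℂ))) =
        Complex.exp (Complex.I * ((inner ℝ w.1 (w.2 - z.2) : ℝ) : ℂ)) *
        Complex.exp (-(Complex.I * ((inner ℝ y (z - w).2 : ℝ) : ℂ))) := by
      rw [← Complex.exp_add, ← Complex.exp_add]
      congr 1
      simp only [Prod.snd_sub, inner_add_left, inner_sub_right]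
      push_cast
      ring
    rw [timeFreqShift, add_sub_cancel_right, e1]
    linear_combination (φ y * (starRingEnd ℂ) (g (y - (z - w).1))) * e2
  simp_rw [h]
  rw [integral_const_mul, norm_mul, norm_cexp_I_mul, one_mul]

theorem gaussianAtom_eq_timeFreqShift (w : RSpace d × RSpace d) :
    (gaussianAtom w.1 w.2 : RSpace d → ℂ) = timeFreqShift (gaussianWindow d) (w.1, -w.2) := by
  funext y
  rw [gaussianAtom_eq, conj_gaussianWindow, timeFreqShift]
  simp

/-- The modulus of the short-time Fourier transform of `φ₀`, as a convolution kernel. -/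
noncomputable def reproducingKernel (d : ℕ) (z : RSpace d × RSpace d) : ℝ≥0∞ :=
  ENNReal.ofReal (stftConst d) * ‖stft (gaussianWindow d) (gaussianWindow d) (z.1, -z.2)‖ₑ

theorem enorm_stftConst : ‖(stftConst d : ℂ)‖ₑ = ENNReal.ofReal (stftConst d) := by
  rw [← ofReal_norm, Complex.norm_real, Real.norm_of_nonneg stftConst_pos.le]

/-- The reproducing formula applied to the atom at `w`. It needs no integrability of `u`, and thus
gives sup bounds for distributions not yet known to lie in `L²`. -/
theorem enorm_gaussianSTFT_le (u : 𝓢'(RSpace d, ℂ)) (w : RSpace d × RSpace d) :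
    ‖gaussianSTFT u w‖ₑ ≤ ∫⁻ z, ‖gaussianSTFT u z‖ₑ * reproducingKernel d (z - w) := by
  have h1 : gaussianSTFT u w = (stftConst d : ℂ) * u (gaussianAtom w.1 w.2) := rfl
  rw [h1, apply_eq_integral_gaussianSTFT, enorm_mul, enorm_stftConst]
  refine (mul_le_mul_right (enorm_integral_le_lintegral_enorm _) _).trans ?_
  rw [← lintegral_const_mul' _ _ ENNReal.ofReal_ne_top,
    ← measurePreserving_conjFrequency.lintegral_comp_emb
      (MeasurableEquiv.prodCongr (MeasurableEquiv.refl _) (MeasurableEquiv.neg _)).measurableEmbedding]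
  refine lintegral_mono fun z => ?_
  rw [gaussianAtom_eq_timeFreqShift, enorm_mul, reproducingKernel]
  have h2 := norm_stft_timeFreqShift (gaussianWindow d) (gaussianWindow d) (w.1, -w.2) (z.1, -z.2)
  have h3 : ‖stft (gaussianWindow d) (timeFreqShift (gaussianWindow d) (w.1, -w.2)) (z.1, -z.2)‖ₑ =
      ‖stft (gaussianWindow d) (gaussianWindow d) ((z - w).1, -(z - w).2)‖ₑ := by
    rw [← ofReal_norm, h2, ofReal_norm]
    congr 2
    ext <;> simp [sub_eq_add_neg, add_comm]
  have h4 : gaussianSTFT u ((z.1, -z.2).1, -(z.1, -z.2).2) = gaussianSTFT u z := by simp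
  rw [h3, h4]
  refine le_of_eq ?_
  ring

/-- Change of window: `V_φ f(w)` is an inner product of `f` with a shift of `φ`, which Moyal's
identity rewrites through Gaussian transforms. -/
theorem enorm_stft_le {φ f : RSpace d → ℂ} (hφ : MemLp φ 2) (hf : MemLp f 2)
    (w : RSpace d × RSpace d) :
    ‖stft φ f w‖ₑ ≤ ∫⁻ z, ‖stft (gaussianWindow d) f z‖ₑ *
      (ENNReal.ofReal (stftConst d) * ‖stft (gaussianWindow d) φ (z - w)‖ₑ) := by
  rw [stft_eq_integral_timeFreqShift, ← integral_stft_gaussianWindow hf (memLp_timeFreqShift hφ w),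
    enorm_mul, enorm_stftConst]
  refine (mul_le_mul_right (enorm_integral_le_lintegral_enorm _) _).trans ?_
  rw [← lintegral_const_mul' _ _ ENNReal.ofReal_ne_top]
  refine lintegral_mono fun z => ?_
  have h : ‖conj (stft (gaussianWindow d) (timeFreqShift φ w) z)‖ₑ =
      ‖stft (gaussianWindow d) φ (z - w)‖ₑ := by
    rw [← ofReal_norm, RCLike.norm_conj, norm_stft_timeFreqShift, ofReal_norm]
  rw [enorm_mul, h]
  refine le_of_eq ?_
  ring

end Reproducing

/-! ### Sup bounds from modulars, and elementary properties of Young functions -/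

section OrliczBounds

variable {d : ℕ}

theorem measurable_reproducingKernel : Measurable (reproducingKernel d) := by
  have h : Continuous fun z : RSpace d × RSpace d =>
      stft (gaussianWindow d) (gaussianWindow d) (z.1, -z.2) :=
    (continuous_stft_gaussianWindow memLp_gaussianWindow).comp
      (continuous_fst.prodMk continuous_snd.neg)
  exact h.measurable.enorm.const_mul _

theorem lintegral_reproducingKernel_lt_top : ∫⁻ z, reproducingKernel d z < ⊤ := by
  unfold reproducingKernel
  rw [lintegral_const_mul' _ _ ENNReal.ofReal_ne_top]
  refine ENNReal.mul_lt_top ENNReal.ofReal_lt_top ?_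
  rw [measurePreserving_conjFrequency.lintegral_comp
    (continuous_stft_gaussianWindow memLp_gaussianWindow).measurable.enorm
    (f := fun z => ‖stft (gaussianWindow d) (gaussianWindow d) z‖ₑ)]
  exact (integrable_stft_schwartz (gaussianWindow d)).2

theorem exists_reproducingKernel_le :
    ∃ B : ℝ≥0∞, B < ⊤ ∧ ∀ z, reproducingKernel d z ≤ B := by
  obtain ⟨C, hC⟩ := norm_stft_le_of_schwartz (gaussianWindow d)
  refine ⟨ENNReal.ofReal (stftConst d) * ENNReal.ofReal C,
    ENNReal.mul_lt_top ENNReal.ofReal_lt_top ENNReal.ofReal_lt_top, fun z => ?_⟩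
  refine mul_le_mul_right ?_ _
  rw [← ofReal_norm]
  exact ENNReal.ofReal_le_ofReal (hC _)

/-- A modular of at least linear growth controls the supremum of the short-time Fourier
transform. -/
theorem exists_enorm_gaussianSTFT_le {Ψ : ℝ≥0∞ → ℝ≥0∞} {A c : ℝ≥0∞} (hA : A ≠ ⊤) (hc : c ≠ ⊤)
    (hΨ : ∀ t, t ≤ A + c * Ψ t) :
    ∃ D : ℝ≥0∞, D < ⊤ ∧ ∀ (u : 𝓢'(RSpace d, ℂ)) (a : ℝ≥0∞), a ≠ 0 → a ≠ ⊤ →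
      ∫⁻ z, Ψ (‖gaussianSTFT u z‖ₑ / a) ≤ 1 → ∀ w, ‖gaussianSTFT u w‖ₑ ≤ a * D := by
  obtain ⟨B, hB, hκ⟩ := exists_reproducingKernel_le (d := d)
  have hAm : A < ⊤ := hA.lt_top
  have hcm : c < ⊤ := hc.lt_top
  refine ⟨A * (∫⁻ z, reproducingKernel d z) + c * B, ENNReal.add_lt_top.2
    ⟨ENNReal.mul_lt_top hAm lintegral_reproducingKernel_lt_top, ENNReal.mul_lt_top hcm hB⟩,
    fun u a ha ha' h w => ?_⟩
  refine (enorm_gaussianSTFT_le u w).trans ?_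
  -- Of the two terms of `A + c Ψ`, the constant is integrated against the integrable kernel, and
  -- the modular uses only that the kernel is bounded.
  have h1 : ∀ z, ‖gaussianSTFT u z‖ₑ * reproducingKernel d (z - w) ≤
      a * (A * reproducingKernel d (z - w) + (c * B) * Ψ (‖gaussianSTFT u z‖ₑ / a)) := by
    intro z
    have h2 : ‖gaussianSTFT u z‖ₑ = a * (‖gaussianSTFT u z‖ₑ / a) :=
      (ENNReal.mul_div_cancel ha ha').symm
    calc ‖gaussianSTFT u z‖ₑ * reproducingKernel d (z - w)
        = a * ((‖gaussianSTFT u z‖ₑ / a) * reproducingKernel d (z - w)) := by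
          rw [← mul_assoc, ← h2]
      _ ≤ a * ((A + c * Ψ (‖gaussianSTFT u z‖ₑ / a)) * reproducingKernel d (z - w)) := by
          gcongr
          exact hΨ _
      _ = a * (A * reproducingKernel d (z - w) +
          c * Ψ (‖gaussianSTFT u z‖ₑ / a) * reproducingKernel d (z - w)) := by rw [add_mul]
      _ ≤ a * (A * reproducingKernel d (z - w) +
          c * Ψ (‖gaussianSTFT u z‖ₑ / a) * B) := by
          gcongr
          exact hκ _
      _ = _ := by ring
  refine (lintegral_mono h1).trans ?_
  have hm : Measurable fun z => A * reproducingKernel d (z - w) :=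
    (measurable_reproducingKernel.comp (measurable_id.sub_const w)).const_mul A
  rw [lintegral_const_mul' _ _ ha', lintegral_add_left hm, lintegral_const_mul' _ _ hA,
    lintegral_const_mul' _ _ (ENNReal.mul_lt_top hcm hB).ne,
    lintegral_sub_right_eq_self (fun z => reproducingKernel d z) w]
  exact mul_le_mul_right (add_le_add_right (mul_le_of_le_one_right' h) _) _

variable {Φ : ℝ≥0∞ → ℝ≥0∞}

theorem IsYoungFunction.smul_le (hΦ : IsYoungFunction Φ) {θ : ℝ≥0} (hθ : θ ≤ 1) (t : ℝ≥0∞) :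
    Φ (θ * t) ≤ θ * Φ t := by
  have h := hΦ.convex.2 (Set.mem_univ t) (Set.mem_univ 0) (zero_le (a := θ)) (zero_le (a := 1 - θ))
    (add_tsub_cancel_of_le hθ)
  rw [hΦ.map_zero, smul_zero, add_zero, add_zero] at h
  exact h

theorem IsYoungFunction.monotone (hΦ : IsYoungFunction Φ) : Monotone Φ := by
  intro s t hst
  rcases eq_or_ne t ⊤ with rfl | ht
  · rw [hΦ.map_top]
    exact le_top
  lift t to ℝ≥0 using ht
  lift s to ℝ≥0 using (hst.trans_lt ENNReal.coe_lt_top).ne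
  rcases eq_or_ne t 0 with rfl | ht0
  · rw [le_antisymm hst (by simp)]
  have hst' : s ≤ t := by exact_mod_cast hst
  have hθ : s / t ≤ 1 := div_le_one_of_le₀ hst' zero_le
  have h := hΦ.smul_le hθ t
  rw [← ENNReal.coe_mul, div_mul_cancel₀ _ ht0] at h
  exact h.trans (mul_le_of_le_one_left' (by exact_mod_cast hθ))

/-- Past `s`, a convex function vanishing at zero lies above the line through the origin of slope `Φ
s / s`. This is the linear growth needed for the sup bound. -/
theorem IsYoungFunction.le_add_mul (hΦ : IsYoungFunction Φ) {s : ℝ≥0} (hs : s ≠ 0)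
    (hΦs : Φ s ≠ 0) (hΦs' : Φ s ≠ ⊤) (t : ℝ≥0∞) : t ≤ s + s / Φ s * Φ t := by
  rcases eq_or_ne t ⊤ with rfl | ht
  · rw [hΦ.map_top, ENNReal.mul_top (ENNReal.div_ne_zero.2 ⟨by simpa using hs, hΦs'⟩)]
    simp
  lift t to ℝ≥0 using ht
  rcases le_total t s with h | h
  · exact le_add_right (by exact_mod_cast h)
  · refine le_add_left ?_
    have ht0 : t ≠ 0 := (hs.bot_lt.trans_le h).ne'
    have h1 := hΦ.smul_le (div_le_one_of_le₀ h zero_le : s / t ≤ 1) t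
    rw [← ENNReal.coe_mul, div_mul_cancel₀ _ ht0, ENNReal.coe_div ht0] at h1
    have ht0' : (t : ℝ≥0∞) ≠ 0 := by exact_mod_cast ht0
    calc (t : ℝ≥0∞) = t * (Φ s / Φ s) := by rw [ENNReal.div_self hΦs hΦs', mul_one]
      _ ≤ t * (s / t * Φ t / Φ s) := by gcongr
      _ = (t / t) * (s / Φ s * Φ t) := by simp only [div_eq_mul_inv]; ring
      _ = s / Φ s * Φ t := by rw [ENNReal.div_self ht0' ENNReal.coe_ne_top, one_mul]

end OrliczBounds

/-! ### The function `-t² log t` near zero -/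

section SqLog

/-- The function `t ↦ -t² log t`. -/
noncomputable def sqLog (t : ℝ) : ℝ := -(t ^ 2 * Real.log t)

theorem continuous_sqLog : Continuous sqLog := by
  have h : sqLog = fun t => -(t * (t * Real.log t)) := by
    funext t
    rw [sqLog]
    ring
  rw [h]
  exact (continuous_id.mul Real.continuous_mul_log).neg

theorem hasDerivAt_sqLog {t : ℝ} (ht : t ≠ 0) :
    HasDerivAt sqLog (-(2 * (t * Real.log t) + t)) t := by
  have h := ((hasDerivAt_pow 2 t).mul (Real.hasDerivAt_log ht)).neg
  refine h.congr_deriv ?_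
  field_simp
  push_cast
  ring

theorem sqLog_nonneg {t : ℝ} (h0 : 0 ≤ t) (h1 : t ≤ 1) : 0 ≤ sqLog t := by
  have := Real.log_nonpos h0 h1
  unfold sqLog
  nlinarith [sq_nonneg t]

/-- The cutoff `e⁻²` covers every requirement on `-t² log t`: dominating `t²` needs `log t ≤ -1`,
monotonicity `log t ≤ -1/2`, and convexity `log t ≤ -3/2`. -/
theorem log_le_neg_two {t : ℝ} (h0 : 0 < t) (h1 : t ≤ Real.exp (-2)) : Real.log t ≤ -2 := by
  rwa [Real.log_le_iff_le_exp h0]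

theorem sq_le_sqLog {t : ℝ} (h0 : 0 ≤ t) (h1 : t ≤ Real.exp (-2)) : t ^ 2 ≤ sqLog t := by
  rcases h0.eq_or_lt with rfl | h0
  · simp [sqLog]
  have := log_le_neg_two h0 h1
  unfold sqLog
  nlinarith [sq_nonneg t]

theorem monotoneOn_sqLog : MonotoneOn sqLog (Set.Icc 0 (Real.exp (-2))) := by
  refine monotoneOn_of_hasDerivWithinAt_nonneg (convex_Icc _ _) continuous_sqLog.continuousOn
    (f' := fun t => -(2 * (t * Real.log t) + t)) ?_ ?_
  · intro t ht
    rw [interior_Icc] at ht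
    exact (hasDerivAt_sqLog ht.1.ne').hasDerivWithinAt
  · intro t ht
    rw [interior_Icc] at ht
    nlinarith [log_le_neg_two ht.1 ht.2.le, ht.1]

theorem convexOn_sqLog : ConvexOn ℝ (Set.Icc 0 (Real.exp (-2))) sqLog := by
  refine convexOn_of_hasDerivWithinAt2_nonneg (convex_Icc _ _) continuous_sqLog.continuousOn
    (f' := fun t => -(2 * (t * Real.log t) + t)) (f'' := fun t => -(2 * (Real.log t + 1) + 1))
    ?_ ?_ ?_
  · intro t ht
    rw [interior_Icc] at ht
    exact (hasDerivAt_sqLog ht.1.ne').hasDerivWithinAt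
  · intro t ht
    rw [interior_Icc] at ht
    exact (((Real.hasDerivAt_mul_log ht.1.ne').const_mul 2).add
      (hasDerivAt_id t)).neg.hasDerivWithinAt
  · intro t ht
    rw [interior_Icc] at ht
    linarith [log_le_neg_two ht.1 ht.2.le]

theorem sqLog_le_rpow {t q : ℝ} (h0 : 0 ≤ t) (hq0 : 0 < q) (hq : q < 2) :
    sqLog t ≤ t ^ q / (2 - q) := by
  rcases h0.eq_or_lt with rfl | h0
  · simp [sqLog, Real.zero_rpow hq0.ne']
  have h := Real.log_le_rpow_div (inv_nonneg.2 h0.le) (sub_pos.2 hq)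
  rw [Real.log_inv] at h
  have e : t ^ q = t ^ 2 * t⁻¹ ^ (2 - q) := by
    rw [Real.inv_rpow h0.le, ← Real.rpow_neg h0.le, ← Real.rpow_natCast, ← Real.rpow_add h0]
    norm_num
  rw [e, mul_div_assoc, sqLog, ← mul_neg]
  exact mul_le_mul_of_nonneg_left h (sq_nonneg t)

end SqLog

/-! ### The modular bound and its relation to the norms -/

section Modular

variable {d : ℕ}

/-- The values of `F` are at most `t l`, and the modular of `F / l` for `-t² log t` is at most
one. -/
def SqLogBound (t l : ℝ) (F : RSpace d × RSpace d → ℂ) : Prop :=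
  (∀ z, ‖F z‖ ≤ t * l) ∧ ∫⁻ z, ENNReal.ofReal (sqLog (‖F z‖ / l)) ≤ 1

theorem ofReal_norm_div {l : ℝ} (hl : 0 < l) (w : ℂ) :
    ENNReal.ofReal (‖w‖ / l) = ‖w‖ₑ / ENNReal.ofReal l := by
  rw [ENNReal.ofReal_div_of_pos hl, ofReal_norm]

variable {Φ : ℝ≥0∞ → ℝ≥0∞} {t₁ : ℝ}

theorem SqLogBound.orliczNorm_le {F : RSpace d × RSpace d → ℂ} {l : ℝ} (hl : 0 < l)
    (hΦ_log : ∀ t : ℝ, 0 ≤ t → t ≤ t₁ → Φ (ENNReal.ofReal t) = ENNReal.ofReal (sqLog t))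
    (h : SqLogBound t₁ l F) : orliczNorm Φ F ≤ ENNReal.ofReal l := by
  refine sInf_le ⟨ENNReal.ofReal_pos.2 hl, ENNReal.ofReal_lt_top, ?_⟩
  refine le_trans (le_of_eq (lintegral_congr fun z => ?_)) h.2
  rw [← ofReal_norm_div hl, hΦ_log _ (by positivity) ((div_le_iff₀ hl).2 (h.1 z))]

/-- The sup bound confines `|V u| / (B l)` to `[0, t₁]`, where `Φ` is the explicit function; its
behaviour at larger arguments only enters through monotonicity. -/
theorem exists_sqLogBound_gaussianSTFT (hΦ : IsYoungFunction Φ) (h0 : 0 < t₁)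
    (h1 : t₁ ≤ Real.exp (-2))
    (hΦ_log : ∀ t : ℝ, 0 ≤ t → t ≤ t₁ → Φ (ENNReal.ofReal t) = ENNReal.ofReal (sqLog t)) :
    ∃ B : ℝ, 0 < B ∧ ∀ (u : 𝓢'(RSpace d, ℂ)) (l : ℝ), 0 < l →
      orliczModNorm Φ u < ENNReal.ofReal l → SqLogBound t₁ (B * l) (gaussianSTFT u) := by
  have hs : 0 < sqLog t₁ := (by positivity : 0 < t₁ ^ 2).trans_le (sq_le_sqLog h0.le h1)
  have hΦt := hΦ_log t₁ h0.le le_rfl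
  have hΦ0 : Φ (t₁.toNNReal : ℝ≥0∞) ≠ 0 := by
    change Φ (ENNReal.ofReal t₁) ≠ 0
    rw [hΦt]
    exact (ENNReal.ofReal_pos.2 hs).ne'
  have hΦtop : Φ (t₁.toNNReal : ℝ≥0∞) ≠ ⊤ := by
    change Φ (ENNReal.ofReal t₁) ≠ ⊤
    rw [hΦt]
    exact ENNReal.ofReal_ne_top
  obtain ⟨D, hD, hD'⟩ := exists_enorm_gaussianSTFT_le (d := d) (Ψ := Φ) ENNReal.coe_ne_top
    (ENNReal.div_ne_top ENNReal.coe_ne_top hΦ0)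
    (hΦ.le_add_mul (Real.toNNReal_pos.2 h0).ne' hΦ0 hΦtop)
  lift D to ℝ≥0 using hD.ne
  -- A factor of at least one does not increase the modular, and the factor `D / t₁` brings the sup
  -- bound below `t₁`.
  refine ⟨max 1 (D / t₁), by positivity, fun u l hl hu => ?_⟩
  have hB1 : (1 : ℝ) ≤ max 1 (D / t₁) := le_max_left _ _
  have hB2 : (D : ℝ) ≤ t₁ * max 1 (D / t₁) := by
    rw [mul_comm, ← div_le_iff₀ h0]
    exact le_max_right _ _
  set B := max 1 ((D : ℝ) / t₁)
  have hBl : 0 < B * l := by positivity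
  obtain ⟨a, ⟨ha0, ha1, ha⟩, hal⟩ := sInf_lt_iff.1 hu
  have hb : ∀ z, ‖gaussianSTFT u z‖ ≤ t₁ * (B * l) := by
    intro z
    have h := (hD' u a ha0.ne' ha1.ne ha z).trans (mul_le_mul_left hal.le _)
    rw [← ofReal_norm, ← ENNReal.ofReal_coe_nnreal, ← ENNReal.ofReal_mul hl.le,
      ENNReal.ofReal_le_ofReal_iff (by positivity)] at h
    calc _ ≤ _ := h
      _ ≤ l * (t₁ * B) := by gcongr
      _ = _ := by ring
  refine ⟨hb, le_trans (lintegral_mono fun z => ?_) ha⟩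
  rw [← hΦ_log _ (by positivity) ((div_le_iff₀ hBl).2 (hb z)), ofReal_norm_div hBl]
  refine hΦ.monotone (ENNReal.div_le_div_left (hal.le.trans ?_) _)
  exact ENNReal.ofReal_le_ofReal (le_mul_of_one_le_left hl.le hB1)

/-- The embedding of `M^p` into `M^Φ`: `t^p` dominates `-t² log t` near zero up to the factor `1 /
(2 - p)`, and the sup bound keeps the arguments near zero. -/
theorem exists_orliczModNorm_le (h0 : 0 < t₁)
    (hΦ_log : ∀ t : ℝ, 0 ≤ t → t ≤ t₁ → Φ (ENNReal.ofReal t) = ENNReal.ofReal (sqLog t))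
    {p : ℝ≥0∞} (hp1 : 1 ≤ p) (hp2 : p < 2) :
    ∃ E : ℝ, 0 < E ∧ ∀ (u : 𝓢'(RSpace d, ℂ)) (a : ℝ), 0 < a →
      lebesgueModNorm p u ≤ ENNReal.ofReal a → orliczModNorm Φ u ≤ ENNReal.ofReal (E * a) := by
  have hpt : p ≠ ⊤ := (hp2.trans ENNReal.ofNat_lt_top).ne
  have hp0 : p ≠ 0 := (one_pos.trans_le hp1).ne'
  obtain ⟨q, rfl⟩ : ∃ q : ℝ≥0, p = q := ⟨p.toNNReal, (ENNReal.coe_toNNReal hpt).symm⟩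
  have hq1 : (1 : ℝ) ≤ q := by exact_mod_cast hp1
  have hq2 : (q : ℝ) < 2 := by exact_mod_cast hp2
  have hq0 : (0 : ℝ) < q := by linarith
  obtain ⟨D, hD, hD'⟩ := exists_enorm_gaussianSTFT_le (d := d) (Ψ := fun t => t ^ (q : ℝ))
    ENNReal.one_ne_top ENNReal.one_ne_top (by
      intro t
      rw [one_mul]
      rcases le_total t 1 with h | h
      · exact le_add_right h
      · exact le_add_left (ENNReal.le_rpow_self_of_one_le h hq1))
  lift D to ℝ≥0 using hD.ne
  have h2q : 0 < 2 - (q : ℝ) := by linarith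
  -- The first two entries give `E^q (2 - q) ≥ 1`, which absorbs the factor `1 / (2 - q)`; the third
  -- brings the values below `t₁`.
  set E : ℝ := max (max 1 (2 - (q : ℝ))⁻¹) (D / t₁)
  have hE1 : 1 ≤ E := (le_max_left _ _).trans (le_max_left _ _)
  have hE2 : (2 - (q : ℝ))⁻¹ ≤ E := (le_max_right _ _).trans (le_max_left _ _)
  have hE3 : D ≤ t₁ * E := by
    rw [mul_comm, ← div_le_iff₀ h0]
    exact le_max_right _ _
  refine ⟨E, by positivity, fun u a ha hu => ?_⟩
  have hEa : 0 < E * a := by positivity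
  have hmod : ∫⁻ z, (‖gaussianSTFT u z‖ₑ / ENNReal.ofReal a) ^ (q : ℝ) ≤ 1 := by
    have hu' : (∫⁻ z, ‖gaussianSTFT u z‖ₑ ^ (q : ℝ)) ≤ ENNReal.ofReal a ^ (q : ℝ) := by
      rw [lebesgueModNorm, eLpNorm_eq_lintegral_rpow_enorm_toReal hp0 hpt,
        ENNReal.coe_toReal, one_div, ENNReal.rpow_inv_le_iff hq0] at hu
      exact hu
    simp_rw [ENNReal.div_rpow_of_nonneg _ _ hq0.le, div_eq_mul_inv]
    have hr : (ENNReal.ofReal a ^ (q : ℝ)) ≠ 0 :=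
      (ENNReal.rpow_pos (ENNReal.ofReal_pos.2 ha) ENNReal.ofReal_ne_top).ne'
    rw [lintegral_mul_const' _ _ (ENNReal.inv_ne_top.2 hr), ← div_eq_mul_inv]
    exact ENNReal.div_le_of_le_mul (by rwa [one_mul])
  have hb : ∀ z, ‖gaussianSTFT u z‖ ≤ t₁ * (E * a) := by
    intro z
    have h := hD' u _ (ENNReal.ofReal_pos.2 ha).ne' ENNReal.ofReal_ne_top hmod z
    rw [← ofReal_norm, ← ENNReal.ofReal_coe_nnreal, ← ENNReal.ofReal_mul ha.le,
      ENNReal.ofReal_le_ofReal_iff (by positivity)] at h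
    calc _ ≤ _ := h
      _ ≤ a * (t₁ * E) := by gcongr
      _ = _ := by ring
  refine SqLogBound.orliczNorm_le hEa hΦ_log ⟨hb, le_trans (lintegral_mono fun z => ?_) hmod⟩
  rw [← ofReal_norm_div ha, ENNReal.ofReal_rpow_of_nonneg (by positivity) hq0.le]
  refine ENNReal.ofReal_le_ofReal ((sqLog_le_rpow (by positivity) hq0 hq2).trans ?_)
  have e : ‖gaussianSTFT u z‖ / (E * a) = ‖gaussianSTFT u z‖ / a * E⁻¹ := by
    field_simp
  rw [e, Real.mul_rpow (by positivity) (by positivity), mul_div_assoc]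
  refine mul_le_of_le_one_right (by positivity) ?_
  rw [Real.inv_rpow (by positivity), div_eq_mul_inv, ← mul_inv]
  refine inv_le_one_of_one_le₀ ?_
  have h5 : E ≤ E ^ (q : ℝ) := Real.self_le_rpow_of_one_le hE1 hq1
  have h6 : 1 ≤ E * (2 - (q : ℝ)) := by rwa [← inv_le_iff_one_le_mul₀ h2q]
  nlinarith

theorem SqLogBound.lintegral_sq_le {F : RSpace d × RSpace d → ℂ} {l : ℝ} (hl : 0 < l)
    (h1 : t₁ ≤ Real.exp (-2)) (h : SqLogBound t₁ l F) :
    ∫⁻ z, ‖F z‖ₑ ^ 2 ≤ ENNReal.ofReal (l ^ 2) := by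
  calc ∫⁻ z, ‖F z‖ₑ ^ 2
      ≤ ∫⁻ z, ENNReal.ofReal (l ^ 2) * ENNReal.ofReal (sqLog (‖F z‖ / l)) := by
        refine lintegral_mono fun z => ?_
        have h2 := sq_le_sqLog (t := ‖F z‖ / l) (by positivity)
          (((div_le_iff₀ hl).2 (h.1 z)).trans h1)
        rw [← ENNReal.ofReal_mul (by positivity), ← ofReal_norm,
          ← ENNReal.ofReal_pow (norm_nonneg _)]
        refine ENNReal.ofReal_le_ofReal ?_
        rw [div_pow, div_le_iff₀ (by positivity)] at h2
        linarith
    _ = ENNReal.ofReal (l ^ 2) * ∫⁻ z, ENNReal.ofReal (sqLog (‖F z‖ / l)) :=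
        lintegral_const_mul' _ _ ENNReal.ofReal_ne_top
    _ ≤ _ := mul_le_of_le_one_right' h.2

/-- Averages preserve the modular bound, by Jensen's inequality. -/
theorem SqLogBound.of_average {F G : RSpace d × RSpace d → ℂ} {l : ℝ} (hl : 0 < l)
    (h1 : t₁ ≤ Real.exp (-2)) (h : SqLogBound t₁ l F) (hF : Measurable F)
    {ν : Measure (RSpace d × RSpace d)} [IsProbabilityMeasure ν] {H : ℝ} (hH : 0 < H)
    (hG : ∀ w, ‖G w‖ ≤ H * ∫ z, ‖F (z + w)‖ ∂ν) : SqLogBound t₁ (H * l) G := by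
  have hHl : 0 < H * l := by positivity
  have hmem : ∀ z, ‖F z‖ / l ∈ Set.Icc 0 (Real.exp (-2)) := fun z =>
    ⟨by positivity, ((div_le_iff₀ hl).2 (h.1 z)).trans h1⟩
  have hm : ∀ w, Measurable fun z => F (z + w) := fun w => hF.comp (measurable_add_const w)
  have hi : ∀ w, Integrable (fun z => ‖F (z + w)‖) ν := fun w =>
    Integrable.of_bound (hm w).norm.aestronglyMeasurable (t₁ * l)
      (Eventually.of_forall fun z => by rw [norm_norm]; exact h.1 _)
  have hb : ∀ w, ‖G w‖ ≤ t₁ * (H * l) := by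
    intro w
    refine (hG w).trans ?_
    have h2 : ∫ z, ‖F (z + w)‖ ∂ν ≤ ∫ _, t₁ * l ∂ν :=
      integral_mono (hi w) (integrable_const _) fun z => h.1 _
    rw [integral_const, probReal_univ, one_smul] at h2
    nlinarith
  refine ⟨hb, ?_⟩
  have hsm : Measurable fun z => sqLog (‖F z‖ / l) :=
    continuous_sqLog.measurable.comp (hF.norm.div_const l)
  have hnn : ∀ z, 0 ≤ sqLog (‖F z‖ / l) := fun z =>
    sqLog_nonneg (hmem z).1 ((hmem z).2.trans (Real.exp_le_one_iff.2 (by norm_num)))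
  have hle : ∀ z, sqLog (‖F z‖ / l) ≤ sqLog (Real.exp (-2)) := fun z =>
    monotoneOn_sqLog (hmem z) ⟨(Real.exp_pos _).le, le_rfl⟩ (hmem z).2
  have hsi : ∀ w, Integrable (fun z => sqLog (‖F (z + w)‖ / l)) ν := fun w =>
    Integrable.of_bound (hsm.comp (measurable_add_const w)).aestronglyMeasurable
      (sqLog (Real.exp (-2)))
      (Eventually.of_forall fun z => by
        rw [Real.norm_of_nonneg (hnn _)]
        exact hle _)
  have hJ : ∀ w, ENNReal.ofReal (sqLog (‖G w‖ / (H * l))) ≤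
      ∫⁻ z, ENNReal.ofReal (sqLog (‖F (z + w)‖ / l)) ∂ν := by
    intro w
    rw [← ofReal_integral_eq_lintegral_ofReal (hsi w) (Eventually.of_forall fun z => hnn _)]
    refine ENNReal.ofReal_le_ofReal ?_
    have h3 := convexOn_sqLog.map_integral_le (μ := ν) (f := fun z => ‖F (z + w)‖ / l)
      continuous_sqLog.continuousOn isClosed_Icc (Eventually.of_forall fun z => hmem _)
      ((hi w).div_const l) (hsi w)
    refine le_trans ?_ h3
    have h4 : ∫ z, ‖F (z + w)‖ / l ∂ν ∈ Set.Icc 0 (Real.exp (-2)) := by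
      refine (convex_Icc _ _).integral_mem isClosed_Icc
        (Eventually.of_forall fun z => hmem _) ((hi w).div_const l)
    have h5 : ‖G w‖ / (H * l) ≤ ∫ z, ‖F (z + w)‖ / l ∂ν := by
      rw [integral_div, div_le_div_iff₀ hHl hl]
      have := mul_le_mul_of_nonneg_right (hG w) hl.le
      linarith
    exact monotoneOn_sqLog ⟨by positivity, h5.trans h4.2⟩ h4 h5
  calc ∫⁻ w, ENNReal.ofReal (sqLog (‖G w‖ / (H * l)))
      ≤ ∫⁻ w, ∫⁻ z, ENNReal.ofReal (sqLog (‖F (z + w)‖ / l)) ∂ν := lintegral_mono hJ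
    _ = ∫⁻ z, (∫⁻ w, ENNReal.ofReal (sqLog (‖F (z + w)‖ / l))) ∂ν := by
        refine lintegral_lintegral_swap ?_
        exact ((hsm.ennreal_ofReal).comp
          (measurable_snd.add measurable_fst)).aemeasurable
    _ = ∫⁻ z, (∫⁻ w, ENNReal.ofReal (sqLog (‖F w‖ / l))) ∂ν := by
        refine lintegral_congr fun z => ?_
        exact lintegral_add_left_eq_self (fun w => ENNReal.ofReal (sqLog (‖F w‖ / l))) z
    _ ≤ ∫⁻ _, 1 ∂ν := lintegral_mono fun _ => h.2
    _ = 1 := by simp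

end Modular

/-! ### Representatives of distributions in `L²` and linearity of the transform -/

section L2Function

variable {d : ℕ}

theorem isL2Function_l2Function {u : 𝓢'(RSpace d, ℂ)} (h : ∃ f, IsL2Function u f) :
    IsL2Function u (l2Function u) := by
  rw [l2Function, dif_pos h]
  exact h.choose_spec

theorem IsL2Function.sub {u v : 𝓢'(RSpace d, ℂ)} {f g : RSpace d → ℂ} (hu : IsL2Function u f)
    (hv : IsL2Function v g) : IsL2Function (u - v) (f - g) := by
  refine ⟨hu.1.sub hv.1, fun ψ => ?_⟩
  have h : (u - v) ψ = u ψ - v ψ := rfl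
  have hi : ∀ {f : RSpace d → ℂ}, MemLp f 2 → Integrable fun y => ψ y * f y := fun hf =>
    (ψ.memLp 2).integrable_mul hf
  rw [h, hu.2, hv.2, ← integral_sub (hi hu.1) (hi hv.1)]
  refine integral_congr_ae (Eventually.of_forall fun y => ?_)
  simp only [Pi.sub_apply, mul_sub]

theorem IsL2Function.const_smul {u : 𝓢'(RSpace d, ℂ)} {f : RSpace d → ℂ} (hu : IsL2Function u f)
    (c : ℂ) : IsL2Function (c • u) (c • f) := by
  refine ⟨hu.1.const_smul c, fun ψ => ?_⟩
  have h : (c • u) ψ = c * u ψ := rfl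
  rw [h, hu.2, ← integral_const_mul]
  refine integral_congr_ae (Eventually.of_forall fun y => ?_)
  simp only [Pi.smul_apply, smul_eq_mul]
  ring

theorem ae_eq_zero_of_gaussianSTFT_eq_zero {u : 𝓢'(RSpace d, ℂ)} {f : RSpace d → ℂ}
    (hu : IsL2Function u f) (h0 : ∫⁻ z, ‖gaussianSTFT u z‖ₑ = 0) : f =ᵐ[volume] 0 := by
  have h1 := lintegral_stft_gaussianWindow_sq hu.1
  rw [← gaussianSTFT_eq_stft hu] at h1
  rw [lintegral_eq_zero_iff (continuous_gaussianSTFT u).enorm.measurable] at h0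
  have h2 : ∫⁻ z, ‖gaussianSTFT u z‖ₑ ^ 2 = 0 := by
    rw [lintegral_eq_zero_iff ((continuous_gaussianSTFT u).enorm.measurable.pow_const 2)]
    filter_upwards [h0] with z hz
    simpa using hz
  rw [h2, eq_comm, lintegral_eq_zero_iff' (hu.1.1.enorm.pow_const 2)] at h1
  filter_upwards [h1] with y hy
  simpa using hy

/-- The Gaussian transform is an isometry on `L²`, hence injective, so the choice made in
`l2Function` is immaterial. -/
theorem IsL2Function.ae_eq {u : 𝓢'(RSpace d, ℂ)} {f g : RSpace d → ℂ} (hf : IsL2Function u f)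
    (hg : IsL2Function u g) : f =ᵐ[volume] g := by
  have h := hf.sub hg
  have h0 : ∀ z, gaussianSTFT (u - u) z = 0 := by
    intro z
    rw [sub_self]
    exact mul_zero _
  have h1 := ae_eq_zero_of_gaussianSTFT_eq_zero h (by simp only [h0, enorm_zero, lintegral_zero])
  filter_upwards [h1] with y hy
  exact sub_eq_zero.1 hy

theorem IsL2Function.stft_l2Function {u : 𝓢'(RSpace d, ℂ)} {f : RSpace d → ℂ}
    (hf : IsL2Function u f) (φ : RSpace d → ℂ) : stft φ (l2Function u) = stft φ f :=
  stft_congr_ae (EventuallyEq.refl _ _) ((isL2Function_l2Function ⟨f, hf⟩).ae_eq hf)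

theorem integrable_stft_integrand {φ f : RSpace d → ℂ} (hφ : MemLp φ 2) (hf : MemLp f 2)
    (z : RSpace d × RSpace d) : Integrable fun y => f y * (starRingEnd ℂ) (φ (y - z.1)) *
      Complex.exp (-(Complex.I * ((inner ℝ y z.2 : ℝ) : ℂ))) := by
  have hc : Continuous fun y : RSpace d =>
      Complex.exp (-(Complex.I * ((inner ℝ y z.2 : ℝ) : ℂ))) := by fun_prop
  refine Integrable.mul_bdd (c := (1 : ℝ)) (integrable_window hφ hf z.1) hc.aestronglyMeasurable
    (Eventually.of_forall fun y => ?_)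
  rw [Complex.norm_exp]
  simp

theorem stft_sub {φ f g : RSpace d → ℂ} (hφ : MemLp φ 2) (hf : MemLp f 2) (hg : MemLp g 2)
    (z : RSpace d × RSpace d) : stft φ (f - g) z = stft φ f z - stft φ g z := by
  unfold stft
  rw [← mul_sub, ← integral_sub (integrable_stft_integrand hφ hf z)
    (integrable_stft_integrand hφ hg z)]
  congr 1
  refine integral_congr_ae (Eventually.of_forall fun y => ?_)
  simp only [Pi.sub_apply, sub_mul]

theorem stft_const_smul (φ f : RSpace d → ℂ) (c : ℂ) (z : RSpace d × RSpace d) :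
    stft φ (c • f) z = c * stft φ f z := by
  unfold stft
  rw [mul_left_comm]
  congr 1
  rw [← integral_const_mul]
  refine integral_congr_ae (Eventually.of_forall fun y => ?_)
  simp only [Pi.smul_apply, smul_eq_mul]
  ring

end L2Function

/-! ### Passing from the Gaussian window to a window in `M¹` -/

section WindowChange

variable {d : ℕ} {t₁ : ℝ}

/-- The kernel of `enorm_stft_le`, divided by its total mass, is a probability density, so
`SqLogBound.of_average` applies. The constant `H` is that mass, which is finite and nonzero by the
assumptions on `φ`. -/
theorem exists_sqLogBound_stft (h1 : t₁ ≤ Real.exp (-2)) {φ : RSpace d → ℂ} (hφ : MemLp φ 2)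
    (hφ1 : ∫⁻ z, ‖stft (gaussianWindow d) φ z‖ₑ ≠ ⊤)
    (hφ0 : ∫⁻ z, ‖stft (gaussianWindow d) φ z‖ₑ ≠ 0) :
    ∃ H : ℝ, 0 < H ∧ ∀ (f : RSpace d → ℂ) (l : ℝ), MemLp f 2 → 0 < l →
      SqLogBound t₁ l (stft (gaussianWindow d) f) → SqLogBound t₁ (H * l) (stft φ f) := by
  set K : RSpace d × RSpace d → ℝ≥0∞ :=
    fun z => ENNReal.ofReal (stftConst d) * ‖stft (gaussianWindow d) φ z‖ₑ with hK
  have hKm : Measurable K := (continuous_stft_gaussianWindow hφ).enorm.measurable.const_mul _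
  have hc0 : ENNReal.ofReal (stftConst d) ≠ 0 := (ENNReal.ofReal_pos.2 stftConst_pos).ne'
  set I : ℝ≥0∞ := ∫⁻ z, K z
  have hI : I = ENNReal.ofReal (stftConst d) * ∫⁻ z, ‖stft (gaussianWindow d) φ z‖ₑ :=
    lintegral_const_mul' _ _ ENNReal.ofReal_ne_top
  have hI0 : I ≠ 0 := by
    rw [hI]
    exact mul_ne_zero hc0 hφ0
  have hIt : I ≠ ⊤ := by
    rw [hI]
    exact ENNReal.mul_ne_top ENNReal.ofReal_ne_top hφ1
  set ν : Measure (RSpace d × RSpace d) := volume.withDensity fun z => I⁻¹ * K z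
  have hν : IsProbabilityMeasure ν := by
    refine ⟨?_⟩
    rw [withDensity_apply _ MeasurableSet.univ, setLIntegral_univ,
      lintegral_const_mul _ hKm, ENNReal.inv_mul_cancel hI0 hIt]
  have hH : 0 < I.toReal := ENNReal.toReal_pos hI0 hIt
  refine ⟨I.toReal, hH, fun f l hf hl h => h.of_average hl h1
    (continuous_stft_gaussianWindow hf).measurable (ν := ν) hH fun w => ?_⟩
  have hFm : Measurable fun z => stft (gaussianWindow d) f (z + w) :=
    ((continuous_stft_gaussianWindow hf).comp (continuous_add_const w)).measurable
  have e1 : ∫⁻ z, ‖stft (gaussianWindow d) f z‖ₑ * K (z - w) =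
      I * ∫⁻ z, ‖stft (gaussianWindow d) f (z + w)‖ₑ ∂ν := by
    rw [lintegral_withDensity_eq_lintegral_mul _ (hKm.const_mul _) hFm.enorm,
      ← lintegral_const_mul' _ _ hIt,
      ← lintegral_add_right_eq_self _ w]
    refine lintegral_congr fun z => ?_
    simp only [add_sub_cancel_right, Pi.mul_apply]
    rw [← mul_assoc I, ← mul_assoc I, ENNReal.mul_inv_cancel hI0 hIt, one_mul, mul_comm]
  have e2 := (enorm_stft_le hφ hf w).trans e1.le
  have hi : Integrable (fun z => ‖stft (gaussianWindow d) f (z + w)‖) ν :=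
    Integrable.of_bound hFm.norm.aestronglyMeasurable (t₁ * l)
      (Eventually.of_forall fun z => by rw [norm_norm]; exact h.1 _)
  have e3 : ∫⁻ z, ‖stft (gaussianWindow d) f (z + w)‖ₑ ∂ν =
      ENNReal.ofReal (∫ z, ‖stft (gaussianWindow d) f (z + w)‖ ∂ν) := by
    rw [ofReal_integral_eq_lintegral_ofReal hi (Eventually.of_forall fun z => norm_nonneg _)]
    simp_rw [ofReal_norm]
  rw [e3, ← ENNReal.ofReal_toReal hIt, ← ENNReal.ofReal_mul hH.le, ← ofReal_norm] at e2
  exact (ENNReal.ofReal_le_ofReal_iff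
    (mul_nonneg hH.le (integral_nonneg fun z => norm_nonneg _))).1 e2

end WindowChange

/-! ### Small modular bounds force small integrals -/

section ModularConvergence

theorem sqLog_mul {l s : ℝ} (hl : l ≠ 0) : sqLog (l * s) = l ^ 2 * sqLog s + s ^ 2 * sqLog l := by
  rcases eq_or_ne s 0 with rfl | hs
  · simp [sqLog]
  · rw [sqLog, Real.log_mul hl hs, sqLog, sqLog]
    ring

variable {d : ℕ} {t₁ : ℝ} {F : RSpace d × RSpace d → ℂ} {l : ℝ}

/-- In the scaling rule `sqLog_mul` the failure of homogeneity is a multiple of `s²`, with `s = ‖F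
z‖ / l`, and `s² ≤ -s² log s` in this range. -/
theorem SqLogBound.abs_sqLog_le (hl : 0 < l) (h1 : t₁ ≤ Real.exp (-2)) (h : SqLogBound t₁ l F)
    (z : RSpace d × RSpace d) :
    |sqLog ‖F z‖| ≤ (l ^ 2 + |sqLog l|) * sqLog (‖F z‖ / l) := by
  have hz : ‖F z‖ / l ≤ Real.exp (-2) := ((div_le_iff₀ hl).2 (h.1 z)).trans h1
  have h2 := sq_le_sqLog (by positivity) hz
  have e : ‖F z‖ = l * (‖F z‖ / l) := by field_simp
  have h3 : 0 ≤ sqLog (‖F z‖ / l) := (sq_nonneg _).trans h2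
  conv_lhs => rw [e, sqLog_mul hl.ne']
  refine (abs_add_le _ _).trans ?_
  rw [abs_mul, abs_mul, abs_of_nonneg h3, abs_of_nonneg (sq_nonneg l),
    abs_of_nonneg (sq_nonneg _)]
  nlinarith [abs_nonneg (sqLog l)]

/-- The bound tends to zero with `l`; this turns convergence in norm into convergence of integrals.
-/
theorem SqLogBound.lintegral_abs_sqLog_le (hl : 0 < l) (h1 : t₁ ≤ Real.exp (-2))
    (h : SqLogBound t₁ l F) :
    ∫⁻ z, ENNReal.ofReal |sqLog ‖F z‖| ≤ ENNReal.ofReal (l ^ 2 + |sqLog l|) := by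
  calc ∫⁻ z, ENNReal.ofReal |sqLog ‖F z‖|
      ≤ ∫⁻ z, ENNReal.ofReal (l ^ 2 + |sqLog l|) * ENNReal.ofReal (sqLog (‖F z‖ / l)) := by
        refine lintegral_mono fun z => ?_
        rw [← ENNReal.ofReal_mul (by positivity)]
        exact ENNReal.ofReal_le_ofReal (h.abs_sqLog_le hl h1 z)
    _ = ENNReal.ofReal (l ^ 2 + |sqLog l|) * ∫⁻ z, ENNReal.ofReal (sqLog (‖F z‖ / l)) :=
        lintegral_const_mul' _ _ ENNReal.ofReal_ne_top
    _ ≤ _ := mul_le_of_le_one_right' h.2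

theorem SqLogBound.integrable_abs_sqLog (hF : Measurable F) (hl : 0 < l)
    (h1 : t₁ ≤ Real.exp (-2)) (h : SqLogBound t₁ l F) : Integrable fun z => |sqLog ‖F z‖| := by
  refine ⟨(continuous_sqLog.measurable.comp hF.norm).norm.aestronglyMeasurable, ?_⟩
  rw [hasFiniteIntegral_iff_ofReal (Eventually.of_forall fun z => abs_nonneg _)]
  exact (h.lintegral_abs_sqLog_le hl h1).trans_lt ENNReal.ofReal_lt_top

theorem SqLogBound.integrable_sqLog (hF : Measurable F) (hl : 0 < l)
    (h1 : t₁ ≤ Real.exp (-2)) (h : SqLogBound t₁ l F) : Integrable fun z => sqLog ‖F z‖ :=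
  (integrable_norm_iff (continuous_sqLog.measurable.comp hF.norm).aestronglyMeasurable).1
    (h.integrable_abs_sqLog hF hl h1)

theorem SqLogBound.integral_abs_sqLog_le (hF : Measurable F) (hl : 0 < l)
    (h1 : t₁ ≤ Real.exp (-2)) (h : SqLogBound t₁ l F) :
    ∫ z, |sqLog ‖F z‖| ≤ l ^ 2 + |sqLog l| := by
  rw [← ENNReal.ofReal_le_ofReal_iff (by positivity), ofReal_integral_eq_lintegral_ofReal
    (h.integrable_abs_sqLog hF hl h1) (Eventually.of_forall fun z => abs_nonneg _)]
  exact h.lintegral_abs_sqLog_le hl h1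

theorem SqLogBound.memLp (hF : Measurable F) (hl : 0 < l) (h1 : t₁ ≤ Real.exp (-2))
    (h : SqLogBound t₁ l F) : MemLp F 2 := by
  refine ⟨hF.aestronglyMeasurable, ?_⟩
  have h2 := (h.lintegral_sq_le hl h1).trans_lt ENNReal.ofReal_lt_top
  rw [← eLpNorm_two_sq] at h2
  exact (ENNReal.pow_lt_top_iff.1 h2).resolve_right two_ne_zero

theorem SqLogBound.integrable_sq (hF : Measurable F) (hl : 0 < l) (h1 : t₁ ≤ Real.exp (-2))
    (h : SqLogBound t₁ l F) : Integrable fun z => ‖F z‖ ^ 2 :=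
  (memLp_two_iff_integrable_sq_norm hF.aestronglyMeasurable).1 (h.memLp hF hl h1)

theorem SqLogBound.integral_sq_le (hF : Measurable F) (hl : 0 < l) (h1 : t₁ ≤ Real.exp (-2))
    (h : SqLogBound t₁ l F) : ∫ z, ‖F z‖ ^ 2 ≤ l ^ 2 := by
  rw [← ENNReal.ofReal_le_ofReal_iff (by positivity),
    ← lintegral_sq_enorm_eq_ofReal (h.memLp hF hl h1)]
  exact h.lintegral_sq_le hl h1

end ModularConvergence

/-! ### Pointwise perturbation estimates -/

section Pointwise

theorem abs_sqLog (t : ℝ) : |sqLog t| = t ^ 2 * |Real.log t| := by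
  rw [sqLog, abs_neg, abs_mul, abs_of_nonneg (sq_nonneg t)]

theorem abs_log_le_add_inv {s : ℝ} (hs : 0 < s) : |Real.log s| ≤ s + s⁻¹ := by
  have h1 := Real.log_le_self hs.le
  have h2 := Real.log_le_self (inv_nonneg.2 hs.le)
  rw [Real.log_inv] at h2
  have := inv_pos.2 hs
  rw [abs_le]
  constructor <;> linarith

/-- For the regime in which the increment dominates: `b < 2 g` and `|a - b| ≤ g` put both `a` and
`b` below `3 g`. -/
theorem abs_sqLog_le_of_le_three_mul {t g : ℝ} (ht : 0 ≤ t) (h : t ≤ 3 * g) :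
    |sqLog t| ≤ 30 * (g ^ 2 + |sqLog g|) := by
  rcases ht.eq_or_lt with rfl | ht
  · have : sqLog 0 = 0 := by simp [sqLog]
    rw [this, abs_zero]
    positivity
  have hg : 0 < g := by linarith
  obtain ⟨s, rfl⟩ : ∃ s, t = g * s := ⟨t / g, by field_simp⟩
  have hs : 0 < s := pos_of_mul_pos_right ht hg.le
  have hs3 : s ≤ 3 := by
    rw [mul_comm] at h
    exact le_of_mul_le_mul_right h hg
  rw [sqLog_mul hg.ne']
  refine (abs_add_le _ _).trans ?_
  rw [abs_mul, abs_mul, abs_of_nonneg (sq_nonneg g), abs_of_nonneg (sq_nonneg s), abs_sqLog s]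
  have h1 : s ^ 2 * |Real.log s| ≤ 30 := by
    calc s ^ 2 * |Real.log s| ≤ s ^ 2 * (s + s⁻¹) := by
          gcongr
          exact abs_log_le_add_inv hs
      _ = s ^ 3 + s := by field_simp
      _ ≤ 3 ^ 3 + 3 := by gcongr
      _ = 30 := by norm_num
  have h2 : s ^ 2 ≤ 30 := by nlinarith
  nlinarith [sq_nonneg g, abs_nonneg (sqLog g), mul_le_mul_of_nonneg_left h1 (sq_nonneg g),
    mul_le_mul_of_nonneg_right h2 (abs_nonneg (sqLog g))]

theorem abs_log_le_of_mem {b t : ℝ} (hb : 0 < b) (h1 : b / 2 ≤ t) (h2 : t ≤ 2 * b) :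
    |Real.log t| ≤ |Real.log b| + 1 := by
  have ht : 0 < t := by linarith
  have hlog2 : Real.log 2 ≤ 1 := by linarith [Real.log_two_lt_d9]
  have h3 := Real.log_le_log ht h2
  have h4 := Real.log_le_log (by linarith) h1
  rw [Real.log_mul two_ne_zero hb.ne'] at h3
  rw [Real.log_div hb.ne' two_ne_zero] at h4
  rw [abs_le]
  constructor
  · linarith [neg_abs_le (Real.log b)]
  · linarith [le_abs_self (Real.log b)]

/-- The mean value inequality on `[b / 2, 2 b]`, where logarithms differ from `log b` by at most
one. -/
theorem abs_sqLog_sub_le {a b g : ℝ} (hb : 0 < b) (h : |a - b| ≤ g) (hg : g ≤ b / 2) :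
    |sqLog a - sqLog b| ≤ 10 * (g * b * (|Real.log b| + 1)) := by
  have hab := abs_le.1 h
  have hconv : Convex ℝ (Set.Icc (b / 2) (2 * b)) := convex_Icc _ _
  have h1 := hconv.norm_image_sub_le_of_norm_hasDerivWithin_le
    (f := sqLog) (f' := fun t => -(2 * (t * Real.log t) + t)) (x := b) (y := a)
    (C := 10 * (b * (|Real.log b| + 1)))
    (fun t ht => (hasDerivAt_sqLog (by linarith [ht.1])).hasDerivWithinAt) ?_
    ⟨by linarith, by linarith⟩ ⟨by linarith, by linarith⟩
  · rw [Real.norm_eq_abs, Real.norm_eq_abs] at h1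
    refine h1.trans ?_
    have : 0 ≤ 10 * (b * (|Real.log b| + 1)) := by positivity
    nlinarith
  · intro t ht
    have ht0 : 0 < t := by linarith [ht.1]
    have h2 := abs_log_le_of_mem hb ht.1 ht.2
    rw [norm_neg, Real.norm_eq_abs]
    refine (abs_add_le _ _).trans ?_
    rw [abs_mul, abs_mul, abs_of_pos ht0, abs_of_pos (two_pos : (0 : ℝ) < 2)]
    have h3 : t * |Real.log t| ≤ (2 * b) * (|Real.log b| + 1) :=
      mul_le_mul ht.2 h2 (abs_nonneg _) (by linarith)
    nlinarith [ht.2, mul_nonneg hb.le (abs_nonneg (Real.log b))]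

/-- Perturbation bound for `-t² log t`: small multiples of the function at `b` plus large multiples
of the function at the increment. -/
theorem abs_sqLog_sub_le_add {ε M a b g : ℝ} (hε : 0 < ε) (hM : 1 ≤ M) (ha : 0 ≤ a)
    (hb0 : 0 ≤ b) (hbM : b ≤ M) (h : |a - b| ≤ g) :
    |sqLog a - sqLog b| ≤ 10 * ε * (b ^ 2 + |sqLog b|) +
      (10 / ε + 60) * ((1 + Real.log M) * g ^ 2 + |sqLog g|) := by
  have hab := abs_le.1 h
  have hg0 : 0 ≤ g := (abs_nonneg _).trans h
  have hlM := Real.log_nonneg hM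
  have hp : 0 ≤ 10 / ε := by positivity
  have hq1 : 0 ≤ Real.log M * g ^ 2 := by positivity
  have hq2 : 0 ≤ g ^ 2 + |sqLog g| := by positivity
  -- Either the increment dominates and both values are estimated separately, or it is small
  -- relative to `b` and the derivative bound applies.
  rcases lt_or_ge (b / 2) g with hgb | hgb
  · have h1 := abs_sqLog_le_of_le_three_mul (g := g) ha (by linarith)
    have h2 := abs_sqLog_le_of_le_three_mul (g := g) hb0 (by linarith)
    have h3 : |sqLog a - sqLog b| ≤ |sqLog a| + |sqLog b| := abs_sub _ _
    have h4 : 0 ≤ 10 * ε * (b ^ 2 + |sqLog b|) := by positivity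
    nlinarith [mul_nonneg hp hq1, mul_nonneg hp hq2]
  · rcases hg0.eq_or_lt with rfl | hg
    · have : a = b := by linarith
      rw [this, sub_self, abs_zero]
      positivity
    have hb : 0 < b := by linarith
    refine (abs_sqLog_sub_le hb h hgb).trans ?_
    rw [abs_sqLog b, abs_sqLog g]
    -- The logarithm of `b` must be traded for that of `g` in the term multiplying `g²`: for `b ≤ 1`
    -- use `g ≤ b`, for `b ≥ 1` use `b ≤ M`.
    have hlog : |Real.log b| ≤ |Real.log g| + Real.log M := by
      rcases le_total b 1 with hb1 | hb1
      · rw [abs_of_nonpos (Real.log_nonpos hb.le hb1), abs_of_nonpos (Real.log_nonpos hg.le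
          (by linarith))]
        have := Real.log_le_log hg (by linarith : g ≤ b)
        linarith
      · rw [abs_of_nonneg (Real.log_nonneg hb1)]
        have := Real.log_le_log hb hbM
        linarith [abs_nonneg (Real.log g)]
    have hamgm : g * b ≤ ε * b ^ 2 + 1 / ε * g ^ 2 := by
      have h5 : 0 ≤ (ε * b - g / 2) ^ 2 / ε := by positivity
      have h6 : (ε * b - g / 2) ^ 2 / ε = ε * b ^ 2 - g * b + 1 / ε * g ^ 2 / 4 := by
        field_simp
        ring
      have h7 : 0 ≤ 1 / ε * g ^ 2 := by positivity
      linarith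
    have hL : 0 ≤ |Real.log b| + 1 := by positivity
    have h8 := mul_le_mul_of_nonneg_right hamgm hL
    have h9 : 1 / ε * g ^ 2 * (|Real.log b| + 1) ≤
        1 / ε * g ^ 2 * (|Real.log g| + Real.log M + 1) := by
      gcongr
    have h10 : 10 / ε * ((1 + Real.log M) * g ^ 2 + g ^ 2 * |Real.log g|) =
        10 * (1 / ε * g ^ 2 * (|Real.log g| + Real.log M + 1)) := by ring
    have h11 : 0 ≤ 60 * ((1 + Real.log M) * g ^ 2 + g ^ 2 * |Real.log g|) := by positivity
    rw [add_mul (10 / ε), h10]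
    linarith

theorem abs_sq_sub_le_add {ε a b g : ℝ} (hε : 0 < ε) (hb : 0 ≤ b) (h : |a - b| ≤ g) :
    |a ^ 2 - b ^ 2| ≤ ε * b ^ 2 + (1 / ε + 1) * g ^ 2 := by
  have hg0 : 0 ≤ g := (abs_nonneg _).trans h
  have h1 : 2 * (g * b) ≤ ε * b ^ 2 + 1 / ε * g ^ 2 := by
    have h5 : 0 ≤ (ε * b - g) ^ 2 / ε := by positivity
    have h6 : (ε * b - g) ^ 2 / ε = ε * b ^ 2 - 2 * (g * b) + 1 / ε * g ^ 2 := by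
      field_simp
      ring
    linarith
  obtain ⟨h2, h3⟩ := abs_le.1 h
  have h4 : |a ^ 2 - b ^ 2| ≤ g * (2 * b + g) := by
    rw [sq_sub_sq, abs_mul, mul_comm]
    refine mul_le_mul h ?_ (abs_nonneg _) hg0
    rw [abs_le]
    constructor <;> linarith
  linarith

end Pointwise

/-! ### Convergence of the two integrals in the entropy -/

section Convergence

variable {d : ℕ} {t₁ : ℝ}

/-- Here `ε` is fixed before `l`, so `C ε` may blow up as `ε → 0`. -/
theorem tendsto_of_forall_abs_sub_le {ι : Type*} {𝓕 : Filter ι} {f : ι → ℝ} {x A : ℝ}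
    {C : ℝ → ℝ} {κ : ℝ → ℝ} (hA : 0 ≤ A) (hκ : Tendsto κ (𝓝[>] 0) (𝓝 0))
    (h : ∀ ε > 0, ∀ l > 0, ∀ᶠ i in 𝓕, |f i - x| ≤ ε * A + C ε * κ l) : Tendsto f 𝓕 (𝓝 x) := by
  rw [Metric.tendsto_nhds]
  intro δ hδ
  set ε := δ / 2 / (A + 1)
  have hε : 0 < ε := by positivity
  have h1 : ε * A < δ / 2 := by
    have : ε * (A + 1) = δ / 2 := by
      simp only [ε]
      field_simp
    nlinarith
  have h2 : Tendsto (fun l => C ε * κ l) (𝓝[>] 0) (𝓝 0) := by simpa using hκ.const_mul (C ε)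
  obtain ⟨l, hl, hl0⟩ := ((h2.eventually (gt_mem_nhds (half_pos hδ))).and
    self_mem_nhdsWithin).exists
  filter_upwards [h ε hε l hl0] with i hi
  rw [Real.dist_eq]
  linarith

theorem tendsto_sq_add_abs_sqLog (c : ℝ) :
    Tendsto (fun l : ℝ => c * l ^ 2 + (l ^ 2 + |sqLog l|)) (𝓝[>] 0) (𝓝 0) := by
  have h : Continuous fun l : ℝ => c * l ^ 2 + (l ^ 2 + |sqLog l|) := by
    have := continuous_sqLog
    fun_prop
  have h0 := (h.tendsto 0).mono_left (nhdsWithin_le_nhds (s := Set.Ioi 0))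
  simpa [sqLog] using h0

variable {ι : Type*} {𝓕 : Filter ι} {V : ι → RSpace d × RSpace d → ℂ}
  {W : RSpace d × RSpace d → ℂ} {L : ι → ℝ} {L₀ : ℝ}

/-- Integrate `abs_sqLog_sub_le_add` with `b = |W|` and `g = |V i - W|`; the modular bound on the
difference controls the terms in `g`. -/
theorem tendsto_integral_sqLog (h1 : t₁ ≤ Real.exp (-2)) (hV : ∀ i, Measurable (V i))
    (hL : ∀ i, 0 < L i) (hVL : ∀ i, SqLogBound t₁ (L i) (V i)) (hW : Measurable W) (hL₀ : 0 < L₀)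
    (hWL : SqLogBound t₁ L₀ W)
    (h : ∀ l > 0, ∀ᶠ i in 𝓕, SqLogBound t₁ l fun z => V i z - W z) :
    Tendsto (fun i => ∫ z, sqLog ‖V i z‖) 𝓕 (𝓝 (∫ z, sqLog ‖W z‖)) := by
  set M := max 1 (t₁ * L₀)
  refine tendsto_of_forall_abs_sub_le (A := 10 * ((∫ z, ‖W z‖ ^ 2) + ∫ z, |sqLog ‖W z‖|))
    (C := fun ε => 10 / ε + 60)
    (κ := fun l => (1 + Real.log M) * l ^ 2 + (l ^ 2 + |sqLog l|)) (by positivity)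
    (tendsto_sq_add_abs_sqLog _) fun ε hε l hl => ?_
  filter_upwards [h l hl] with i hi
  have hD : Measurable fun z => V i z - W z := (hV i).sub hW
  have iW1 := hWL.integrable_sq hW hL₀ h1
  have iW2 := hWL.integrable_abs_sqLog hW hL₀ h1
  have iD1 := hi.integrable_sq hD hl h1
  have iD2 := hi.integrable_abs_sqLog hD hl h1
  have hlM : 0 ≤ Real.log M := Real.log_nonneg (le_max_left _ _)
  have hp : ∀ z, |sqLog ‖V i z‖ - sqLog ‖W z‖| ≤
      10 * ε * (‖W z‖ ^ 2 + |sqLog ‖W z‖|) +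
      (10 / ε + 60) * ((1 + Real.log M) * ‖V i z - W z‖ ^ 2 + |sqLog ‖V i z - W z‖|) := fun z =>
    abs_sqLog_sub_le_add hε (le_max_left _ _) (norm_nonneg _) (norm_nonneg _)
      ((hWL.1 z).trans (le_max_right _ _)) (abs_norm_sub_norm_le _ _)
  rw [← integral_sub ((hVL i).integrable_sqLog (hV i) (hL i) h1) (hWL.integrable_sqLog hW hL₀ h1)]
  have i1 : Integrable fun z => 10 * ε * (‖W z‖ ^ 2 + |sqLog ‖W z‖|) :=
    (iW1.add iW2).const_mul _
  have i2 : Integrable fun z => (10 / ε + 60) *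
      ((1 + Real.log M) * ‖V i z - W z‖ ^ 2 + |sqLog ‖V i z - W z‖|) :=
    ((iD1.const_mul _).add iD2).const_mul _
  have h2 := norm_integral_le_of_norm_le (f := fun z => sqLog ‖V i z‖ - sqLog ‖W z‖) (i1.add i2)
    (Eventually.of_forall hp)
  rw [Real.norm_eq_abs] at h2
  refine h2.trans ?_
  rw [integral_add' i1 i2, integral_const_mul, integral_const_mul, integral_add iW1 iW2,
    integral_add (iD1.const_mul _) iD2, integral_const_mul]
  have h3 := hi.integral_sq_le hD hl h1
  have h4 := hi.integral_abs_sqLog_le hD hl h1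
  have h5 : 0 < 10 / ε + 60 := by positivity
  have h6 : (1 + Real.log M) * (∫ z, ‖V i z - W z‖ ^ 2) ≤ (1 + Real.log M) * l ^ 2 := by gcongr
  have h7 := mul_le_mul_of_nonneg_left (add_le_add h6 h4) h5.le
  linarith

theorem tendsto_integral_sq (h1 : t₁ ≤ Real.exp (-2)) (hV : ∀ i, Measurable (V i))
    (hL : ∀ i, 0 < L i) (hVL : ∀ i, SqLogBound t₁ (L i) (V i)) (hW : Measurable W) (hL₀ : 0 < L₀)
    (hWL : SqLogBound t₁ L₀ W)
    (h : ∀ l > 0, ∀ᶠ i in 𝓕, SqLogBound t₁ l fun z => V i z - W z) :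
    Tendsto (fun i => ∫ z, ‖V i z‖ ^ 2) 𝓕 (𝓝 (∫ z, ‖W z‖ ^ 2)) := by
  refine tendsto_of_forall_abs_sub_le (A := ∫ z, ‖W z‖ ^ 2) (C := fun ε => 1 / ε + 1)
    (κ := fun l => (0 : ℝ) * l ^ 2 + (l ^ 2 + |sqLog l|)) (by positivity)
    (tendsto_sq_add_abs_sqLog _) fun ε hε l hl => ?_
  filter_upwards [h l hl] with i hi
  have hD : Measurable fun z => V i z - W z := (hV i).sub hW
  have iW1 := hWL.integrable_sq hW hL₀ h1
  have iD1 := hi.integrable_sq hD hl h1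
  have hp : ∀ z, |‖V i z‖ ^ 2 - ‖W z‖ ^ 2| ≤
      ε * ‖W z‖ ^ 2 + (1 / ε + 1) * ‖V i z - W z‖ ^ 2 := fun z =>
    abs_sq_sub_le_add hε (norm_nonneg _) (abs_norm_sub_norm_le _ _)
  rw [← integral_sub ((hVL i).integrable_sq (hV i) (hL i) h1) iW1]
  have h2 := norm_integral_le_of_norm_le (f := fun z => ‖V i z‖ ^ 2 - ‖W z‖ ^ 2) ((iW1.const_mul ε).add (iD1.const_mul (1 / ε + 1)))
    (Eventually.of_forall hp)
  rw [Real.norm_eq_abs] at h2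
  refine h2.trans ?_
  rw [integral_add' (iW1.const_mul ε) (iD1.const_mul (1 / ε + 1)), integral_const_mul,
    integral_const_mul]
  have h3 := hi.integral_sq_le hD hl h1
  have h5 : 0 < 1 / ε + 1 := by positivity
  have h7 := mul_le_mul_of_nonneg_left h3 h5.le
  have h8 : 0 ≤ (1 / ε + 1) * |sqLog l| := by positivity
  linarith

end Convergence

/-! ### Finiteness and continuity of the entropy -/

section EntropyContinuity

variable {d : ℕ} {t₁ : ℝ}

theorem negMulLog_sq (t : ℝ) : Real.negMulLog (t ^ 2) = 2 * sqLog t := by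
  rw [Real.negMulLog, sqLog, Real.log_pow]
  push_cast
  ring

theorem entropy_eq_coe {φ u : 𝓢'(RSpace d, ℂ)}
    (h : Integrable fun z => sqLog ‖stft (l2Function φ) (l2Function u) z‖) :
    entropy φ u = ((2 * (∫ z, sqLog ‖stft (l2Function φ) (l2Function u) z‖) +
      (∫ z, ‖stft (l2Function φ) (l2Function u) z‖ ^ 2) *
        Real.log (∫ z, ‖stft (l2Function φ) (l2Function u) z‖ ^ 2) : ℝ) : EReal) := by
  have h2 : Integrable fun z =>
      Real.negMulLog (‖stft (l2Function φ) (l2Function u) z‖ ^ 2) := by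
    simp_rw [negMulLog_sq]
    exact h.const_mul 2
  have h3 := integral_eq_lintegral_pos_part_sub_lintegral_neg_part h2
  have e1 := h2.lintegral_lt_top.ne
  have e2 := h2.neg.lintegral_lt_top.ne
  simp only [Pi.neg_apply] at e2
  simp only [negMulLog_sq, integral_const_mul] at h3 e1 e2
  rw [h3, entropy]
  simp only [negMulLog_sq]
  rw [EReal.coe_add, EReal.coe_sub, EReal.coe_ennreal_toReal e1, EReal.coe_ennreal_toReal e2]

/-- Only the definition of open sets is used, so no triangle inequality for `N` is required. -/
theorem FiniteNormSpace.continuous_of_tendsto {N : 𝓢'(RSpace d, ℂ) → ℝ≥0∞} {Y : Type*}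
    [TopologicalSpace Y] {f : FiniteNormSpace N → Y}
    (h : ∀ u, Tendsto f (comap (fun v => N (v.val - u.val)) (𝓝 0)) (𝓝 (f u))) :
    Continuous f := by
  refine ⟨fun s hs u hu => ?_⟩
  obtain ⟨t, ht, hts⟩ := h u (hs.mem_nhds hu)
  obtain ⟨δ, hδ, hδt⟩ := ENNReal.nhds_zero_basis.mem_iff.1 ht
  exact ⟨δ, hδ, fun v hv => hts (hδt hv)⟩

theorem SqLogBound.exists_isL2Function {u : 𝓢'(RSpace d, ℂ)} {l : ℝ} (hl : 0 < l)
    (h1 : t₁ ≤ Real.exp (-2)) (h : SqLogBound t₁ l (gaussianSTFT u)) : ∃ f, IsL2Function u f :=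
  exists_isL2Function_of_eLpNorm_lt_top (h.memLp (continuous_gaussianSTFT u).measurable hl h1).2

theorem measurable_stft {φ f : RSpace d → ℂ} (hφ : MemLp φ 2) (hf : MemLp f 2) :
    Measurable (stft φ f) :=
  (stronglyMeasurable_stft hφ.1 hf.1).measurable

/-- A norm that controls the modular of the short-time Fourier transform. -/
def ControlsModular (t₁ : ℝ) (N : 𝓢'(RSpace d, ℂ) → ℝ≥0∞) : Prop :=
  ∃ B : ℝ, 0 < B ∧ ∀ (u : 𝓢'(RSpace d, ℂ)) (l : ℝ), 0 < l → N u < ENNReal.ofReal l →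
    SqLogBound t₁ (B * l) (gaussianSTFT u)

variable {N : 𝓢'(RSpace d, ℂ) → ℝ≥0∞}

theorem lt_ofReal_toReal_add_one {x : ℝ≥0∞} (hx : x < ⊤) : x < ENNReal.ofReal (x.toReal + 1) := by
  rw [ENNReal.lt_ofReal_iff_toReal_lt hx.ne]
  linarith

theorem ControlsModular.exists_isL2Function (hN : ControlsModular t₁ N) (h1 : t₁ ≤ Real.exp (-2))
    {u : 𝓢'(RSpace d, ℂ)} (hu : N u < ⊤) : ∃ f, IsL2Function u f := by
  obtain ⟨B, hB, h⟩ := hN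
  have hl : 0 < (N u).toReal + 1 := by positivity
  exact (h u _ hl (lt_ofReal_toReal_add_one hu)).exists_isL2Function (mul_pos hB hl) h1

theorem ControlsModular.exists_sqLogBound_stft (hN : ControlsModular t₁ N)
    (h1 : t₁ ≤ Real.exp (-2)) {φ : RSpace d → ℂ} (hφ : MemLp φ 2)
    (hφ1 : ∫⁻ z, ‖stft (gaussianWindow d) φ z‖ₑ ≠ ⊤)
    (hφ0 : ∫⁻ z, ‖stft (gaussianWindow d) φ z‖ₑ ≠ 0) :
    ∃ B : ℝ, 0 < B ∧ ∀ (u : 𝓢'(RSpace d, ℂ)) (l : ℝ), 0 < l → N u < ENNReal.ofReal l →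
      SqLogBound t₁ (B * l) (stft φ (l2Function u)) := by
  obtain ⟨B, hB, h⟩ := hN
  obtain ⟨H, hH, h'⟩ := _root_.exists_sqLogBound_stft h1 hφ hφ1 hφ0
  refine ⟨H * B, mul_pos hH hB, fun u l hl hu => ?_⟩
  have h2 := h u l hl hu
  have h3 := isL2Function_l2Function (h2.exists_isL2Function (mul_pos hB hl) h1)
  rw [mul_assoc]
  refine h' _ _ h3.1 (mul_pos hB hl) ?_
  rwa [← gaussianSTFT_eq_stft h3]

/-- One argument serves `M^p` and `M^Φ`, since it uses the norm only through the modular bound. -/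
theorem ControlsModular.entropy_finite_and_continuous (hN : ControlsModular t₁ N)
    (h1 : t₁ ≤ Real.exp (-2)) {φ : 𝓢'(RSpace d, ℂ)} (hφ : MemLp (l2Function φ) 2)
    (hφ1 : ∫⁻ z, ‖stft (gaussianWindow d) (l2Function φ) z‖ₑ ≠ ⊤)
    (hφ0 : ∫⁻ z, ‖stft (gaussianWindow d) (l2Function φ) z‖ₑ ≠ 0) :
    (∀ u : FiniteNormSpace N, entropy φ u.val ≠ ⊥ ∧ entropy φ u.val ≠ ⊤) ∧
      Continuous fun u : FiniteNormSpace N => entropy φ u.val := by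
  obtain ⟨B, hB, hbd⟩ := hN.exists_sqLogBound_stft h1 hφ hφ1 hφ0
  set V : FiniteNormSpace N → RSpace d × RSpace d → ℂ :=
    fun u => stft (l2Function φ) (l2Function u.val)
  have hL2 : ∀ u : FiniteNormSpace N, IsL2Function u.val (l2Function u.val) := fun u =>
    isL2Function_l2Function (hN.exists_isL2Function h1 u.norm_lt_top)
  have hVm : ∀ u, Measurable (V u) := fun u => measurable_stft hφ (hL2 u).1
  set L : FiniteNormSpace N → ℝ := fun u => B * ((N u.val).toReal + 1)
  have hL : ∀ u, 0 < L u := fun u => mul_pos hB (by positivity)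
  have hVL : ∀ u, SqLogBound t₁ (L u) (V u) := fun u =>
    hbd _ _ (by positivity) (lt_ofReal_toReal_add_one u.norm_lt_top)
  have he : ∀ u : FiniteNormSpace N, entropy φ u.val =
      ((2 * (∫ z, sqLog ‖V u z‖) + (∫ z, ‖V u z‖ ^ 2) * Real.log (∫ z, ‖V u z‖ ^ 2) : ℝ) :
        EReal) := fun u => entropy_eq_coe ((hVL u).integrable_sqLog (hVm u) (hL u) h1)
  refine ⟨fun u => ?_, FiniteNormSpace.continuous_of_tendsto fun u => ?_⟩
  · rw [he]
    exact ⟨EReal.coe_ne_bot _, EReal.coe_ne_top _⟩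
  · have hev : ∀ l > 0, ∀ᶠ v in comap (fun v : FiniteNormSpace N => N (v.val - u.val)) (𝓝 0),
        SqLogBound t₁ l fun z => V v z - V u z := by
      intro l hl
      have h2 : ∀ᶠ v in comap (fun v : FiniteNormSpace N => N (v.val - u.val)) (𝓝 0),
          N (v.val - u.val) < ENNReal.ofReal (l / B) :=
        (eventually_lt_nhds (ENNReal.ofReal_pos.2 (by positivity))).comap _
      filter_upwards [h2] with v hv
      have h3 := hbd _ _ (by positivity) hv
      have h4 : stft (l2Function φ) (l2Function (v.val - u.val)) = fun z => V v z - V u z := by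
        -- The difference of the transforms is the transform of the difference, whose modular is
        -- controlled by the small norm of the increment.
        funext z
        rw [((hL2 v).sub (hL2 u)).stft_l2Function, stft_sub hφ (hL2 v).1 (hL2 u).1]
      rwa [h4, mul_div_cancel₀ _ hB.ne'] at h3
    simp only [he]
    refine (continuous_coe_real_ereal.tendsto _).comp ?_
    have h5 := tendsto_integral_sq h1 hVm hL hVL (hVm u) (hL u) (hVL u) hev
    have h6 := tendsto_integral_sqLog h1 hVm hL hVL (hVm u) (hL u) (hVL u) hev
    exact (h6.const_mul 2).add ((Real.continuous_mul_log.tendsto _).comp h5)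

end EntropyContinuity

/-! ### The norms of `M^Φ` and `M^p` control the modular -/

section Controls

variable {d : ℕ} {t₁ : ℝ} {Φ : ℝ≥0∞ → ℝ≥0∞}

theorem controlsModular_orliczModNorm (hΦ : IsYoungFunction Φ) (h0 : 0 < t₁)
    (h1 : t₁ ≤ Real.exp (-2))
    (hΦ_log : ∀ t : ℝ, 0 ≤ t → t ≤ t₁ → Φ (ENNReal.ofReal t) = ENNReal.ofReal (sqLog t)) :
    ControlsModular t₁ (orliczModNorm (d := d) Φ) :=
  exists_sqLogBound_gaussianSTFT hΦ h0 h1 hΦ_log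

theorem controlsModular_lebesgueModNorm (hΦ : IsYoungFunction Φ) (h0 : 0 < t₁)
    (h1 : t₁ ≤ Real.exp (-2))
    (hΦ_log : ∀ t : ℝ, 0 ≤ t → t ≤ t₁ → Φ (ENNReal.ofReal t) = ENNReal.ofReal (sqLog t))
    {p : ℝ≥0∞} (hp1 : 1 ≤ p) (hp2 : p < 2) :
    ControlsModular t₁ (lebesgueModNorm (d := d) p) := by
  obtain ⟨B, hB, h⟩ := exists_sqLogBound_gaussianSTFT (d := d) hΦ h0 h1 hΦ_log
  obtain ⟨E, hE, h'⟩ := exists_orliczModNorm_le (d := d) h0 hΦ_log hp1 hp2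
  -- The factor two supplies the strict inequality that the modular bound for `M^Φ` asks for.
  refine ⟨B * (2 * E), by positivity, fun u l hl hu => ?_⟩
  rw [mul_assoc]
  refine h u _ (by positivity) ((h' u l hl hu.le).trans_lt ?_)
  rw [ENNReal.ofReal_lt_ofReal_iff (by positivity)]
  nlinarith [mul_pos hE hl]

end Controls

/-! ### Uniform smallness of short-time Fourier transforms -/

section SupBound

variable {d : ℕ}

theorem enorm_stft_le_lintegral (φ f : RSpace d → ℂ) (z : RSpace d × RSpace d) :
    ‖stft φ f z‖ₑ ≤ ENNReal.ofReal (stftConst d) * ∫⁻ y, ‖f y‖ₑ * ‖φ (y - z.1)‖ₑ := by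
  unfold stft
  rw [enorm_mul, ← stftConst, enorm_stftConst]
  refine mul_le_mul_right ((enorm_integral_le_lintegral_enorm _).trans_eq
    (lintegral_congr fun y => ?_)) _
  have h : ‖Complex.exp (-(Complex.I * ((inner ℝ y z.2 : ℝ) : ℂ)))‖ₑ = 1 := by
    rw [← ofReal_norm, Complex.norm_exp]
    simp
  rw [enorm_mul, enorm_mul, h, mul_one, RCLike.enorm_conj]

theorem lintegral_enorm_mul_le {f g : RSpace d → ℂ} (hf : AEStronglyMeasurable f)
    (hg : AEStronglyMeasurable g) :
    ∫⁻ y, ‖f y‖ₑ * ‖g y‖ₑ ≤ eLpNorm f 2 volume * eLpNorm g 2 volume := by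
  have h := ENNReal.lintegral_mul_le_Lp_mul_Lq volume Real.HolderConjugate.two_two
    hf.enorm hg.enorm
  have e : ∀ F : RSpace d → ℂ, (∫⁻ z, ‖F z‖ₑ ^ (2 : ℝ)) ^ (1 / 2 : ℝ) = eLpNorm F 2 volume := by
    intro F
    rw [eLpNorm_eq_lintegral_rpow_enorm_toReal two_ne_zero ENNReal.ofNat_ne_top]
    simp
  rw [e, e] at h
  exact h

/-- If the functions `f i` are bounded in `L²`, and their convolutions with test functions tend to
zero uniformly, then so do their short-time Fourier transforms with windows in `L²`. -/
theorem eventually_norm_stft_le {ι : Type*} {𝓕 : Filter ι} {f : ι → RSpace d → ℂ}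
    {φ : RSpace d → ℂ} (hφ : MemLp φ 2) (hf : ∀ᶠ i in 𝓕, MemLp (f i) 2 ∧ eLpNorm (f i) 2 volume ≤ 1)
    {A : ι → ℝ≥0∞} (hA : Tendsto A 𝓕 (𝓝 0))
    (hfA : ∀ χ : RSpace d → ℂ, Continuous χ → HasCompactSupport χ → ∃ C : ℝ≥0∞, C ≠ ⊤ ∧
      ∀ᶠ i in 𝓕, ∀ x, ∫⁻ y, ‖f i y‖ₑ * ‖χ (y - x)‖ₑ ≤ C * A i) {δ : ℝ} (hδ : 0 < δ) :
    ∀ᶠ i in 𝓕, ∀ z, ‖stft φ (f i) z‖ ≤ δ := by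
  have hc : 0 < stftConst d := stftConst_pos
  set η : ℝ := δ / (2 * stftConst d)
  have hη : 0 < η := by positivity
  -- The window is split into a test function `χ`, for which the assumption gives decay, and an
  -- `L²`-small rest handled by Cauchy–Schwarz; each contributes at most `δ / 2`.
  obtain ⟨χ, hχs, hχ, hχc, hχm⟩ := hφ.exists_hasCompactSupport_eLpNorm_sub_le
    ENNReal.ofNat_ne_top (ENNReal.ofReal_pos.2 hη).ne'
  obtain ⟨C, hC, hCA⟩ := hfA χ hχc hχs
  have hCA0 : Tendsto (fun i => C * A i) 𝓕 (𝓝 0) := by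
    simpa using ENNReal.Tendsto.const_mul hA (Or.inr hC)
  filter_upwards [hf, hCA, hCA0.eventually (ge_mem_nhds (ENNReal.ofReal_pos.2 hη))]
    with i hi h1 h2 z
  have hρ : MemLp (fun y => (φ - χ) (y - z.1)) 2 := memLp_comp_sub (hφ.sub hχm) z.1
  have h3 : ∫⁻ y, ‖f i y‖ₑ * ‖φ (y - z.1)‖ₑ ≤ ENNReal.ofReal η + ENNReal.ofReal η := by
    calc ∫⁻ y, ‖f i y‖ₑ * ‖φ (y - z.1)‖ₑ
        ≤ ∫⁻ y, (‖f i y‖ₑ * ‖χ (y - z.1)‖ₑ + ‖f i y‖ₑ * ‖(φ - χ) (y - z.1)‖ₑ) := by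
          refine lintegral_mono fun y => ?_
          rw [← mul_add]
          gcongr
          have e : φ (y - z.1) = χ (y - z.1) + (φ - χ) (y - z.1) := by simp
          conv_lhs => rw [e]
          exact enorm_add_le _ _
      _ = (∫⁻ y, ‖f i y‖ₑ * ‖χ (y - z.1)‖ₑ) + ∫⁻ y, ‖f i y‖ₑ * ‖(φ - χ) (y - z.1)‖ₑ :=
          lintegral_add_right' _ (hi.1.1.enorm.mul hρ.1.enorm)
      _ ≤ ENNReal.ofReal η + 1 * ENNReal.ofReal η := by
          refine add_le_add ((h1 z.1).trans h2) ((lintegral_enorm_mul_le hi.1.1 hρ.1).trans ?_)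
          refine mul_le_mul' hi.2 ?_
          refine le_trans (le_of_eq ?_) hχ
          exact eLpNorm_comp_measurePreserving (hφ.sub hχm).1
            (measurePreserving_sub_right volume z.1)
      _ = _ := by rw [one_mul]
  have h4 := (enorm_stft_le_lintegral φ (f i) z).trans (mul_le_mul_right h3 _)
  rw [← ENNReal.ofReal_add hη.le hη.le, ← ENNReal.ofReal_mul hc.le, ← ofReal_norm,
    ENNReal.ofReal_le_ofReal_iff (by positivity)] at h4
  refine h4.trans_eq ?_
  simp only [η]
  field_simp
  ring

theorem eventually_norm_stft_le_of_tendsto_lintegral {ι : Type*} {𝓕 : Filter ι}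
    {f : ι → RSpace d → ℂ} {φ : RSpace d → ℂ} (hφ : MemLp φ 2)
    (hf : ∀ᶠ i in 𝓕, MemLp (f i) 2 ∧ eLpNorm (f i) 2 volume ≤ 1)
    (hA : Tendsto (fun i => ∫⁻ y, ‖f i y‖ₑ) 𝓕 (𝓝 0)) {δ : ℝ} (hδ : 0 < δ) :
    ∀ᶠ i in 𝓕, ∀ z, ‖stft φ (f i) z‖ ≤ δ := by
  refine eventually_norm_stft_le hφ hf hA (fun χ hχc hχs => ?_) hδ
  obtain ⟨C, hC⟩ := hχs.exists_bound_of_continuous hχc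
  refine ⟨ENNReal.ofReal C, ENNReal.ofReal_ne_top, Eventually.of_forall fun i x => ?_⟩
  rw [← lintegral_const_mul' _ _ ENNReal.ofReal_ne_top]
  refine lintegral_mono fun y => ?_
  rw [mul_comm]
  gcongr
  rw [← ofReal_norm]
  exact ENNReal.ofReal_le_ofReal (hC _)

theorem eventually_norm_stft_le_of_tendsto_sup {ι : Type*} {𝓕 : Filter ι}
    {f : ι → RSpace d → ℂ} {φ : RSpace d → ℂ} (hφ : MemLp φ 2)
    (hf : ∀ᶠ i in 𝓕, MemLp (f i) 2 ∧ eLpNorm (f i) 2 volume ≤ 1)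
    {A : ι → ℝ≥0∞} (hA : Tendsto A 𝓕 (𝓝 0)) (hfA : ∀ᶠ i in 𝓕, ∀ y, ‖f i y‖ₑ ≤ A i)
    {δ : ℝ} (hδ : 0 < δ) : ∀ᶠ i in 𝓕, ∀ z, ‖stft φ (f i) z‖ ≤ δ := by
  refine eventually_norm_stft_le hφ hf hA (fun χ hχc hχs => ?_) hδ
  have hχ := hχc.integrable_of_hasCompactSupport (μ := volume) hχs
  refine ⟨∫⁻ y, ‖χ y‖ₑ, hχ.2.ne, ?_⟩
  filter_upwards [hfA] with i hi x
  rw [← lintegral_sub_right_eq_self (fun y => ‖χ y‖ₑ) x, ← lintegral_mul_const'']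
  · refine lintegral_mono fun y => ?_
    rw [mul_comm]
    gcongr
    exact hi y
  · exact (hχc.comp (continuous_sub_right x)).enorm.aemeasurable

end SupBound

/-! ### The dilated Gaussians -/

section Gaussians

variable {d : ℕ} {r : ℝ}

theorem continuous_gaussianFamily : Continuous (gaussianFamily (d := d) r) := by
  unfold gaussianFamily
  fun_prop

theorem norm_gaussianFamily (hr : 0 < r) (y : RSpace d) : ‖gaussianFamily r y‖ =
    Real.pi ^ (-(d : ℝ) / 4) * r ^ ((d : ℝ) / 4) * Real.exp (-(r / 2 * ‖y‖ ^ 2)) := by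
  have := Real.pi_pos
  rw [gaussianFamily, Complex.norm_real, Real.norm_of_nonneg (by positivity)]

theorem integrable_exp_neg_mul_sq_norm {b : ℝ} (hb : 0 < b) :
    Integrable fun y : RSpace d => Real.exp (-b * ‖y‖ ^ 2) := by
  refine Integrable.of_integral_ne_zero ?_
  rw [GaussianFourier.integral_rexp_neg_mul_sq_norm hb]
  have := Real.pi_pos
  positivity

theorem norm_gaussianFamily_sq (hr : 0 < r) (y : RSpace d) : ‖gaussianFamily r y‖ ^ 2 =
    Real.pi ^ (-(d : ℝ) / 2) * r ^ ((d : ℝ) / 2) * Real.exp (-r * ‖y‖ ^ 2) := by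
  have e1 : -(d : ℝ) / 4 * (2 : ℕ) = -(d : ℝ) / 2 := by push_cast; ring
  have e2 : (d : ℝ) / 4 * (2 : ℕ) = (d : ℝ) / 2 := by push_cast; ring
  have e3 : ((2 : ℕ) : ℝ) * -(r / 2 * ‖y‖ ^ 2) = -r * ‖y‖ ^ 2 := by push_cast; ring
  rw [norm_gaussianFamily hr, mul_pow, mul_pow, ← Real.rpow_mul_natCast Real.pi_pos.le,
    ← Real.rpow_mul_natCast hr.le, ← Real.exp_nat_mul, e1, e2, e3]

theorem memLp_gaussianFamily (hr : 0 < r) : MemLp (gaussianFamily (d := d) r) 2 := by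
  rw [memLp_two_iff_integrable_sq_norm continuous_gaussianFamily.aestronglyMeasurable]
  simp_rw [norm_gaussianFamily_sq hr]
  exact (integrable_exp_neg_mul_sq_norm hr).const_mul _

theorem integral_norm_gaussianFamily_sq (hr : 0 < r) :
    ∫ y, ‖gaussianFamily (d := d) r y‖ ^ 2 = 1 := by
  have := Real.pi_pos
  simp_rw [norm_gaussianFamily_sq hr]
  rw [integral_const_mul, GaussianFourier.integral_rexp_neg_mul_sq_norm hr,
    finrank_euclideanSpace_fin, Real.div_rpow Real.pi_pos.le hr.le, neg_div,
    Real.rpow_neg Real.pi_pos.le]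
  field_simp

theorem eLpNorm_gaussianFamily (hr : 0 < r) :
    eLpNorm (gaussianFamily (d := d) r) 2 volume = 1 := by
  have h := lintegral_sq_enorm_eq_ofReal (memLp_gaussianFamily (d := d) hr)
  rw [integral_norm_gaussianFamily_sq hr, ENNReal.ofReal_one, ← eLpNorm_two_sq] at h
  exact (ENNReal.pow_right_strictMono two_ne_zero).injective (h.trans (one_pow 2).symm)

/-- What matters is the power `r^(-d/4)`: for `d ≥ 1` the `L¹` norm vanishes as `r → ∞`, while the
supremum, of order `r^(d/4)`, vanishes as `r → 0`. -/
theorem lintegral_enorm_gaussianFamily (hr : 0 < r) :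
    ∫⁻ y, ‖gaussianFamily (d := d) r y‖ₑ =
      ENNReal.ofReal (Real.pi ^ (-(d : ℝ) / 4) * (2 * Real.pi) ^ ((d : ℝ) / 2) *
        r ^ (-((d : ℝ) / 4))) := by
  have hpi := Real.pi_pos
  have e : ∀ y : RSpace d, ‖gaussianFamily r y‖ₑ = ENNReal.ofReal (Real.pi ^ (-(d : ℝ) / 4) *
      r ^ ((d : ℝ) / 4) * Real.exp (-(r / 2) * ‖y‖ ^ 2)) := by
    intro y
    rw [← ofReal_norm, norm_gaussianFamily hr, neg_mul]
  simp_rw [e]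
  rw [← ofReal_integral_eq_lintegral_ofReal
    ((integrable_exp_neg_mul_sq_norm (by positivity)).const_mul _)
    (Eventually.of_forall fun y => by positivity), integral_const_mul,
    GaussianFourier.integral_rexp_neg_mul_sq_norm (by positivity), finrank_euclideanSpace_fin]
  congr 1
  have e1 : Real.pi / (r / 2) = (2 * Real.pi) / r := by field_simp
  have e2 : r ^ ((d : ℝ) / 2) = r ^ ((d : ℝ) / 4) * r ^ ((d : ℝ) / 4) := by
    rw [← Real.rpow_add hr]
    ring_nf
  have e3 : 0 < r ^ ((d : ℝ) / 4) := by positivity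
  rw [e1, Real.div_rpow (by positivity) hr.le, e2, Real.rpow_neg hr.le]
  field_simp

theorem enorm_gaussianFamily_le (hr : 0 < r) (y : RSpace d) : ‖gaussianFamily r y‖ₑ ≤
    ENNReal.ofReal (Real.pi ^ (-(d : ℝ) / 4) * r ^ ((d : ℝ) / 4)) := by
  rw [← ofReal_norm, norm_gaussianFamily hr]
  have := Real.pi_pos
  refine ENNReal.ofReal_le_ofReal (mul_le_of_le_one_right (by positivity) ?_)
  rw [Real.exp_le_one_iff, neg_nonpos]
  positivity

theorem eventually_norm_stft_gaussianFamily_atTop (hd : 0 < d) {φ : RSpace d → ℂ}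
    (hφ : MemLp φ 2) {δ : ℝ} (hδ : 0 < δ) :
    ∀ᶠ r : ℝ in atTop, ∀ z, ‖stft φ (gaussianFamily r) z‖ ≤ δ := by
  have hd' : (0 : ℝ) < (d : ℝ) / 4 := by positivity
  refine eventually_norm_stft_le_of_tendsto_lintegral hφ ?_ ?_ hδ
  · filter_upwards [eventually_gt_atTop 0] with r hr
    exact ⟨memLp_gaussianFamily hr, (eLpNorm_gaussianFamily hr).le⟩
  · have h := ENNReal.tendsto_ofReal ((tendsto_rpow_neg_atTop hd').const_mul
      (Real.pi ^ (-(d : ℝ) / 4) * (2 * Real.pi) ^ ((d : ℝ) / 2)))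
    rw [mul_zero, ENNReal.ofReal_zero] at h
    refine h.congr' ?_
    filter_upwards [eventually_gt_atTop 0] with r hr
    rw [lintegral_enorm_gaussianFamily hr]

theorem eventually_norm_stft_gaussianFamily_nhdsGT (hd : 0 < d) {φ : RSpace d → ℂ}
    (hφ : MemLp φ 2) {δ : ℝ} (hδ : 0 < δ) :
    ∀ᶠ r : ℝ in 𝓝[>] 0, ∀ z, ‖stft φ (gaussianFamily r) z‖ ≤ δ := by
  have hd' : (0 : ℝ) < (d : ℝ) / 4 := by positivity
  refine eventually_norm_stft_le_of_tendsto_sup hφ (A := fun r =>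
    ENNReal.ofReal (Real.pi ^ (-(d : ℝ) / 4) * r ^ ((d : ℝ) / 4))) ?_ ?_ ?_ hδ
  · filter_upwards [self_mem_nhdsWithin] with r hr
    exact ⟨memLp_gaussianFamily hr, (eLpNorm_gaussianFamily hr).le⟩
  · have h := ENNReal.tendsto_ofReal (((Real.continuous_rpow_const hd'.le).tendsto 0).const_mul
      (Real.pi ^ (-(d : ℝ) / 4)))
    rw [Real.zero_rpow hd'.ne', mul_zero, ENNReal.ofReal_zero] at h
    exact h.mono_left nhdsWithin_le_nhds
  · filter_upwards [self_mem_nhdsWithin] with r hr y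
    exact enorm_gaussianFamily_le hr y

end Gaussians

/-! ### Blow-up and discontinuity of the entropy -/

section EntropyGrowth

variable {d : ℕ}

/-- Where `0 < |V| ≤ e^{-K}` one has `-log |V|² ≥ 2K`; since `K ≥ 0`, the integrand has no negative
part. -/
theorem le_entropy {φ u : 𝓢'(RSpace d, ℂ)} {K : ℝ} (hK : 0 ≤ K)
    (hV : MemLp (stft (l2Function φ) (l2Function u)) 2)
    (hs : ∀ z, ‖stft (l2Function φ) (l2Function u) z‖ ≤ Real.exp (-K)) :
    ((2 * K * (∫ z, ‖stft (l2Function φ) (l2Function u) z‖ ^ 2) +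
      (∫ z, ‖stft (l2Function φ) (l2Function u) z‖ ^ 2) *
        Real.log (∫ z, ‖stft (l2Function φ) (l2Function u) z‖ ^ 2) : ℝ) : EReal) ≤
      entropy φ u := by
  set V := stft (l2Function φ) (l2Function u)
  have hp : ∀ z, 2 * K * ‖V z‖ ^ 2 ≤ Real.negMulLog (‖V z‖ ^ 2) := by
    intro z
    rw [negMulLog_sq, sqLog]
    rcases (norm_nonneg (V z)).eq_or_lt with h | h
    · simp [← h]
    · have h1 : Real.log ‖V z‖ ≤ -K := by
        rw [Real.log_le_iff_le_exp h]
        exact hs z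
      nlinarith [sq_nonneg ‖V z‖]
  have hneg : ∫⁻ z, ENNReal.ofReal (-Real.negMulLog (‖V z‖ ^ 2)) = 0 := by
    rw [lintegral_eq_zero_of_ae_eq_zero]
    refine Eventually.of_forall fun z => ENNReal.ofReal_of_nonpos ?_
    rw [neg_nonpos]
    exact le_trans (by positivity) (hp z)
  have hint : Integrable fun z => ‖V z‖ ^ 2 := (memLp_two_iff_integrable_sq_norm hV.1).1 hV
  have hpos : ENNReal.ofReal (2 * K * ∫ z, ‖V z‖ ^ 2) ≤
      ∫⁻ z, ENNReal.ofReal (Real.negMulLog (‖V z‖ ^ 2)) := by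
    rw [← integral_const_mul, ofReal_integral_eq_lintegral_ofReal (hint.const_mul _)
      (Eventually.of_forall fun z => by positivity)]
    exact lintegral_mono fun z => ENNReal.ofReal_le_ofReal (hp z)
  have hpos' : ((2 * K * ∫ z, ‖V z‖ ^ 2 : ℝ) : EReal) ≤
      ((∫⁻ z, ENNReal.ofReal (Real.negMulLog (‖V z‖ ^ 2)) : ℝ≥0∞) : EReal) := by
    refine le_trans ?_ (EReal.coe_ennreal_le_coe_ennreal_iff.2 hpos)
    rw [EReal.coe_ennreal_ofReal]
    exact EReal.coe_le_coe_iff.2 (le_max_left _ _)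
  rw [entropy, EReal.coe_add]
  change _ ≤ _ - ((∫⁻ z, ENNReal.ofReal (-Real.negMulLog (‖V z‖ ^ 2)) : ℝ≥0∞) : EReal) + _
  rw [hneg, EReal.coe_ennreal_zero, sub_zero]
  exact add_le_add_left hpos' _

theorem integral_norm_stft_sq {φ f : RSpace d → ℂ} (hφ : MemLp φ 2) (hf : MemLp f 2) :
    ∫ z, ‖stft φ f z‖ ^ 2 = (∫ y, ‖f y‖ ^ 2) * ∫ y, ‖φ y‖ ^ 2 := by
  have h := lintegral_stft_sq hφ hf
  rw [lintegral_sq_enorm_eq_ofReal (memLp_stft hφ hf), lintegral_sq_enorm_eq_ofReal hφ,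
    lintegral_sq_enorm_eq_ofReal hf, ← ENNReal.ofReal_mul (by positivity)] at h
  exact (ENNReal.ofReal_eq_ofReal_iff (by positivity) (by positivity)).1 h

theorem tendsto_entropy_top {ι : Type*} {𝓕 : Filter ι} {φ : 𝓢'(RSpace d, ℂ)}
    (hφ : MemLp (l2Function φ) 2) (hφ0 : 0 < ∫ y, ‖l2Function φ y‖ ^ 2) {u : ι → 𝓢'(RSpace d, ℂ)}
    {f : ι → RSpace d → ℂ} {c : ℂ} (hc : c ≠ 0)
    (hu : ∀ᶠ i in 𝓕, IsL2Function (u i) (c • f i))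
    (hf : ∀ᶠ i in 𝓕, MemLp (f i) 2 ∧ ∫ y, ‖f i y‖ ^ 2 = 1)
    (hs : ∀ δ > 0, ∀ᶠ i in 𝓕, ∀ z, ‖stft (l2Function φ) (f i) z‖ ≤ δ) :
    Tendsto (fun i => entropy φ (u i)) 𝓕 (𝓝 ⊤) := by
  rw [EReal.tendsto_nhds_top_iff_real]
  intro x
  have hc' : 0 < ‖c‖ := norm_pos_iff.2 hc
  set N := ‖c‖ ^ 2 * ∫ y, ‖l2Function φ y‖ ^ 2
  have hN : 0 < N := by positivity
  -- By Moyal's identity `N` is the squared `L²` norm of every transform; `K` is chosen so that the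
  -- lower bound `2 K N + N log N` exceeds `x`.
  set K := max 0 ((x + 1 - N * Real.log N) / (2 * N))
  have hK : x < 2 * K * N + N * Real.log N := by
    have h1 : (x + 1 - N * Real.log N) / (2 * N) ≤ K := le_max_right _ _
    rw [div_le_iff₀ (by positivity)] at h1
    linarith
  filter_upwards [hu, hf, hs (Real.exp (-K) / ‖c‖) (by positivity)] with i h1 h2 h3
  have e1 : stft (l2Function φ) (l2Function (u i)) = stft (l2Function φ) (c • f i) :=
    h1.stft_l2Function _
  have e2 : ∫ z, ‖stft (l2Function φ) (l2Function (u i)) z‖ ^ 2 = N := by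
    rw [e1]
    simp_rw [stft_const_smul, norm_mul, mul_pow]
    rw [integral_const_mul, integral_norm_stft_sq hφ h2.1, h2.2, one_mul]
  have h4 := le_entropy (φ := φ) (u := u i) (K := K) (le_max_left _ _)
    (by
      rw [e1]
      exact memLp_stft hφ h1.1)
    (fun z => by
      rw [e1, stft_const_smul, norm_mul, mul_comm]
      exact (le_div_iff₀ hc').1 (h3 z))
  rw [e2] at h4
  exact lt_of_lt_of_le (EReal.coe_lt_coe_iff.2 hK) h4

theorem lebesgueModNorm_two_eq {u : 𝓢'(RSpace d, ℂ)} {f : RSpace d → ℂ} (h : IsL2Function u f) :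
    lebesgueModNorm 2 u = eLpNorm f 2 volume := by
  have h1 := lintegral_stft_gaussianWindow_sq h.1
  rw [← eLpNorm_two_sq, ← eLpNorm_two_sq] at h1
  rw [lebesgueModNorm, gaussianSTFT_eq_stft h]
  exact (ENNReal.pow_right_strictMono two_ne_zero).injective h1

theorem entropy_zero (φ : 𝓢'(RSpace d, ℂ)) : entropy φ 0 = 0 := by
  have h0 : IsL2Function (0 : 𝓢'(RSpace d, ℂ)) 0 := by
    refine ⟨MemLp.zero, fun ψ => ?_⟩
    simp only [Pi.zero_apply, mul_zero, integral_zero]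
    rfl
  have h : stft (l2Function φ) (l2Function (0 : 𝓢'(RSpace d, ℂ))) = fun _ => 0 := by
    rw [h0.stft_l2Function]
    funext z
    simp [stft]
  simp [entropy, h]

/-- Continuity fails at `0`: a ball about `0` contains all `c f_r` for one fixed `c ≠ 0`, and their
entropies tend to infinity as `r → ∞`, while the entropy of `0` is `0`. -/
theorem not_continuous_entropy {φ : 𝓢'(RSpace d, ℂ)} (hd : 0 < d) (hφ : MemLp (l2Function φ) 2)
    (hφ0 : 0 < ∫ y, ‖l2Function φ y‖ ^ 2) :
    ¬ Continuous fun u : ModSpace d 2 => entropy φ u.val := by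
  intro hcont
  have hzero : lebesgueModNorm 2 (0 : 𝓢'(RSpace d, ℂ)) < ⊤ := by
    rw [lebesgueModNorm_two_lt_top_iff]
    refine ⟨0, MemLp.zero, fun ψ => ?_⟩
    simp only [Pi.zero_apply, mul_zero, integral_zero]
    rfl
  have hmem : (⟨0, hzero⟩ : ModSpace d 2) ∈
      (fun u : ModSpace d 2 => entropy φ u.val) ⁻¹' Set.Iio 1 := by
    change entropy φ 0 < 1
    rw [entropy_zero]
    exact zero_lt_one
  obtain ⟨δ, hδ, hball⟩ := (isOpen_Iio.preimage hcont) _ hmem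
  obtain ⟨c, hc0, hcδ⟩ := ENNReal.lt_iff_exists_nnreal_btwn.1 hδ
  have hc : (((c : ℝ) : ℂ)) ≠ 0 := by
    have : c ≠ 0 := by
      rintro rfl
      simp at hc0
    exact_mod_cast this
  have hex : ∀ r : ℝ, ∃ u : 𝓢'(RSpace d, ℂ), 0 < r → IsL2Function u (gaussianFamily r) := by
    intro r
    by_cases hr : 0 < r
    · obtain ⟨u, hu⟩ := exists_isL2Function (memLp_gaussianFamily (d := d) hr)
      exact ⟨u, fun _ => hu⟩
    · exact ⟨0, fun h => absurd h hr⟩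
  choose u hu using hex
  have ht := tendsto_entropy_top (𝓕 := atTop) (u := fun r => ((c : ℝ) : ℂ) • u r)
    (f := fun r : ℝ => gaussianFamily r) hφ hφ0 hc
    ((eventually_gt_atTop 0).mono fun r hr => (hu r hr).const_smul _)
    ((eventually_gt_atTop 0).mono fun r hr =>
      ⟨memLp_gaussianFamily hr, integral_norm_gaussianFamily_sq hr⟩)
    fun δ hδ => eventually_norm_stft_gaussianFamily_atTop hd hφ hδ
  rw [EReal.tendsto_nhds_top_iff_real] at ht
  obtain ⟨r, hr1, hr⟩ := ((ht 1).and (eventually_gt_atTop 0)).exists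
  have hcu := (hu r hr).const_smul ((c : ℝ) : ℂ)
  have hlt : entropy φ (((c : ℝ) : ℂ) • u r) < 1 := by
    refine hball ⟨((c : ℝ) : ℂ) • u r, (lebesgueModNorm_two_lt_top_iff _).2 ⟨_, hcu⟩⟩ ?_
    change lebesgueModNorm 2 (((c : ℝ) : ℂ) • u r - 0) < δ
    rw [sub_zero, lebesgueModNorm_two_eq hcu, eLpNorm_const_smul, eLpNorm_gaussianFamily hr,
      mul_one]
    refine lt_of_eq_of_lt ?_ hcδ
    rw [← ofReal_norm, Complex.norm_real, Real.norm_of_nonneg c.coe_nonneg,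
      ENNReal.ofReal_coe_nnreal]
  exact lt_asymm hlt hr1

end EntropyGrowth

/-! ### Nonvanishing of the window -/

section Window

variable {d : ℕ} {φ : 𝓢'(RSpace d, ℂ)}

theorem not_ae_eq_zero_of_ne_zero {f : RSpace d → ℂ} (hf : IsL2Function φ f) (hφ : φ ≠ 0) :
    ¬ f =ᵐ[volume] 0 := by
  intro h
  refine hφ ?_
  ext ψ
  rw [hf.2 ψ]
  refine (integral_eq_zero_of_ae ?_).trans rfl
  filter_upwards [h] with y hy
  simp [hy]

theorem integral_norm_sq_pos_of_ne_zero {f : RSpace d → ℂ} (hf : IsL2Function φ f) (hφ : φ ≠ 0) :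
    0 < ∫ y, ‖f y‖ ^ 2 := by
  refine lt_of_le_of_ne (by positivity) fun h => not_ae_eq_zero_of_ne_zero hf hφ ?_
  rw [eq_comm, integral_eq_zero_iff_of_nonneg (fun y => by positivity)
    ((memLp_two_iff_integrable_sq_norm hf.1.1).1 hf.1)] at h
  filter_upwards [h] with y hy
  simpa using hy

end Window

/-! ### The theorem -/

theorem mainTheorem4 (d : ℕ) (hd : 0 < d)
    (Φ : ℝ≥0∞ → ℝ≥0∞) (hΦ : IsYoungFunction Φ)
    (hΦ_log : ∃ t₀ : ℝ, 0 < t₀ ∧ ∀ t : ℝ, 0 ≤ t → t ≤ t₀ →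
      Φ (ENNReal.ofReal t) = ENNReal.ofReal (-(t ^ 2 * Real.log t)))
    (φ : ModSpace d 1) (hφ : φ.val ≠ 0) :
    -- all spaces involved consist of square integrable functions, and `M² = L²`
    (∀ p : ℝ≥0∞, 1 ≤ p → p < 2 → ∀ u : ModSpace d p, ∃ f, IsL2Function u.val f) ∧
    (∀ u : OrliczModSpace d Φ, ∃ f, IsL2Function u.val f) ∧
    (∀ u : 𝓢'(RSpace d, ℂ), lebesgueModNorm 2 u < ⊤ ↔ ∃ f, IsL2Function u f) ∧
    -- the entropy is finite and continuous on `M^p`, `1 ≤ p < 2`, and on `M^Φ`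
    (∀ p : ℝ≥0∞, 1 ≤ p → p < 2 →
      (∀ u : ModSpace d p, entropy φ.val u.val ≠ ⊥ ∧ entropy φ.val u.val ≠ ⊤) ∧
      Continuous (fun u : ModSpace d p => entropy φ.val u.val)) ∧
    ((∀ u : OrliczModSpace d Φ, entropy φ.val u.val ≠ ⊥ ∧ entropy φ.val u.val ≠ ⊤) ∧
      Continuous (fun u : OrliczModSpace d Φ => entropy φ.val u.val)) ∧
    -- the entropy is discontinuous on `M²`
    ¬ Continuous (fun u : ModSpace d 2 => entropy φ.val u.val) ∧
    -- the normalized Gaussians `f_r` have entropies tending to `∞`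
    (∃ F : ℝ → ModSpace d 2,
      (∀ r : ℝ, 0 < r → IsL2Function (F r).val (gaussianFamily r) ∧
        eLpNorm (gaussianFamily (d := d) r) 2 volume = 1) ∧
      Tendsto (fun r => entropy φ.val (F r).val) atTop (𝓝 ⊤) ∧
      Tendsto (fun r => entropy φ.val (F r).val) (𝓝[>] 0) (𝓝 ⊤)) := by
  obtain ⟨t₀, ht₀, hlog⟩ := hΦ_log
  set t₁ := min t₀ (Real.exp (-2))
  have h0 : 0 < t₁ := lt_min ht₀ (Real.exp_pos _)
  have h1 : t₁ ≤ Real.exp (-2) := min_le_right _ _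
  have hΦt : ∀ t : ℝ, 0 ≤ t → t ≤ t₁ → Φ (ENNReal.ofReal t) = ENNReal.ofReal (sqLog t) :=
    fun t ht ht' => hlog t ht (ht'.trans (min_le_left _ _))
  have cΦ := controlsModular_orliczModNorm (d := d) hΦ h0 h1 hΦt
  have cp := fun p (hp1 : 1 ≤ p) (hp2 : p < 2) =>
    controlsModular_lebesgueModNorm (d := d) hΦ h0 h1 hΦt hp1 hp2
  -- The window is in `M¹`, so the inclusion into `L²` with `p = 1` applies to it.
  have hL2 : IsL2Function φ.val (l2Function φ.val) := isL2Function_l2Function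
    ((cp 1 le_rfl ENNReal.one_lt_two).exists_isL2Function h1 φ.norm_lt_top)
  have hpos := integral_norm_sq_pos_of_ne_zero hL2 hφ
  have hstft := gaussianSTFT_eq_stft hL2
  have hφ1 : ∫⁻ z, ‖stft (gaussianWindow d) (l2Function φ.val) z‖ₑ ≠ ⊤ := by
    rw [← hstft, ← eLpNorm_one_eq_lintegral_enorm]
    exact φ.norm_lt_top.ne
  have hφ0 : ∫⁻ z, ‖stft (gaussianWindow d) (l2Function φ.val) z‖ₑ ≠ 0 := by
    rw [← hstft]
    exact fun h => not_ae_eq_zero_of_ne_zero hL2 hφ (ae_eq_zero_of_gaussianSTFT_eq_zero hL2 h)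
  refine ⟨fun p hp1 hp2 u => (cp p hp1 hp2).exists_isL2Function h1 u.norm_lt_top,
    fun u => cΦ.exists_isL2Function h1 u.norm_lt_top, lebesgueModNorm_two_lt_top_iff,
    fun p hp1 hp2 => (cp p hp1 hp2).entropy_finite_and_continuous h1 hL2.1 hφ1 hφ0,
    cΦ.entropy_finite_and_continuous h1 hL2.1 hφ1 hφ0,
    not_continuous_entropy hd hL2.1 hpos, ?_⟩
  have hex : ∀ r : ℝ, ∃ u : ModSpace d 2, 0 < r → IsL2Function u.val (gaussianFamily r) := by
    intro r
    by_cases hr : 0 < r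
    · obtain ⟨u, hu⟩ := exists_isL2Function (memLp_gaussianFamily (d := d) hr)
      exact ⟨⟨u, (lebesgueModNorm_two_lt_top_iff u).2 ⟨_, hu⟩⟩, fun _ => hu⟩
    -- For `r ≤ 0` the value is irrelevant to both limits; `f_1` serves as a default element of
    -- `M²`.
    · obtain ⟨u, hu⟩ := exists_isL2Function (memLp_gaussianFamily (d := d) one_pos)
      exact ⟨⟨u, (lebesgueModNorm_two_lt_top_iff u).2 ⟨_, hu⟩⟩, fun h => absurd h hr⟩
  choose F hF using hex
  have key : ∀ 𝓕 : Filter ℝ, (∀ᶠ r in 𝓕, 0 < r) →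
      (∀ δ > 0, ∀ᶠ r in 𝓕, ∀ z, ‖stft (l2Function φ.val) (gaussianFamily r) z‖ ≤ δ) →
      Tendsto (fun r => entropy φ.val (F r).val) 𝓕 (𝓝 ⊤) := fun 𝓕 h2 h3 =>
    tendsto_entropy_top (c := 1) hL2.1 hpos one_ne_zero
      (h2.mono fun r hr => by
        rw [one_smul]
        exact hF r hr)
      (h2.mono fun r hr => ⟨memLp_gaussianFamily hr, integral_norm_gaussianFamily_sq hr⟩) h3
  exact ⟨F, fun r hr => ⟨hF r hr, eLpNorm_gaussianFamily hr⟩,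
    key _ (eventually_gt_atTop 0) fun δ hδ =>
      eventually_norm_stft_gaussianFamily_atTop hd hL2.1 hδ,
    key _ self_mem_nhdsWithin fun δ hδ =>
      eventually_norm_stft_gaussianFamily_nhdsGT hd hL2.1 hδ⟩
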